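/- **Model.** A HyTM implementation $\mathcal M$ lets $n\ge 3$ asynchronous processes run transactions over an infinite set $\mathcal X$ of t-objects with initial values, holding values from a set $V$ with $|V|\ge 2$. Each transaction $T_k$ (fast-path or slow-path, run by one process; a process runs its transactions one after another) issues $read_k(X)$ (at most once per t-object), $write_k(X,v)$ and $tryC_k$, each of which may return abort $A_k$; $tryC_k$ may return commit $C_k$. The processes are deterministic state machines applying read-modify-write primitives $\langle g,h\rangle$ to base objects; a primitive is trivial if $g$ is the identity. Slow-path transactions access the memory directly. Fast-path transactions use cached primitives, recorded in the tracking set $\tau_i$ of the process $p_i$ in shared mode (trivial primitive) or exclusive mode (nontrivial primitive). A cached primitive on $b$ by $p_i$ returns $\bot$ and empties $\tau_i$ if $|\tau_i|$ equals the fixed bound $TS$ (a *capacity abort*), or if $\tau_i$ is invalid, or if $b$ is in another process's tracking set in exclusive mode (in any mode, if the primitive is nontrivial). If $b$ is in $\tau_i$ in exclusive (resp. shared) mode, then $\tau_i$ becomes invalid when another process applies any (resp. any nontrivial) primitive to $b$. The $tryC$ of a fast-path transaction is a cache-commit, which writes the exclusive entries to memory if $\tau_i$ is valid and returns $\bot$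 otherwise. A fast-path transaction aborts as soon as it receives $\bot$. $Rset$, $Wset$ and $Dset=Rset\cup Wset$ are the sets of t-objects on which a transaction has invoked a read, a write, or either; $T_k$ is *read-only* if $Rset(T_k)\neq\emptyset=Wset(T_k)$. A transaction is *t-complete* if it has committed or aborted; $E|k$ is the subsequence of the events of $T_k$ in $E$; *real-time order* means that the first transaction is t-complete and its last event precedes the first event of the second; transactions not so ordered are *concurrent*. An execution $E$ *appears t-sequential* to $T_k\in txns(E)$ if there is an execution $E'$ with $txns(E')\subseteq txns(E)\setminus\{T_k\}$, all transactions of $E'$ t-complete, such that every $T_j$ preceding $T_k$ in the real-time order of $E$ is in $E'$ with $E|j=E'|j$; $E'$ respects the real-time order of $E$; the read and write sets of every transaction in $E'$ are contained in those in $E$; and $E'\cdot E|k$ is an execution. The base objects are partitioned into metadata objects $\mathbb M$ and, for each t-object $X$, data objects $\mathbb D_X$, such that: 1. A fast-path transaction $T_k$ accesses only objects of $\mathbb M$ and of $\mathbb D_X$, $X\in Dset(T_k)$. 2. If $E$, $E\cdot E'$, $E\cdot\rho$, $E\cdot E'\cdot\rho'$ are t-complete executions, $\rho,\rho'$ consist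 of events of a transaction $T_k\notin txns(E\cdot E')$ only and have the same history, and all transactions of $E'$ have data sets disjoint from $Dset(T_k)$, then the objects of $\mathbb D_X$, $X\in Dset(T_k)$, have the same states after $E\cdot\rho$ and after $E\cdot E'\cdot\rho'$. 3. If $E$ appears t-sequential to a fast-path transaction $T_k$ and the next event $e$ of $T_k$ after $E$ is a primitive on a data object that does not return $\bot$, then $E\cdot e$ appears t-sequential to $T_k$. $\mathcal M$ is *progressive* if, in every execution, each aborted transaction (fast-path or slow-path) incurs a capacity abort or conflicts with a concurrent transaction (their data sets share a t-object that at least one of the two writes). It is *opaque* if every prefix of the history of every execution is final-state opaque, i.e. has a completion equivalent to a legal t-complete t-sequential history that respects the real-time order. It provides *obstruction-free TM-liveness* if every t-operation returns a matching response when, from its invocation on, its transaction runs without steps of other transactions. **Theorem.** There is an absolute constant $c>0$ such that the following holds for every progressive, opaque HyTM implementation $\mathcal M$ that provides obstruction-free TM-liveness, and for every partition of its base objects as above. For every integer $m\ge 1$ there is an execution $E$ of $\mathcal M$ in which some fast-path read-only transaction $T_k$ satisfies either (1) $|Dset(T_k)|\le m$ and $T_k$ incurs a capacity abort in $E$, or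 (2) $|Dset(T_k)|=m$ and $T_k$ accesses at least $c\,m$ distinct metadata base objects in $E$. -/

import Mathlib

noncomputable section HybridTMDefinitions

open Classical

universe u₁ u₂ u₃ u₄ u₅ u₆

namespace HybridTM

/-! ### Transactions, t-operations, primitives, events -/

/-- Hardware (fast-path) or software (slow-path) transactions. -/
inductive Path where
  | fast
  | slow

/-- A transaction identifier. It records the process that executes the transaction and whether
the transaction is fast-path or slow-path; every process has infinitely many identifiers of
either kind at its disposal. -/
structure Txn (n : ℕ) where
  proc : Fin n
  path : Path
  idx : ℕ

/-- Invocations of t-operations on t-objects `X` with values in `V`. -/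
inductive TOp (X : Type u₁) (V : Type u₂) where
  | read (x : X)
  | write (x : X) (v : V)
  | tryC

/-- Responses of t-operations; `commit` is `C_k` and `abort` is `A_k`. -/
inductive TResp (V : Type u₂) where
  | value (v : V)
  | ok
  | commit
  | abort

/-- The responses that match an invocation. -/
def TOp.Matches {X : Type u₁} {V : Type u₂} : TOp X V → TResp V → Prop
  | _, .abort => True
  | .read _, .value _ => True
  | .write _ _, .ok => True
  | .tryC, .commit => True
  | _, _ => False

/-- The responses that end a transaction. -/
def TResp.Final {V : Type u₂} (r : TResp V) : Prop := r = .commit ∨ r = .abort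

/-- A read-modify-write primitive `⟨g, h⟩`: update function and response function. -/
structure Prim (W : Type u₄) (R : Type u₅) where
  update : W → W
  result : W → R

/-- A primitive is trivial if it never changes the value of the base object. -/
def Prim.Trivial {W : Type u₄} {R : Type u₅} (p : Prim W R) : Prop := ∀ w, p.update w = w

/-- The outcome of a primitive: a response, or `⊥`. The two kinds of `⊥` are told apart for
bookkeeping only; the process that applies the primitive just sees `⊥`. -/
inductive Outcome (R : Type u₅) where
  | value (r : R)
  | capacityAbort
  | trackingAbort

/-- Events. A primitive is a cached one if its transaction is fast-path, a direct one if its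
transaction is slow-path. The flag of `cacheCommit` says whether it returned `commit` or `⊥`. -/
inductive Event (n : ℕ) (X : Type u₁) (V : Type u₂) (B : Type u₃) (W : Type u₄)
    (R : Type u₅) where
  | inv (T : Txn n) (op : TOp X V)
  | resp (T : Txn n) (r : TResp V)
  | prim (T : Txn n) (b : B) (p : Prim W R) (o : Outcome R)
  | cacheCommit (T : Txn n) (success : Bool)

section Histories

variable {n : ℕ} {X : Type u₁} {V : Type u₂} {B : Type u₃} {W : Type u₄} {R : Type u₅}

/-- The transaction that performs an event. -/
def Event.txn : Event n X V B W R → Txn n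
  | .inv T _ => T
  | .resp T _ => T
  | .prim T _ _ _ => T
  | .cacheCommit T _ => T

/-- Invocations and responses of t-operations. -/
def Event.IsTOpEvent : Event n X V B W R → Prop
  | .inv _ _ => True
  | .resp _ _ => True
  | _ => False

/-- The history exported by a sequence of events. -/
def history (E : List (Event n X V B W R)) : List (Event n X V B W R) :=
  E.filter (fun e => decide e.IsTOpEvent)

/-- The transactions that participate in `E`. -/
def txns (E : List (Event n X V B W R)) : Set (Txn n) := {T | ∃ e ∈ E, e.txn = T}

/-- `E | T`: the subsequence of the events of `T`. -/
def proj (E : List (Event n X V B W R)) (T : Txn n) : List (Event n X V B W R) :=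
  E.filter (fun e => decide (e.txn = T))

def Committed (E : List (Event n X V B W R)) (T : Txn n) : Prop :=
  (proj E T).getLast? = some (.resp T .commit)

def Aborted (E : List (Event n X V B W R)) (T : Txn n) : Prop :=
  (proj E T).getLast? = some (.resp T .abort)

/-- `T` is t-complete in `E`. -/
def TComplete (E : List (Event n X V B W R)) (T : Txn n) : Prop :=
  Committed E T ∨ Aborted E T

/-- `E` is t-complete; for executions, the configuration after `E` is t-quiescent. -/
def AllTComplete (E : List (Event n X V B W R)) : Prop := ∀ T ∈ txns E, TComplete E T

/-- Real-time order: `T` is t-complete and its last event precedes the first event of `T'`. -/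
def Precedes (E : List (Event n X V B W R)) (T T' : Txn n) : Prop :=
  T ∈ txns E ∧ T' ∈ txns E ∧ TComplete E T ∧
    ∃ E₁ E₂, E = E₁ ++ E₂ ∧ T' ∉ txns E₁ ∧ T ∉ txns E₂

def Concurrent (E : List (Event n X V B W R)) (T T' : Txn n) : Prop :=
  T ∈ txns E ∧ T' ∈ txns E ∧ T ≠ T' ∧ ¬ Precedes E T T' ∧ ¬ Precedes E T' T

/-- No two transactions of `E` are concurrent. -/
def TSequential (E : List (Event n X V B W R)) : Prop := ∀ T T', ¬ Concurrent E T T'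

/-- Read set, write set and data set of a transaction. -/
def Rset (E : List (Event n X V B W R)) (T : Txn n) : Set X := {x | .inv T (.read x) ∈ E}

def Wset (E : List (Event n X V B W R)) (T : Txn n) : Set X := {x | ∃ v, .inv T (.write x v) ∈ E}

def Dset (E : List (Event n X V B W R)) (T : Txn n) : Set X := Rset E T ∪ Wset E T

def ReadOnly (E : List (Event n X V B W R)) (T : Txn n) : Prop :=
  (Rset E T).Nonempty ∧ Wset E T = ∅

/-- `T` and `T'` conflict in `E` on some t-object. -/
def Conflict (E : List (Event n X V B W R)) (T T' : Txn n) : Prop :=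
  ∃ x, x ∈ Dset E T ∩ Dset E T' ∧ x ∈ Wset E T ∪ Wset E T'

/-- `T` incurs a capacity abort in `E`. -/
def CapacityAborts (E : List (Event n X V B W R)) (T : Txn n) : Prop :=
  ∃ b p, .prim T b p .capacityAbort ∈ E

/-- `T` accesses the base object `b` in `E`. -/
def Accesses (E : List (Event n X V B W R)) (T : Txn n) (b : B) : Prop :=
  ∃ p o, .prim T b p o ∈ E

/-! ### Opacity -/

/-- What a completion appends to the events `h = H | T` of a transaction: nothing if it is
t-complete, `A` after a pending t-read or t-write, `C` or `A` after a pending `tryC`, and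
`tryC · A` if it is complete but not t-complete. -/
inductive CompletionSuffix (T : Txn n) (h : List (Event n X V B W R)) :
    List (Event n X V B W R) → Prop
  | tComplete (r : TResp V) (hr : r.Final) (hl : h.getLast? = some (.resp T r)) :
      CompletionSuffix T h []
  | pendingAbort (op : TOp X V) (hl : h.getLast? = some (.inv T op)) :
      CompletionSuffix T h [.resp T .abort]
  | pendingCommit (hl : h.getLast? = some (.inv T .tryC)) :
      CompletionSuffix T h [.resp T .commit]
  | complete (r : TResp V) (hr : ¬ r.Final) (hl : h.getLast? = some (.resp T r)) :
      CompletionSuffix T h [.inv T .tryC, .resp T .abort]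

/-- `H'` is a completion of the history `H`. -/
def IsCompletion (H H' : List (Event n X V B W R)) : Prop :=
  H.Sublist H' ∧ txns H' = txns H ∧
    ∀ T ∈ txns H, ∃ s, CompletionSuffix T (proj H T) s ∧ proj H' T = proj H T ++ s

/-- Equivalence of histories. -/
def Equivalent (H H' : List (Event n X V B W R)) : Prop :=
  txns H = txns H' ∧ ∀ T ∈ txns H, proj H T = proj H' T

/-- The value written to `x` by an event of one of the transactions satisfying `P`. -/
def writtenValue (P : Txn n → Prop) (x : X) : Event n X V B W R → Option V
  | .inv T (.write y v) => if P T ∧ y = x then some v else none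
  | _ => none

/-- The latest written value of `x` for a t-read of `T` that comes right after the prefix `S₁`
of the t-sequential history `S`: the value of the latest preceding write of `T` itself to `x`
if there is one; otherwise that of the latest preceding write to `x` of a committed
transaction, the initial value of `x` counting as written before `S`. -/
def latestValue (init : X → V) (S S₁ : List (Event n X V B W R)) (T : Txn n) (x : X) : V :=
  ((S₁.filterMap (writtenValue (fun T' => T' = T) x)).getLast?).getD
    (((S₁.filterMap (writtenValue (Committed S) x)).getLast?).getD (init x))

/-- Legality of a t-sequential history: each t-read that returns a value (i.e. does not abort)
returns the latest written value. In the histories below the response of a t-read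
immediately follows its invocation. -/
def Legal (init : X → V) (S : List (Event n X V B W R)) : Prop :=
  ∀ S₁ S₂ T x v, S = S₁ ++ .inv T (.read x) :: .resp T (.value v) :: S₂ →
    v = latestValue init S S₁ T x

def FinalStateOpaque (init : X → V) (H : List (Event n X V B W R)) : Prop :=
  ∃ S, AllTComplete S ∧ TSequential S ∧ Legal init S ∧
    (∀ T ∈ txns H, ∀ T' ∈ txns H, Precedes H T T' → Precedes S T T') ∧
    ∃ H', IsCompletion H H' ∧ Equivalent S H'

/-- A finite history is opaque if all of its prefixes are final-state opaque. -/
def OpaqueHistory (init : X → V) (H : List (Event n X V B W R)) : Prop :=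
  ∀ H', H' <+: H → FinalStateOpaque init H'

end Histories

/-! ### HyTM implementations and their executions -/

/-- The next event of the algorithm inside a t-operation: a primitive on a base object, or the
response of the t-operation. -/
inductive Action (V : Type u₂) (B : Type u₃) (W : Type u₄) (R : Type u₅) where
  | prim (b : B) (p : Prim W R)
  | respond (r : TResp V)

/-- A HyTM implementation for `n` processes: the size of the tracking sets, the initial values of
the t-objects and of the base objects, and a deterministic state machine with states in `Q`
for every process. The identifier of a transaction includes its process and its path, so
that processes may run different algorithms, and separate ones on the two paths.
`onResult` receives the response of a primitive, `none` standing for `⊥`. -/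
structure Implementation (n : ℕ) (X : Type u₁) (V : Type u₂) (B : Type u₃) (W : Type u₄)
    (R : Type u₅) (Q : Type u₆) where
  trackingSize : ℕ
  initVal : X → V
  initMem : B → W
  initState : Fin n → Q
  onInvoke : Txn n → TOp X V → Q → Q
  next : Txn n → Q → Action V B W R
  onResult : Txn n → Option R → Q → Q
  onCacheCommit : Txn n → Bool → Q → Q

inductive Mode where
  | shared
  | exclusive

/-- A tracking set: at most one (value, mode) entry for every base object. -/
abbrev TrackingSet (B : Type u₃) (W : Type u₄) := B → Option (W × Mode)

/-- The number of entries of a tracking set. -/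
def TrackingSet.size {B : Type u₃} {W : Type u₄} (τ : TrackingSet B W) : ℕ :=
  {b | τ b ≠ none}.ncard

/-- `b` is present in `τ` in exclusive mode, or in any mode if `p` is nontrivial. -/
def Clashes {B : Type u₃} {W : Type u₄} {R : Type u₅} (τ : TrackingSet B W) (b : B)
    (p : Prim W R) : Prop :=
  match τ b with
  | none => False
  | some (_, .exclusive) => True
  | some (_, .shared) => ¬ p.Trivial

/-- What a process is doing: no transaction is running; a transaction is running and may invoke
its next t-operation; a t-operation is being executed; a fast-path transaction has received
`⊥` and must abort; a fast-path transaction has performed its cache-commit and must commit. -/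
inductive Phase (n : ℕ) (X : Type u₁) (V : Type u₂) where
  | idle
  | ready (T : Txn n)
  | busy (T : Txn n) (op : TOp X V)
  | doomed (T : Txn n)
  | flushed (T : Txn n)

/-- Configurations: base objects, local states, tracking sets and their validity, phases. -/
structure Config (n : ℕ) (X : Type u₁) (V : Type u₂) (B : Type u₃) (W : Type u₄)
    (Q : Type u₆) where
  mem : B → W
  loc : Fin n → Q
  track : Fin n → TrackingSet B W
  valid : Fin n → Prop
  phase : Fin n → Phase n X V

section Executions

variable {n : ℕ} {X : Type u₁} {V : Type u₂} {B : Type u₃} {W : Type u₄} {R : Type u₅}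
  {Q : Type u₆}

/-- Process `i` applies `p` to `b`: the tracking sets of other processes in which `b` is present
in exclusive mode (in any mode if `p` is nontrivial) become invalid. -/
def Config.invalidate (C : Config n X V B W Q) (i : Fin n) (b : B) (p : Prim W R) :
    Config n X V B W Q :=
  { C with valid := fun j => C.valid j ∧ ¬ (j ≠ i ∧ Clashes (C.track j) b p) }

/-- Empty the tracking set of process `i`. -/
def Config.clear (C : Config n X V B W Q) (i : Fin n) : Config n X V B W Q :=
  { C with
    track := Function.update C.track i (fun _ => none)
    valid := Function.update C.valid i True }

def Config.setPhase (C : Config n X V B W Q) (i : Fin n) (φ : Phase n X V) :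
    Config n X V B W Q :=
  { C with phase := Function.update C.phase i φ }

def Config.setLoc (C : Config n X V B W Q) (i : Fin n) (q : Q) : Config n X V B W Q :=
  { C with loc := Function.update C.loc i q }

/-- The value of `b` seen by a cached access of process `i`. -/
def Config.cachedValue (C : Config n X V B W Q) (i : Fin n) (b : B) : W :=
  match C.track i b with
  | some (w, _) => w
  | none => C.mem b

/-- The mode of `b` after an access of process `i` with `p`; an exclusive entry stays exclusive. -/
def Config.newMode (C : Config n X V B W Q) (i : Fin n) (b : B) (p : Prim W R) : Mode :=
  match C.track i b with
  | some (_, .exclusive) => .exclusive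
  | _ => if p.Trivial then .shared else .exclusive

/-- A successful cached access of process `i`. -/
def Config.trackAccess (C : Config n X V B W Q) (i : Fin n) (b : B) (p : Prim W R) :
    Config n X V B W Q :=
  { C with
    track := Function.update C.track i
      (Function.update (C.track i) b (some (p.update (C.cachedValue i b), C.newMode i b p))) }

/-- Cache-commit: the exclusive entries of process `i` are written to memory. -/
def Config.flush (C : Config n X V B W Q) (i : Fin n) : Config n X V B W Q :=
  { C with
    mem := fun b => match C.track i b with
      | some (w, .exclusive) => w
      | _ => C.mem b }

namespace Implementation

variable (M : Implementation n X V B W R Q)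

def initConfig : Config n X V B W Q where
  mem := M.initMem
  loc := M.initState
  track := fun _ _ => none
  valid := fun _ => True
  phase := fun _ => .idle

/-- The configuration after `T` has received `⊥`; `T` can only return `A` next. -/
def bottom (T : Txn n) (C : Config n X V B W Q) (q : Q) : Config n X V B W Q :=
  ((C.clear T.proc).setLoc T.proc q).setPhase T.proc (.doomed T)

/-- `Step M E C e C'`: in the configuration `C` reached by the execution `E`, the event `e` may
occur, and it leads to `C'`. Invocations are chosen by the environment, which respects
well-formedness and reads a t-object at most once in a transaction. -/
inductive Step (E : List (Event n X V B W R)) :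
    Config n X V B W Q → Event n X V B W R → Config n X V B W Q → Prop
  | invoke (C : Config n X V B W Q) (T : Txn n) (op : TOp X V)
      (hphase : (C.phase T.proc = .idle ∧ T ∉ txns E) ∨ C.phase T.proc = .ready T)
      (hread : ∀ x, op = .read x → x ∉ Rset E T) :
      Step E C (.inv T op)
        ((C.setLoc T.proc (M.onInvoke T op (C.loc T.proc))).setPhase T.proc (.busy T op))
  | direct (C : Config n X V B W Q) (T : Txn n) (op : TOp X V) (b : B) (p : Prim W R)
      (hpath : T.path = .slow) (hphase : C.phase T.proc = .busy T op)
      (hnext : M.next T (C.loc T.proc) = .prim b p) :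
      Step E C (.prim T b p (.value (p.result (C.mem b))))
        { (C.invalidate T.proc b p).setLoc T.proc
            (M.onResult T (some (p.result (C.mem b))) (C.loc T.proc)) with
          mem := Function.update C.mem b (p.update (C.mem b)) }
  | cachedCapacity (C : Config n X V B W Q) (T : Txn n) (op : TOp X V) (b : B) (p : Prim W R)
      (hpath : T.path = .fast) (hphase : C.phase T.proc = .busy T op) (hop : op ≠ .tryC)
      (hnext : M.next T (C.loc T.proc) = .prim b p)
      (hsize : (C.track T.proc).size = M.trackingSize) :
      Step E C (.prim T b p .capacityAbort)
        (bottom T C (M.onResult T none (C.loc T.proc)))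
  | cachedInvalid (C : Config n X V B W Q) (T : Txn n) (op : TOp X V) (b : B) (p : Prim W R)
      (hpath : T.path = .fast) (hphase : C.phase T.proc = .busy T op) (hop : op ≠ .tryC)
      (hnext : M.next T (C.loc T.proc) = .prim b p)
      (hsize : (C.track T.proc).size ≠ M.trackingSize) (hvalid : ¬ C.valid T.proc) :
      Step E C (.prim T b p .trackingAbort)
        (bottom T C (M.onResult T none (C.loc T.proc)))
  | cachedClash (C : Config n X V B W Q) (T : Txn n) (op : TOp X V) (b : B) (p : Prim W R)
      (hpath : T.path = .fast) (hphase : C.phase T.proc = .busy T op) (hop : op ≠ .tryC)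
      (hnext : M.next T (C.loc T.proc) = .prim b p)
      (hsize : (C.track T.proc).size ≠ M.trackingSize) (hvalid : C.valid T.proc)
      (hclash : ∃ j, j ≠ T.proc ∧ Clashes (C.track j) b p) :
      Step E C (.prim T b p .trackingAbort)
        (bottom T (C.invalidate T.proc b p) (M.onResult T none (C.loc T.proc)))
  | cached (C : Config n X V B W Q) (T : Txn n) (op : TOp X V) (b : B) (p : Prim W R)
      (hpath : T.path = .fast) (hphase : C.phase T.proc = .busy T op) (hop : op ≠ .tryC)
      (hnext : M.next T (C.loc T.proc) = .prim b p)
      (hsize : (C.track T.proc).size ≠ M.trackingSize) (hvalid : C.valid T.proc)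
      (hclash : ¬ ∃ j, j ≠ T.proc ∧ Clashes (C.track j) b p) :
      Step E C (.prim T b p (.value (p.result (C.cachedValue T.proc b))))
        ((C.trackAccess T.proc b p).setLoc T.proc
          (M.onResult T (some (p.result (C.cachedValue T.proc b))) (C.loc T.proc)))
  | commitSuccess (C : Config n X V B W Q) (T : Txn n)
      (hpath : T.path = .fast) (hphase : C.phase T.proc = .busy T .tryC)
      (hvalid : C.valid T.proc) :
      Step E C (.cacheCommit T true)
        ((((C.flush T.proc).clear T.proc).setLoc T.proc
          (M.onCacheCommit T true (C.loc T.proc))).setPhase T.proc (.flushed T))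
  | commitFailure (C : Config n X V B W Q) (T : Txn n)
      (hpath : T.path = .fast) (hphase : C.phase T.proc = .busy T .tryC)
      (hvalid : ¬ C.valid T.proc) :
      Step E C (.cacheCommit T false)
        (bottom T C (M.onCacheCommit T false (C.loc T.proc)))
  | respond (C : Config n X V B W Q) (T : Txn n) (op : TOp X V) (r : TResp V)
      (hphase : C.phase T.proc = .busy T op) (hop : T.path = .slow ∨ op ≠ .tryC)
      (hnext : M.next T (C.loc T.proc) = .respond r) (hmatch : op.Matches r)
      (hfinal : ¬ r.Final) :
      Step E C (.resp T r) (C.setPhase T.proc (.ready T))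
  | respondFinal (C : Config n X V B W Q) (T : Txn n) (op : TOp X V) (r : TResp V)
      (hphase : C.phase T.proc = .busy T op) (hop : T.path = .slow ∨ op ≠ .tryC)
      (hnext : M.next T (C.loc T.proc) = .respond r) (hmatch : op.Matches r)
      (hfinal : r.Final) :
      Step E C (.resp T r) ((C.clear T.proc).setPhase T.proc .idle)
  | abort (C : Config n X V B W Q) (T : Txn n) (hphase : C.phase T.proc = .doomed T) :
      Step E C (.resp T .abort) (C.setPhase T.proc .idle)
  | commit (C : Config n X V B W Q) (T : Txn n) (hphase : C.phase T.proc = .flushed T) :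
      Step E C (.resp T .commit) (C.setPhase T.proc .idle)

/-- `Run M E C`: `E` is a (finite) execution of `M`, and `C` is the configuration after it. -/
inductive Run : List (Event n X V B W R) → Config n X V B W Q → Prop
  | nil : Run [] M.initConfig
  | snoc (E : List (Event n X V B W R)) (C : Config n X V B W Q) (e : Event n X V B W R)
      (C' : Config n X V B W Q) (hrun : Run E C) (hstep : M.Step E C e C') : Run (E ++ [e]) C'

def IsExecution (E : List (Event n X V B W R)) : Prop := ∃ C, M.Run E C

/-! ### The properties of HyTM implementations -/

/-- Every execution is opaque. -/
def SatisfiesOpacity : Prop :=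
  ∀ E, M.IsExecution E → OpaqueHistory M.initVal (history E)

/-- Progressiveness, on the fast path and on the slow path. -/
def Progressive : Prop :=
  ∀ E, M.IsExecution E → ∀ T ∈ txns E, Aborted E T →
    CapacityAborts E T ∨ ∃ T', Concurrent E T T' ∧ Conflict E T T'

/-- Obstruction-free TM-liveness: a t-operation invoked after any execution returns a matching
response if its transaction runs without steps of other transactions from then on. -/
def ObstructionFreeLiveness : Prop :=
  ∀ E T op, M.IsExecution (E ++ [.inv T op]) →
    ∃ E' r, (∀ e ∈ E', e.txn = T) ∧ op.Matches r ∧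
      M.IsExecution (E ++ [.inv T op] ++ E' ++ [.resp T r])

/-- The execution `E` appears t-sequential to its transaction `T`. -/
def AppearsTSequential (E : List (Event n X V B W R)) (T : Txn n) : Prop :=
  T ∈ txns E ∧ ∃ E', M.IsExecution E' ∧
    txns E' ⊆ txns E \ {T} ∧
    AllTComplete E' ∧
    (∀ T' ∈ txns E, Precedes E T' T → T' ∈ txns E' ∧ proj E T' = proj E' T') ∧
    (∀ T₁ ∈ txns E', ∀ T₂ ∈ txns E', Precedes E T₁ T₂ → Precedes E' T₁ T₂) ∧
    (∀ T' ∈ txns E', Rset E' T' ⊆ Rset E T' ∧ Wset E' T' ⊆ Wset E T') ∧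
    M.IsExecution (E' ++ proj E T)

/-- A partition of the base objects into metadata objects (`D b = none`) and, for every t-object
`x`, data objects associated with `x` (`D b = some x`). -/
structure IsDataPartition (D : B → Option X) : Prop where
  /-- A fast-path transaction accesses only metadata and the data objects of its data set. -/
  fast_access : ∀ E, M.IsExecution E → ∀ T ∈ txns E, T.path = .fast → ∀ b, Accesses E T b →
    ∀ x, D b = some x → x ∈ Dset E T
  /-- The data objects of the data set of a transaction are not influenced by transactions with
  disjoint data sets. -/
  disjoint_data : ∀ E E' ρ ρ' T C C',
    M.IsExecution E → M.IsExecution (E ++ E') →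
    M.Run (E ++ ρ) C → M.Run (E ++ E' ++ ρ') C' →
    AllTComplete E → AllTComplete (E ++ E') →
    AllTComplete (E ++ ρ) → AllTComplete (E ++ E' ++ ρ') →
    T ∉ txns (E ++ E') → (∀ e ∈ ρ, e.txn = T) → (∀ e ∈ ρ', e.txn = T) →
    history ρ = history ρ' →
    (∀ T' ∈ txns E', Disjoint (Dset E' T') (Dset ρ T)) →
    ∀ b x, D b = some x → x ∈ Dset ρ T → C.mem b = C'.mem b
  /-- Accesses to data objects do not reveal concurrency to fast-path transactions. -/
  data_access : ∀ E T b p r, T.path = .fast → M.AppearsTSequential E T → D b ≠ none →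
    M.IsExecution (E ++ [.prim T b p (.value r)]) →
    M.AppearsTSequential (E ++ [.prim T b p (.value r)]) T

end Implementation

end Executions

end HybridTM

end HybridTMDefinitions

/-! Suppose that no fast-path read-only transaction with at most `m` t-objects incurs a capacity
abort. Take two fast-path readers `T` and `T'` on different processes, and a third process `p` that
runs slow-path transactions. By induction on `k ≤ m` (`exists_readPair`) there is a t-complete
execution `F` of slow-path transactions of `p` after which `T` and `T'`, each running on its own,
can read `k` t-objects each, with disjoint data sets, so that the numbers of metadata objects they
access add up to at least `k`. For `k = m`, one of the two accesses at least `m / 2` of them.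

The induction step rests on `ReadContext.accessesNewMetadata_or`. Let `T` go on to an unused
t-object `x` and `T'` to an unused `y`, and let a slow-path transaction `S` write new values to both
and commit. Suppose that after no t-complete extension of `F` by events of `S` with data set in `{x,
y}` does either reader meet a new metadata object in its next t-read. Consider the reads started
after each prefix of the run of `S`.

Such a read returns a value, although `S` may be pending. The execution appears t-sequential to the
reader at every step (`ReadContext.appearsTSequential`): accesses to data objects preserve this by
assumption, and the only metadata objects met are those accessed before, which `S` leaves unchanged.
So the reader cannot tell the execution from a t-complete one, after which progressiveness forbids
it to abort.

By opacity the reads return the initial values before `S` invokes `tryC` and the written ones after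
`S` has committed. Moreover `T` sees `S` if and only if `T'` does, because either reader can commit
before the other one starts (`QuietRead.eq_of_seen`). Hence both answers change at the same event of
`S`. That event changes a single base object, which both reads must access. It is not a data object,
since the data sets are disjoint. It is not a metadata object either: the reader accessed it in its
earlier t-reads, and by changing it `S` would make a reader abort with which it has no conflict
(`Progressive.mem_eq`).

Therefore one of the readers accesses a new metadata object after some t-complete extension of `F`.
This extension is the next `F`; the other reader replays its run there and completes its own new
t-read. -/

namespace HybridTM

/-! ### Basic facts on projections, data sets and runs. -/

section Basics

open Classical

universe u₁ u₂ u₃ u₄ u₅ u₆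

variable {n : ℕ} {X : Type u₁} {V : Type u₂} {B : Type u₃} {W : Type u₄} {R : Type u₅}
  {Q : Type u₆}

theorem txns_append (E E' : List (Event n X V B W R)) : txns (E ++ E') = txns E ∪ txns E' := by
  ext T
  simp only [txns, List.mem_append, Set.mem_ofPred_eq, Set.mem_union]
  grind

theorem proj_append (E E' : List (Event n X V B W R)) (T : Txn n) :
    proj (E ++ E') T = proj E T ++ proj E' T := List.filter_append ..

theorem mem_proj {E : List (Event n X V B W R)} {T : Txn n} {e : Event n X V B W R} :
    e ∈ proj E T ↔ e ∈ E ∧ e.txn = T := by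
  simp [proj]

theorem proj_eq_nil {E : List (Event n X V B W R)} {T : Txn n} (h : T ∉ txns E) :
    proj E T = [] := by
  simp only [proj, List.filter_eq_nil_iff, decide_eq_true_eq]
  exact fun e he h' => h ⟨e, he, h'⟩

theorem proj_eq_self {E : List (Event n X V B W R)} {T : Txn n} (h : ∀ e ∈ E, e.txn = T) :
    proj E T = E := by
  simpa [proj, List.filter_eq_self] using h

theorem mem_txns_of_mem {E : List (Event n X V B W R)} {e : Event n X V B W R} (h : e ∈ E) :
    e.txn ∈ txns E := ⟨e, h, rfl⟩

theorem Rset_append (E E' : List (Event n X V B W R)) (T : Txn n) :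
    Rset (E ++ E') T = Rset E T ∪ Rset E' T := by
  ext x; simp [Rset]

theorem Wset_append (E E' : List (Event n X V B W R)) (T : Txn n) :
    Wset (E ++ E') T = Wset E T ∪ Wset E' T := by
  ext x; simp [Wset, exists_or]

theorem Dset_append (E E' : List (Event n X V B W R)) (T : Txn n) :
    Dset (E ++ E') T = Dset E T ∪ Dset E' T := by
  simp only [Dset, Rset_append, Wset_append]
  ext x; simp only [Set.mem_union]; tauto

theorem Rset_eq_empty {E : List (Event n X V B W R)} {T : Txn n} (h : T ∉ txns E) :
    Rset E T = ∅ := by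
  ext x; simp only [Rset, Set.mem_ofPred_eq, Set.mem_empty_iff_false, iff_false]
  exact fun hx => h ⟨_, hx, rfl⟩

theorem Wset_eq_empty {E : List (Event n X V B W R)} {T : Txn n} (h : T ∉ txns E) :
    Wset E T = ∅ := by
  ext x; simp only [Wset, Set.mem_ofPred_eq, Set.mem_empty_iff_false, iff_false]
  exact fun ⟨_, hx⟩ => h ⟨_, hx, rfl⟩

theorem Dset_eq_empty {E : List (Event n X V B W R)} {T : Txn n} (h : T ∉ txns E) :
    Dset E T = ∅ := by
  simp [Dset, Rset_eq_empty h, Wset_eq_empty h]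

namespace Implementation

variable {M : Implementation n X V B W R Q}

theorem Run.snoc_inv {E : List (Event n X V B W R)} {e : Event n X V B W R}
    {C' : Config n X V B W Q} (h : M.Run (E ++ [e]) C') :
    ∃ C, M.Run E C ∧ M.Step E C e C' := by
  generalize hL : E ++ [e] = L at h
  cases h with
  | nil => simp at hL
  | snoc E₁ C e₁ C' hrun hstep =>
    obtain ⟨rfl, h⟩ := List.append_inj' hL rfl
    cases h
    exact ⟨C, hrun, hstep⟩

theorem Run.prefix {E E' : List (Event n X V B W R)} {C' : Config n X V B W Q}
    (h : M.Run (E ++ E') C') : ∃ C, M.Run E C := by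
  induction E' using List.reverseRecOn generalizing C' with
  | nil => exact ⟨C', by simpa using h⟩
  | append_singleton L e ih =>
    rw [← List.append_assoc] at h
    obtain ⟨C, hC, -⟩ := h.snoc_inv
    exact ih hC

/-- Constructors that produce the same event are told apart by the phase, the validity of the
tracking set or finality of the response. So an execution determines its configuration. -/
theorem Step.deterministic {E : List (Event n X V B W R)} {e : Event n X V B W R}
    {C C₁ C₂ : Config n X V B W Q} (h₁ : M.Step E C e C₁) (h₂ : M.Step E C e C₂) : C₁ = C₂ := by
  generalize he : e = e' at h₂
  cases h₁ <;> cases h₂ <;> simp only [Event.inv.injEq, Event.resp.injEq, Event.prim.injEq,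
    Event.cacheCommit.injEq, reduceCtorEq] at he <;> grind [TResp.Final]

theorem Run.deterministic {E : List (Event n X V B W R)} {C₁ C₂ : Config n X V B W Q}
    (h₁ : M.Run E C₁) (h₂ : M.Run E C₂) : C₁ = C₂ := by
  induction h₁ generalizing C₂ with
  | nil =>
    generalize hL : ([] : List (Event n X V B W R)) = L at h₂
    cases h₂ with
    | nil => rfl
    | snoc => simp at hL
  | snoc E C e C' hrun hstep ih =>
    obtain ⟨C₃, h₃, h₄⟩ := h₂.snoc_inv
    obtain rfl := ih h₃
    exact hstep.deterministic h₄

/-- A process without transactions is in its initial state. -/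
theorem Run.untouched {E : List (Event n X V B W R)} {C : Config n X V B W Q} (h : M.Run E C)
    {i : Fin n} (hi : ∀ e ∈ E, e.txn.proc ≠ i) :
    C.loc i = M.initState i ∧ C.phase i = .idle ∧ C.track i = (fun _ => none) ∧ C.valid i := by
  induction h with
  | nil => simp [initConfig]
  | snoc E C e C' hrun hstep ih =>
    have h1 := ih fun e he => hi e (by simp [he])
    have h2 : i ≠ e.txn.proc := (hi e (by simp)).symm
    cases hstep <;>
      simp_all [Event.txn, Config.setLoc, Config.setPhase, Config.clear, Config.flush, bottom,
        Config.invalidate, Config.trackAccess, Clashes]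

/-- The tracking set of a process without fast-path transactions is empty. -/
theorem Run.track_of_slow {E : List (Event n X V B W R)} {C : Config n X V B W Q}
    (h : M.Run E C) {i : Fin n} (hi : ∀ e ∈ E, e.txn.proc = i → e.txn.path = .slow) :
    C.track i = (fun _ => none) := by
  induction h with
  | nil => simp [initConfig]
  | snoc E C e C' hrun hstep ih =>
    have h1 := ih fun e he => hi e (by simp [he])
    have h2 := hi e (by simp)
    cases hstep <;>
      simp_all [Event.txn, Config.setLoc, Config.setPhase, Config.clear, Config.flush, bottom,
        Config.invalidate, Config.trackAccess, Function.update_apply]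
    grind

end Implementation

end Basics

end HybridTM

noncomputable section

namespace HybridTM

/-! ### Local runs of fast-path readers, described apart from the rest of the configuration. -/

section FastReads

open Classical

universe u₁ u₂ u₃ u₄ u₅ u₆

variable {n : ℕ} {X : Type u₁} {V : Type u₂} {B : Type u₃} {W : Type u₄} {R : Type u₅}
  {Q : Type u₆}

theorem Accesses.append_left {E E' : List (Event n X V B W R)} {T : Txn n} {b : B}
    (h : Accesses E T b) : Accesses (E ++ E') T b := by
  obtain ⟨p, o, h⟩ := h
  exact ⟨p, o, List.mem_append_left _ h⟩

theorem Accesses.append_right {E E' : List (Event n X V B W R)} {T : Txn n} {b : B}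
    (h : Accesses E' T b) : Accesses (E ++ E') T b := by
  obtain ⟨p, o, h⟩ := h
  exact ⟨p, o, List.mem_append_right _ h⟩

/-- The part of a configuration that belongs to a single process. -/
structure ProcState (n : ℕ) (X : Type u₁) (V : Type u₂) (B : Type u₃) (W : Type u₄)
    (Q : Type u₆) where
  loc : Q
  phase : Phase n X V
  track : TrackingSet B W

/-- The value seen by a cached access when the memory is `mem`. -/
def ProcState.value (s : ProcState n X V B W Q) (mem : B → W) (b : B) : W :=
  match s.track b with
  | some (w, _) => w
  | none => mem b

/-- The mode of an entry after a cached access. -/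
def ProcState.mode (s : ProcState n X V B W Q) (b : B) (p : Prim W R) : Mode :=
  match s.track b with
  | some (_, .exclusive) => .exclusive
  | _ => if p.Trivial then .shared else .exclusive

/-- Replace the part of a configuration that belongs to process `i`. -/
def Config.put (C : Config n X V B W Q) (i : Fin n) (s : ProcState n X V B W Q) :
    Config n X V B W Q :=
  { C with
    loc := Function.update C.loc i s.loc
    phase := Function.update C.phase i s.phase
    track := Function.update C.track i s.track }

@[simp]
theorem Config.put_mem (C : Config n X V B W Q) (i : Fin n) (s : ProcState n X V B W Q) :
    (C.put i s).mem = C.mem := rfl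

@[simp]
theorem Config.put_valid (C : Config n X V B W Q) (i : Fin n) (s : ProcState n X V B W Q) :
    (C.put i s).valid = C.valid := rfl

@[simp]
theorem Config.put_loc_self (C : Config n X V B W Q) (i : Fin n) (s : ProcState n X V B W Q) :
    (C.put i s).loc i = s.loc := by simp [Config.put]

@[simp]
theorem Config.put_phase_self (C : Config n X V B W Q) (i : Fin n)
    (s : ProcState n X V B W Q) : (C.put i s).phase i = s.phase := by simp [Config.put]

@[simp]
theorem Config.put_track_self (C : Config n X V B W Q) (i : Fin n)
    (s : ProcState n X V B W Q) : (C.put i s).track i = s.track := by simp [Config.put]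

theorem Config.put_loc_of_ne (C : Config n X V B W Q) {i j : Fin n} (h : j ≠ i)
    (s : ProcState n X V B W Q) : (C.put i s).loc j = C.loc j := by simp [Config.put, h]

theorem Config.put_phase_of_ne (C : Config n X V B W Q) {i j : Fin n} (h : j ≠ i)
    (s : ProcState n X V B W Q) : (C.put i s).phase j = C.phase j := by simp [Config.put, h]

theorem Config.put_track_of_ne (C : Config n X V B W Q) {i j : Fin n} (h : j ≠ i)
    (s : ProcState n X V B W Q) : (C.put i s).track j = C.track j := by simp [Config.put, h]

theorem Config.put_cachedValue (C : Config n X V B W Q) (i : Fin n)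
    (s : ProcState n X V B W Q) (b : B) :
    (C.put i s).cachedValue i b = s.value C.mem b := by
  simp only [Config.cachedValue, ProcState.value, Config.put_track_self, Config.put_mem]

theorem Config.put_trackAccess (C : Config n X V B W Q) (i : Fin n)
    (s : ProcState n X V B W Q) (b : B) (p : Prim W R) (q : Q) :
    ((C.put i s).trackAccess i b p).setLoc i q = C.put i ⟨q, s.phase,
      Function.update s.track b (some (p.update (s.value C.mem b), s.mode b p))⟩ := by
  simp only [Config.trackAccess, Config.put_cachedValue, Config.newMode, Config.put_track_self,
    ProcState.mode]
  simp only [Config.put, Config.setLoc, Function.update_idem]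

namespace Implementation

variable (M : Implementation n X V B W R Q)

/-- A successful cached access. -/
def access (T : Txn n) (mem : B → W) (s : ProcState n X V B W Q) (b : B) (p : Prim W R) :
    ProcState n X V B W Q where
  loc := M.onResult T (some (p.result (s.value mem b))) s.loc
  phase := s.phase
  track := Function.update s.track b (some (p.update (s.value mem b), s.mode b p))

/-- The steps of a fast-path transaction `T` that performs t-reads without receiving `⊥` or
aborting, while the memory is `mem`; `α` lists the earlier events of `T`. -/
inductive ReadStep (mem : B → W) (T : Txn n) (α : List (Event n X V B W R)) :
    ProcState n X V B W Q → Event n X V B W R → ProcState n X V B W Q → Prop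
  | invoke (s : ProcState n X V B W Q) (x : X)
      (hphase : (s.phase = .idle ∧ α = []) ∨ s.phase = .ready T) (hx : x ∉ Rset α T) :
      ReadStep mem T α s (.inv T (.read x))
        ⟨M.onInvoke T (.read x) s.loc, .busy T (.read x), s.track⟩
  | access (s : ProcState n X V B W Q) (x : X) (b : B) (p : Prim W R)
      (hphase : s.phase = .busy T (.read x)) (hnext : M.next T s.loc = .prim b p)
      (hsize : s.track.size ≠ M.trackingSize) :
      ReadStep mem T α s (.prim T b p (.value (p.result (s.value mem b))))
        (M.access T mem s b p)
  | respond (s : ProcState n X V B W Q) (x : X) (v : V)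
      (hphase : s.phase = .busy T (.read x)) (hnext : M.next T s.loc = .respond (.value v)) :
      ReadStep mem T α s (.resp T (.value v)) ⟨s.loc, .ready T, s.track⟩

/-- A run of a fast-path transaction `T` that performs t-reads without receiving `⊥` or
aborting, while the memory is `mem`. -/
inductive FastReads (mem : B → W) (T : Txn n) :
    List (Event n X V B W R) → ProcState n X V B W Q → Prop
  | nil : FastReads mem T [] ⟨M.initState T.proc, .idle, fun _ => none⟩
  | snoc (α : List (Event n X V B W R)) (s : ProcState n X V B W Q) (e : Event n X V B W R)
      (s' : ProcState n X V B W Q) (hα : FastReads mem T α s)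
      (he : M.ReadStep mem T α s e s') : FastReads mem T (α ++ [e]) s'

variable {M}

theorem FastReads.nil_inv {mem : B → W} {T : Txn n} {s : ProcState n X V B W Q}
    (h : M.FastReads mem T [] s) : s = ⟨M.initState T.proc, .idle, fun _ => none⟩ := by
  generalize hL : ([] : List (Event n X V B W R)) = L at h
  cases h with
  | nil => rfl
  | snoc => simp at hL

theorem FastReads.snoc_inv {mem : B → W} {T : Txn n} {α : List (Event n X V B W R)}
    {e : Event n X V B W R} {s' : ProcState n X V B W Q} (h : M.FastReads mem T (α ++ [e]) s') :
    ∃ s, M.FastReads mem T α s ∧ M.ReadStep mem T α s e s' := by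
  generalize hL : α ++ [e] = L at h
  cases h with
  | nil => simp at hL
  | snoc α₁ s e₁ s' hα he =>
    obtain ⟨rfl, h⟩ := List.append_inj' hL rfl
    cases h
    exact ⟨s, hα, he⟩

theorem FastReads.prefix {mem : B → W} {T : Txn n} {α β : List (Event n X V B W R)}
    {s' : ProcState n X V B W Q} (h : M.FastReads mem T (α ++ β) s') :
    ∃ s, M.FastReads mem T α s := by
  induction β using List.reverseRecOn generalizing s' with
  | nil => exact ⟨s', by simpa using h⟩
  | append_singleton L e ih =>
    rw [← List.append_assoc] at h
    obtain ⟨s, hs, -⟩ := h.snoc_inv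
    exact ih hs

theorem ReadStep.shape {mem : B → W} {T : Txn n} {α : List (Event n X V B W R)}
    {e : Event n X V B W R} {s s' : ProcState n X V B W Q} (h : M.ReadStep mem T α s e s') :
    (∃ x, e = .inv T (.read x)) ∨ (∃ b p r, e = .prim T b p (.value r)) ∨
      ∃ v, e = .resp T (.value v) := by
  cases h <;> simp

theorem FastReads.shape {mem : B → W} {T : Txn n} {α : List (Event n X V B W R)}
    {s : ProcState n X V B W Q} (h : M.FastReads mem T α s) :
    ∀ e ∈ α, (∃ x, e = .inv T (.read x)) ∨ (∃ b p r, e = .prim T b p (.value r)) ∨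
      ∃ v, e = .resp T (.value v) := by
  induction h with
  | nil => simp
  | snoc α s e s' _ he ih =>
    intro e' he'
    rcases List.mem_append.1 he' with h | h
    · exact ih _ h
    · rw [List.mem_singleton.1 h]
      exact he.shape

theorem FastReads.txn_eq {mem : B → W} {T : Txn n} {α : List (Event n X V B W R)}
    {s : ProcState n X V B W Q} (h : M.FastReads mem T α s) : ∀ e ∈ α, e.txn = T := by
  intro e he
  rcases h.shape e he with ⟨x, rfl⟩ | ⟨b, p, r, rfl⟩ | ⟨v, rfl⟩ <;> rfl

theorem FastReads.Wset_eq {mem : B → W} {T : Txn n} {α : List (Event n X V B W R)}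
    {s : ProcState n X V B W Q} (h : M.FastReads mem T α s) (T' : Txn n) : Wset α T' = ∅ := by
  ext x
  simp only [Wset, Set.mem_ofPred_eq, Set.mem_empty_iff_false, iff_false]
  rintro ⟨v, hv⟩
  rcases h.shape _ hv with ⟨x, h⟩ | ⟨b, p, r, h⟩ | ⟨v, h⟩ <;> simp at h

theorem FastReads.not_capacityAborts {mem : B → W} {T : Txn n} {α : List (Event n X V B W R)}
    {s : ProcState n X V B W Q} (h : M.FastReads mem T α s) (T' : Txn n) :
    ¬ CapacityAborts α T' := by
  rintro ⟨b, p, hb⟩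
  rcases h.shape _ hb with ⟨x, h⟩ | ⟨b, p, r, h⟩ | ⟨v, h⟩ <;> simp at h

/-- Entries are never dropped as long as no `⊥` is received. -/
theorem FastReads.track_ne_none_iff {mem : B → W} {T : Txn n} {α : List (Event n X V B W R)}
    {s : ProcState n X V B W Q} (h : M.FastReads mem T α s) (b : B) :
    s.track b ≠ none ↔ Accesses α T b := by
  induction h with
  | nil => simp [Accesses]
  | snoc α s e s' _ he ih =>
    cases he <;> simp_all [Accesses, Implementation.access, Function.update_apply]
    grind

/-- Trivial primitives never promote an entry to exclusive mode. This identifies the objects that a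
cache-commit may overwrite as targets of nontrivial primitives. -/
theorem FastReads.exclusive {mem : B → W} {T : Txn n} {α : List (Event n X V B W R)}
    {s : ProcState n X V B W Q} (h : M.FastReads mem T α s) {b : B} {w : W}
    (hb : s.track b = some (w, .exclusive)) : ∃ p o, .prim T b p o ∈ α ∧ ¬ p.Trivial := by
  induction h generalizing w with
  | nil => simp at hb
  | snoc α s e s' _ he ih =>
    have key : ∀ w', s.track b = some (w', .exclusive) →
        ∃ p o, .prim T b p o ∈ α ++ [e] ∧ ¬ p.Trivial := fun w' hw' => by
      obtain ⟨p, o, hp, hp'⟩ := ih hw'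
      exact ⟨p, o, List.mem_append_left _ hp, hp'⟩
    cases he with
    | invoke => exact key w hb
    | respond => exact key w hb
    | access x b' p hphase hnext hsize =>
      by_cases hbb : b = b'
      · subst hbb
        by_cases hp : p.Trivial
        · rcases hs : s.track b with _ | ⟨w', m⟩
          · simp [Implementation.access, ProcState.mode, hs, hp] at hb
          · cases m
            · simp [Implementation.access, ProcState.mode, hs, hp] at hb
            · exact key w' hs
        · exact ⟨p, _, List.mem_append_right _ (List.mem_singleton.2 rfl), hp⟩
      · simp only [Implementation.access, Function.update_of_ne hbb] at hb
        exact key w hb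

/-- The memory enters a run only through the objects accessed. Hence a reader can replay its run
after a longer slow-path execution that leaves these objects alone. -/
theorem FastReads.congr_mem {mem mem' : B → W} {T : Txn n} {α : List (Event n X V B W R)}
    {s : ProcState n X V B W Q} (h : M.FastReads mem T α s)
    (hmem : ∀ b, Accesses α T b → mem' b = mem b) : M.FastReads mem' T α s := by
  induction h with
  | nil => exact .nil
  | snoc α s e s' _ he ih =>
    refine .snoc α s e s' (ih fun b hb => hmem b hb.append_left) ?_
    cases he with
    | invoke x hphase hx => exact .invoke s x hphase hx
    | respond x v hphase hnext => exact .respond s x v hphase hnext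
    | access x b p hphase hnext hsize =>
      have hv : s.value mem b = s.value mem' b := by
        have := hmem b ⟨p, _, List.mem_append_right _ (List.mem_singleton.2 rfl)⟩
        simp [ProcState.value, this]
      have ha : M.access T mem s b p = M.access T mem' s b p := by
        simp [Implementation.access, hv]
      rw [hv, ha]
      exact .access s x b p hphase hnext hsize

/-- The local state of a transaction, except for the values in its tracking set, is determined
by its events. -/
theorem FastReads.view {mem mem' : B → W} {T : Txn n} {α : List (Event n X V B W R)}
    {s s' : ProcState n X V B W Q} (h : M.FastReads mem T α s) (h' : M.FastReads mem' T α s') :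
    s.loc = s'.loc ∧ s.phase = s'.phase ∧ ∀ b, mem b = mem' b → s.track b = s'.track b := by
  induction h generalizing s' with
  | nil => simp [h'.nil_inv]
  | snoc α s e s₁ _ he ih =>
    obtain ⟨s₂, h₂, he₂⟩ := h'.snoc_inv
    obtain ⟨h1, h2, h3⟩ := ih h₂
    cases he with
    | invoke x hphase hx =>
      cases he₂ with
      | invoke => exact ⟨by simp [h1], rfl, h3⟩
    | respond x v hphase hnext =>
      cases he₂ with
      | respond => exact ⟨h1, rfl, h3⟩
    | access x b p hphase hnext hsize =>
      generalize he : Event.prim T b p (.value (p.result (s.value mem b))) = e at he₂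
      cases he₂ with
      | invoke => simp at he
      | respond => simp at he
      | access x' b' p' hphase' hnext' hsize' =>
        simp only [Event.prim.injEq, Outcome.value.injEq, true_and] at he
        obtain ⟨rfl, rfl, hr⟩ := he
        -- The responses are recorded in the events, so the local states agree even if the memories
        -- differ at `b`.
        refine ⟨by simp [Implementation.access, h1, hr], h2, fun b' hb' => ?_⟩
        by_cases hbb : b' = b
        · subst hbb
          have := h3 _ hb'
          simp [Implementation.access, ProcState.value, ProcState.mode, this, hb']
        · simp [Implementation.access, Function.update_of_ne hbb, h3 _ hb']

theorem FastReads.unique {mem : B → W} {T : Txn n} {α : List (Event n X V B W R)}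
    {s s' : ProcState n X V B W Q} (h : M.FastReads mem T α s) (h' : M.FastReads mem T α s') :
    s = s' := by
  obtain ⟨h1, h2, h3⟩ := h.view h'
  cases s; cases s'
  simp only [ProcState.mk.injEq] at *
  exact ⟨h1, h2, funext fun b => h3 b trivial⟩

/-- After the execution `E`, the process of the fast-path transaction `T` is in its initial
state. -/
structure FreshFast (M : Implementation n X V B W R Q) (E : List (Event n X V B W R))
    (C : Config n X V B W Q) (T : Txn n) : Prop where
  run : M.Run E C
  path : T.path = .fast
  loc : C.loc T.proc = M.initState T.proc
  phase : C.phase T.proc = .idle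
  track : C.track T.proc = fun _ => none
  valid : C.valid T.proc
  notMem : T ∉ txns E

theorem Run.freshFast {E : List (Event n X V B W R)} {C : Config n X V B W Q} (h : M.Run E C)
    {T : Txn n} (hT : T.path = .fast) (hE : ∀ e ∈ E, e.txn.proc ≠ T.proc) :
    M.FreshFast E C T := by
  obtain ⟨h1, h2, h3, h4⟩ := h.untouched hE
  exact ⟨h, hT, h1, h2, h3, h4, fun ⟨e, he, h⟩ => hE e he (by rw [h])⟩

/-- While `T` runs alone nobody invalidates its tracking set, and `put` leaves `valid` untouched. So
only clashes with the tracking sets of other processes have to be excluded. -/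
theorem FastReads.step {E : List (Event n X V B W R)} {C : Config n X V B W Q} {T : Txn n}
    (hE : M.FreshFast E C T) {α : List (Event n X V B W R)} {s s' : ProcState n X V B W Q}
    {e : Event n X V B W R} (he : M.ReadStep C.mem T α s e s')
    (hclash : ∀ b p o, e = .prim T b p o → ∀ j ≠ T.proc, ¬ Clashes (C.track j) b p) :
    M.Step (E ++ α) (C.put T.proc s) e (C.put T.proc s') := by
  cases he with
  | invoke x hphase hx =>
    convert Step.invoke (M := M) (E := E ++ α) (C.put T.proc s) T (.read x) ?_ ?_ using 1
    · simp [Config.put, Config.setLoc, Config.setPhase]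
    · rcases hphase with ⟨h, rfl⟩ | h
      · left
        simpa [Config.put, h] using hE.notMem
      · right
        simp [Config.put, h]
    · intro y hy
      cases hy
      rw [Rset_append, Rset_eq_empty hE.notMem]
      simpa using hx
  | respond x v hphase hnext =>
    have := Step.respond (M := M) (E := E ++ α) (C.put T.proc s) T (.read x) (.value v)
      (by simp [hphase]) (by simp) (by simpa using hnext) trivial (by simp [TResp.Final])
    simpa [Config.put, Config.setPhase] using this
  | access x b p hphase hnext hsize =>
    have := Step.cached (M := M) (E := E ++ α) (C.put T.proc s) T (.read x) b p hE.path
      (by simp [hphase]) (by simp) (by simpa using hnext) (by simpa using hsize) hE.valid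
      (by
        rintro ⟨j, hj, hj'⟩
        rw [Config.put_track_of_ne _ hj] at hj'
        exact hclash b p _ rfl j hj hj')
    rw [Config.put_cachedValue, Config.put_trackAccess] at this
    simpa [Implementation.access] using this

theorem FreshFast.put_nil {E : List (Event n X V B W R)} {C : Config n X V B W Q} {T : Txn n}
    (hE : M.FreshFast E C T) : C.put T.proc ⟨M.initState T.proc, .idle, fun _ => none⟩ = C := by
  simp only [Config.put, ← hE.loc, ← hE.phase, ← hE.track, Function.update_eq_self]

/-- A run of t-reads of a fast-path transaction is an execution if it does not clash with the
tracking sets of the other processes. -/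
theorem FastReads.run {E : List (Event n X V B W R)} {C : Config n X V B W Q} {T : Txn n}
    (hE : M.FreshFast E C T) {α : List (Event n X V B W R)} {s : ProcState n X V B W Q}
    (hα : M.FastReads C.mem T α s)
    (hclash : ∀ b p o, .prim T b p o ∈ α → ∀ j ≠ T.proc, ¬ Clashes (C.track j) b p) :
    M.Run (E ++ α) (C.put T.proc s) := by
  induction hα with
  | nil => simpa [hE.put_nil] using hE.run
  | snoc α s e s' hα he ih =>
    rw [← List.append_assoc]
    exact .snoc _ _ _ _ (ih fun b p o h => hclash b p o (List.mem_append_left _ h))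
      (FastReads.step hE he fun b p o h =>
        hclash b p o (List.mem_append_right _ (by simp [h])))

theorem FastReads.phase_cases {mem : B → W} {T : Txn n} {α : List (Event n X V B W R)}
    {s : ProcState n X V B W Q} (h : M.FastReads mem T α s) :
    (s.phase = .idle ∧ α = []) ∨ s.phase = .ready T ∨ ∃ x, s.phase = .busy T (.read x) := by
  induction h with
  | nil => simp
  | snoc α s e s' _ he ih => cases he <;> simp_all [Implementation.access]

/-- Converse of `FastReads.step`. It recovers a local run from an execution that is only known to
contain events of the right shape, as happens with the executions in `AppearsTSequential`. -/
theorem Step.readStep {E : List (Event n X V B W R)} {C C' : Config n X V B W Q} {T : Txn n}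
    (hE : M.FreshFast E C T) {α : List (Event n X V B W R)} {s : ProcState n X V B W Q}
    {e : Event n X V B W R} (hα : M.FastReads C.mem T α s)
    (h : M.Step (E ++ α) (C.put T.proc s) e C')
    (he : (∃ x, e = .inv T (.read x)) ∨ (∃ b p r, e = .prim T b p (.value r)) ∨
      ∃ v, e = .resp T (.value v)) :
    ∃ s', M.ReadStep C.mem T α s e s' ∧ C' = C.put T.proc s' := by
  have hph := hα.phase_cases
  rcases he with ⟨x, rfl⟩ | ⟨b, p, r, rfl⟩ | ⟨v, rfl⟩
  · cases h with
    | invoke _ _ hphase hread =>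
      refine ⟨_, .invoke s x ?_ fun h => hread x rfl ?_, ?_⟩
      · simp only [Config.put_phase_self] at hphase
        rcases hphase with ⟨h1, h2⟩ | h
        · rcases hph with h | h | ⟨y, h⟩
          · exact .inl h
          · rw [h] at h1; cases h1
          · rw [h] at h1; cases h1
        · exact .inr h
      · rw [Rset_append]; exact .inr h
      · simp [Config.put, Config.setLoc, Config.setPhase]
  · cases h with
    | direct _ op _ _ hpath => rw [hE.path] at hpath; cases hpath
    | cached _ op _ _ hpath hphase hop hnext hsize hvalid hclash =>
      simp only [Config.put_phase_self, Config.put_loc_self, Config.put_track_self] at *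
      rcases hph with h | h | ⟨y, h⟩
      · rw [h.1] at hphase; cases hphase
      · rw [h] at hphase; cases hphase
      · rw [Config.put_cachedValue, Config.put_trackAccess]
        exact ⟨_, .access s y b p h hnext hsize, rfl⟩
  · cases h with
    | respond _ op _ hphase hop hnext hmatch hfinal =>
      simp only [Config.put_phase_self, Config.put_loc_self] at *
      rcases hph with h | h | ⟨y, h⟩
      · rw [h.1] at hphase; cases hphase
      · rw [h] at hphase; cases hphase
      · exact ⟨_, .respond s y v h hnext, by simp [Config.put, Config.setPhase]⟩
    | respondFinal _ op _ hphase hop hnext hmatch hfinal => simp [TResp.Final] at hfinal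

/-- An execution of a fast-path transaction whose events have the shape of a run of t-reads is
a run of t-reads. -/
theorem Run.fastReads {E : List (Event n X V B W R)} {C C' : Config n X V B W Q} {T : Txn n}
    (hE : M.FreshFast E C T) {α : List (Event n X V B W R)} (h : M.Run (E ++ α) C')
    (hα : ∀ e ∈ α, (∃ x, e = .inv T (.read x)) ∨ (∃ b p r, e = .prim T b p (.value r)) ∨
      ∃ v, e = .resp T (.value v)) :
    ∃ s, M.FastReads C.mem T α s ∧ C' = C.put T.proc s := by
  induction α using List.reverseRecOn generalizing C' with
  | nil =>
    refine ⟨_, .nil, ?_⟩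
    rw [hE.put_nil]
    exact (Run.deterministic (by simpa using h) hE.run)
  | append_singleton α e ih =>
    rw [← List.append_assoc] at h
    obtain ⟨C₁, hC₁, hstep⟩ := h.snoc_inv
    obtain ⟨s, hs, rfl⟩ := ih hC₁ fun e he => hα e (List.mem_append_left _ he)
    obtain ⟨s', hs', rfl⟩ := hstep.readStep hE hs (hα e (by simp))
    exact ⟨s', .snoc _ _ _ _ hs hs', rfl⟩

end Implementation

end FastReads

end HybridTM

end

namespace HybridTM

/-! ### Consequences of progressiveness: transactions with disjoint data sets leave each other
alone. -/

section Progress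

open Classical

universe u₁ u₂ u₃ u₄ u₅ u₆

variable {n : ℕ} {X : Type u₁} {V : Type u₂} {B : Type u₃} {W : Type u₄} {R : Type u₅}
  {Q : Type u₆}

theorem txns_subset {E : List (Event n X V B W R)} {T : Txn n} (h : ∀ e ∈ E, e.txn = T) :
    ∀ T' ∈ txns E, T' = T := by
  rintro _ ⟨e, he, rfl⟩
  exact h e he

theorem Dset_mono_left (E E' : List (Event n X V B W R)) (T : Txn n) :
    Dset E T ⊆ Dset (E ++ E') T := by
  rw [Dset_append]; exact Set.subset_union_left

/-- A finite sequence of events of `T` that contains a response splits at its first response. -/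
theorem exists_first_response {T : Txn n} {L : List (Event n X V B W R)}
    (hL : ∀ e ∈ L, e.txn = T) (h : ∃ r, .resp T r ∈ L) :
    ∃ β r L', L = β ++ .resp T r :: L' ∧ ∀ e ∈ β, e.txn = T ∧ ∀ r', e ≠ .resp T r' := by
  induction L with
  | nil => simp at h
  | cons e L ih =>
    by_cases he : ∃ r, e = .resp T r
    · obtain ⟨r, rfl⟩ := he
      exact ⟨[], r, L, rfl, by simp⟩
    · push Not at he
      obtain ⟨r, hr⟩ := h
      have hr' : Event.resp T r ∈ L := by
        rcases List.mem_cons.1 hr with h | h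
        · exact absurd h.symm (he r)
        · exact h
      obtain ⟨β, r', L', rfl, hβ⟩ := ih (fun e he => hL e (by simp [he])) ⟨r, hr'⟩
      refine ⟨e :: β, r', L', rfl, ?_⟩
      rintro e' he'
      rcases List.mem_cons.1 he' with rfl | h
      · exact ⟨hL _ (by simp), he⟩
      · exact hβ _ h

namespace Implementation

variable {M : Implementation n X V B W R Q}

theorem IsExecution.prefix {E E' : List (Event n X V B W R)} (h : M.IsExecution (E ++ E')) :
    M.IsExecution E := by
  obtain ⟨C, hC⟩ := h
  exact hC.prefix

/-- In a progressive implementation, a transaction that follows a t-complete execution and is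
concurrent only with transactions with disjoint data sets does not abort. -/
theorem Progressive.not_aborted (hM : M.Progressive) {F G : List (Event n X V B W R)}
    {T : Txn n} (hE : M.IsExecution (F ++ G)) (hF : AllTComplete F) (hT : T ∈ txns G)
    (hG : ∀ T' ∈ txns G, T' ∉ txns F)
    (hdisj : ∀ T' ∈ txns G, T' ≠ T → Disjoint (Dset G T') (Dset G T))
    (hcap : ¬ CapacityAborts G T) : ¬ Aborted (F ++ G) T := by
  intro hab
  have hTF := hG T hT
  have hD : ∀ T' ∈ txns G, Dset (F ++ G) T' = Dset G T' := fun T' hT' => by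
    rw [Dset_append, Dset_eq_empty (hG T' hT'), Set.empty_union]
  rcases hM _ hE T (by rw [txns_append]; exact .inr hT) hab with ⟨b, p, h⟩ | ⟨T', hc, hconf⟩
  · rcases List.mem_append.1 h with h | h
    · exact hTF (mem_txns_of_mem h)
    · exact hcap ⟨b, p, h⟩
  · obtain ⟨hc1, hc2, hne, hc3, hc4⟩ := hc
    by_cases hT' : T' ∈ txns G
    · obtain ⟨x, ⟨h1, h2⟩, -⟩ := hconf
      rw [hD T hT] at h1
      rw [hD T' hT'] at h2
      exact Set.disjoint_left.1 (hdisj T' hT' hne.symm) h2 h1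
    · have hT'F : T' ∈ txns F := by
        rw [txns_append] at hc2
        exact hc2.resolve_right hT'
      -- A transaction of `F` is t-complete and ends before `T` starts, so it is not concurrent with
      -- `T`.
      refine hc4 ⟨hc2, hc1, ?_, F, G, rfl, hTF, hT'⟩
      have := hF T' hT'F
      rw [TComplete, Committed, Aborted, proj_append, proj_eq_nil hT', List.append_nil]
      exact this

/-- A solo run of a slow-path transaction is not affected by a pending run of t-reads of a
fast-path transaction `T`, and it does not change the objects in the tracking set of `T` as long
as that is valid. -/
theorem Run.insert_fastReads {F δ α : List (Event n X V B W R)} {C D : Config n X V B W Q}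
    {T S : Txn n} {s : ProcState n X V B W Q} (hα : M.FastReads C.mem T α s)
    (hrun : M.Run (F ++ α) (C.put T.proc s)) (hF : M.Run F C) (hD : M.Run (F ++ δ) D)
    (hδ : ∀ e ∈ δ, e.txn = S) (hS : S.path = .slow) (hST : S.proc ≠ T.proc) :
    ∃ D', M.Run (F ++ α ++ δ) D' ∧ D'.mem = D.mem ∧ D'.loc S.proc = D.loc S.proc ∧
      D'.phase S.proc = D.phase S.proc ∧ D'.loc T.proc = s.loc ∧ D'.phase T.proc = s.phase ∧
      D'.track T.proc = s.track ∧
      (D'.valid T.proc → ∀ b, s.track b ≠ none → D'.mem b = C.mem b) := by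
  induction δ using List.reverseRecOn generalizing D with
  | nil =>
    refine ⟨C.put T.proc s, by simpa using hrun, ?_⟩
    obtain rfl := hF.deterministic (by simpa using hD)
    simp [Config.put_loc_of_ne _ hST, Config.put_phase_of_ne _ hST]
  | append_singleton δ e ih =>
    rw [← List.append_assoc] at hD
    obtain ⟨D₁, hD₁, hstep⟩ := hD.snoc_inv
    obtain ⟨D₂, h0, h1, h2, h3, h4, h5, h6, h7⟩ := ih hD₁ fun e he => hδ e (by simp [he])
    have he : e.txn = S := hδ e (by simp)
    have hSα : S ∉ txns α := fun ⟨e, he, h⟩ => by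
      rw [hα.txn_eq e he] at h; exact hST (by rw [h])
    rw [← List.append_assoc]
    have hTS := hST.symm
    cases hstep with
    | invoke S' op hphase hread =>
      obtain rfl : S' = S := he
      refine ⟨_, .snoc _ _ _ _ h0 (.invoke D₂ S' op ?_ ?_), ?_⟩
      · rw [h3]
        refine hphase.imp_left fun h => ⟨h.1, fun h' => h.2 ?_⟩
        simp only [txns_append, Set.mem_union] at h' ⊢
        tauto
      · intro x hx h'
        refine hread x hx ?_
        simp only [Rset_append, Rset_eq_empty hSα, Set.mem_union, Set.mem_empty_iff_false] at h' ⊢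
        tauto
      · simpa [Config.setLoc, Config.setPhase, hTS, h1, h2, h4, h5, h6] using
          fun h => by simpa [h1] using h7 h
    | direct S' op b p hpath hphase hnext =>
      obtain rfl : S' = S := he
      have hst := Step.direct (M := M) (E := F ++ α ++ δ) D₂ S' op b p hpath (h3 ▸ hphase)
        (h2 ▸ hnext)
      rw [h1] at hst
      refine ⟨_, .snoc _ _ _ _ h0 hst, ?_⟩
      simp only [Config.setLoc, Config.invalidate, h2, Function.update_self, h3,
        Function.update_of_ne hTS, h4, h5, h6, true_and]
      rintro ⟨hv, hcl⟩ b' hb'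
      by_cases hbb : b' = b
      · subst hbb
        -- A nontrivial primitive on an object tracked by `T` would have made the tracking set of
        -- `T` invalid.
        have hp : p.Trivial := by
          by_contra hp
          refine hcl ⟨hTS, ?_⟩
          rcases h : s.track b' with _ | ⟨w, _ | _⟩
          · exact absurd h hb'
          · simpa [Clashes, h] using hp
          · simp [Clashes, h]
        rw [Function.update_self, hp, ← h1]
        exact h7 hv b' hb'
      · rw [Function.update_of_ne hbb, ← h1]
        exact h7 hv b' hb'
    | cachedCapacity S' op b p hpath => cases he; exact absurd (hpath.symm.trans hS) (by simp)
    | cachedInvalid S' op b p hpath => cases he; exact absurd (hpath.symm.trans hS) (by simp)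
    | cachedClash S' op b p hpath => cases he; exact absurd (hpath.symm.trans hS) (by simp)
    | cached S' op b p hpath => cases he; exact absurd (hpath.symm.trans hS) (by simp)
    | commitSuccess S' hpath => cases he; exact absurd (hpath.symm.trans hS) (by simp)
    | commitFailure S' hpath => cases he; exact absurd (hpath.symm.trans hS) (by simp)
    | respond S' op r hphase hop hnext hmatch hfinal =>
      obtain rfl : S' = S := he
      refine ⟨_, .snoc _ _ _ _ h0 (.respond D₂ S' op r (h3 ▸ hphase) hop (h2 ▸ hnext) hmatch
        hfinal), ?_⟩
      simpa [Config.setPhase, hTS, h1, h2, h4, h5, h6] using fun h => by simpa [h1] using h7 h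
    | respondFinal S' op r hphase hop hnext hmatch hfinal =>
      obtain rfl : S' = S := he
      refine ⟨_, .snoc _ _ _ _ h0 (.respondFinal D₂ S' op r (h3 ▸ hphase) hop (h2 ▸ hnext) hmatch
        hfinal), ?_⟩
      simpa [Config.setPhase, Config.clear, hTS, h1, h2, h4, h5, h6] using
        fun h => by simpa [h1] using h7 h
    | abort S' hphase =>
      obtain rfl : S' = S := he
      refine ⟨_, .snoc _ _ _ _ h0 (.abort D₂ S' (h3 ▸ hphase)), ?_⟩
      simpa [Config.setPhase, hTS, h1, h2, h4, h5, h6] using fun h => by simpa [h1] using h7 h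
    | commit S' hphase =>
      obtain rfl : S' = S := he
      refine ⟨_, .snoc _ _ _ _ h0 (.commit D₂ S' (h3 ▸ hphase)), ?_⟩
      simpa [Config.setPhase, hTS, h1, h2, h4, h5, h6] using fun h => by simpa [h1] using h7 h

/-- A solo run of a slow-path transaction does not change the base objects accessed by a
fast-path transaction with a disjoint data set. -/
theorem Progressive.mem_eq (hM : M.Progressive) {F δ α : List (Event n X V B W R)}
    {C D : Config n X V B W Q} {T S : Txn n} {s : ProcState n X V B W Q}
    (hF : M.FreshFast F C T) (hFc : AllTComplete F) (htrack : ∀ j, C.track j = fun _ => none)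
    (hα : M.FastReads C.mem T α s) (hs : s.phase = .ready T ∨ α = [])
    (hD : M.Run (F ++ δ) D) (hδ : ∀ e ∈ δ, e.txn = S) (hS : S.path = .slow)
    (hST : S.proc ≠ T.proc) (hSF : S ∉ txns F) (hdisj : Disjoint (Dset δ S) (Dset α T)) :
    ∀ b, Accesses α T b → D.mem b = C.mem b := by
  intro b hb
  rcases hs with hs | rfl
  swap
  · simp [Accesses] at hb
  have hrun := FastReads.run hF hα fun b p o _ j _ => by simp [Clashes, htrack]
  obtain ⟨D', h0, h1, h2, h3, h4, h5, h6, h7⟩ := hrun.insert_fastReads hα hF.run hD hδ hS hST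
  rw [← h1]
  refine h7 ?_ b ((hα.track_ne_none_iff b).2 hb)
  -- Otherwise the tracking set of `T` is invalid after `δ`, so `tryC` fails and `T` aborts. The
  -- only other transaction after the t-complete `F` is `S`, whose data set is disjoint from that of
  -- `T`.
  by_contra hv
  have h8 := Run.snoc _ _ _ _ h0 (.invoke D' T .tryC (.inr (h5.trans hs)) (by simp))
  have h9 := Run.snoc _ _ _ _ h8 (.commitFailure _ T hF.path
    (by simp [Config.setPhase]) (by simpa [Config.setPhase, Config.setLoc] using hv))
  have h10 := Run.snoc _ _ _ _ h9 (.abort _ T (by simp [Config.setPhase, bottom]))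
  have hTS : T ≠ S := fun h => hST (by rw [h])
  have hTδ : T ∉ txns δ := fun h => hTS (txns_subset hδ _ h)
  have hSα : S ∉ txns α := fun h => hTS (txns_subset hα.txn_eq _ h).symm
  set τ : List (Event n X V B W R) := [.inv T .tryC, .cacheCommit T false, .resp T .abort]
    with hτ
  have hτT : ∀ e ∈ τ, e.txn = T := by simp [hτ, Event.txn]
  have hτS : S ∉ txns τ := fun h => hTS (txns_subset hτT _ h).symm
  have hDτ : Dset τ T = ∅ := by simp [hτ, Dset, Rset, Wset]
  have hG : ∀ T' ∈ txns (α ++ δ ++ τ), T' = T ∨ T' = S := by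
    rintro _ ⟨e, he, rfl⟩
    simp only [List.mem_append] at he
    rcases he with (he | he) | he
    · exact .inl (hα.txn_eq _ he)
    · exact .inr (hδ _ he)
    · exact .inl (hτT _ he)
  refine hM.not_aborted (F := F) (G := α ++ δ ++ τ) (T := T) ?_ hFc ?_ ?_ ?_ ?_ ?_
  · exact ⟨_, by simpa [hτ] using h10⟩
  · exact ⟨.inv T .tryC, by simp [hτ], rfl⟩
  · intro T' hT'
    rcases hG T' hT' with rfl | rfl
    · exact hF.notMem
    · exact hSF
  · intro T' hT' hne
    rcases hG T' hT' with rfl | rfl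
    · exact absurd rfl hne
    · rw [Dset_append, Dset_append, Dset_append, Dset_append, Dset_eq_empty hSα,
        Dset_eq_empty hτS, Dset_eq_empty hTδ, hDτ]
      simpa using hdisj
  · rintro ⟨b, p, h⟩
    simp only [List.mem_append] at h
    rcases h with (h | h) | h
    · exact hα.not_capacityAborts T ⟨b, p, h⟩
    · exact hTδ (mem_txns_of_mem h)
    · simp [hτ] at h
  · rw [Aborted, proj_append, proj_append, proj_eq_self hτT]
    simp [hτ]

/-- Two fast-path transactions with disjoint data sets do not interfere. -/
theorem Progressive.not_clashes (hM : M.Progressive) {F α β : List (Event n X V B W R)}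
    {C : Config n X V B W Q} {T S : Txn n} {s t : ProcState n X V B W Q}
    (hFT : M.FreshFast F C T) (hFS : M.FreshFast F C S) (hFc : AllTComplete F)
    (htrack : ∀ j, C.track j = fun _ => none) (hTS : T.proc ≠ S.proc)
    (hα : M.FastReads C.mem T α s) (hβ : M.FastReads C.mem S β t)
    (hdisj : Disjoint (Dset α T) (Dset β S)) :
    ∀ b p o, .prim S b p o ∈ β → ¬ Clashes (s.track) b p := by
  have hrun := FastReads.run hFT hα fun b p o _ j _ => by simp [Clashes, htrack]
  have hne : T ≠ S := fun h => hTS (by rw [h])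
  have hSα : S ∉ txns α := fun h => hne (txns_subset hα.txn_eq _ h).symm
  have hfresh : M.FreshFast (F ++ α) (C.put T.proc s) S :=
    { run := hrun
      path := hFS.path
      loc := by rw [Config.put_loc_of_ne _ hTS.symm]; exact hFS.loc
      phase := by rw [Config.put_phase_of_ne _ hTS.symm]; exact hFS.phase
      track := by rw [Config.put_track_of_ne _ hTS.symm]; exact hFS.track
      valid := hFS.valid
      notMem := by
        rw [txns_append]
        rintro (h | h)
        · exact hFS.notMem h
        · exact hSα h }
  have hmem : (C.put T.proc s).mem = C.mem := rfl
  rw [← hmem] at hβ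
  induction hβ with
  | nil => simp
  | snoc β t e t' hβ he ih =>
    have ih := ih (hdisj.mono_right (Dset_mono_left _ _ _))
    have hrun' := FastReads.run hfresh hβ fun b p o hb j hj => by
      by_cases hjT : j = T.proc
      · subst hjT
        rw [Config.put_track_self]
        exact ih b p o hb
      · rw [Config.put_track_of_ne _ hjT, htrack]
        simp [Clashes]
    intro b p o hb hcl
    rcases List.mem_append.1 hb with hb | hb
    · exact ih b p o hb hcl
    rw [List.mem_singleton] at hb
    subst hb
    cases he with
    | access x _ _ hphase hnext hsize =>
      -- At a first clash with the pending `T`, the access of `S` would return `⊥` and `S` would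
      -- abort without a conflict.
      have h8 := Run.snoc _ _ _ _ hrun' (.cachedClash _ S (.read x) b p hFS.path
        (by simp [hphase]) (by simp) (by simpa using hnext) (by simpa using hsize) hfresh.valid
        ⟨T.proc, hTS, by
          rw [Config.put_track_of_ne _ hTS, Config.put_track_self]; exact hcl⟩)
      have h9 := Run.snoc _ _ _ _ h8 (.abort _ S (by simp [Config.setPhase, bottom]))
      set τ : List (Event n X V B W R) := [.prim S b p .trackingAbort, .resp S .abort] with hτ
      have hτT : ∀ e ∈ τ, e.txn = S := by simp [hτ, Event.txn]
      have hTτ : T ∉ txns τ := fun h => hne (txns_subset hτT _ h)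
      have hTβ : T ∉ txns β := fun h => hne (txns_subset hβ.txn_eq _ h)
      have hDτ : Dset τ S = ∅ := by simp [hτ, Dset, Rset, Wset]
      have hG : ∀ T' ∈ txns (α ++ β ++ τ), T' = T ∨ T' = S := by
        rintro _ ⟨e, he, rfl⟩
        simp only [List.mem_append] at he
        rcases he with (he | he) | he
        · exact .inl (hα.txn_eq _ he)
        · exact .inr (hβ.txn_eq _ he)
        · exact .inr (hτT _ he)
      refine hM.not_aborted (F := F) (G := α ++ β ++ τ) (T := S) ?_ hFc ?_ ?_ ?_ ?_ ?_
      · exact ⟨_, by simpa [hτ] using h9⟩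
      · exact ⟨.resp S .abort, by simp [hτ], rfl⟩
      · intro T' hT'
        rcases hG T' hT' with rfl | rfl
        · exact hFT.notMem
        · exact hFS.notMem
      · intro T' hT' hne'
        rcases hG T' hT' with rfl | rfl
        · rw [Dset_append, Dset_append, Dset_append, Dset_append, Dset_eq_empty hSα,
            Dset_eq_empty hTτ, Dset_eq_empty hTβ, hDτ]
          simpa using hdisj.mono_right (Dset_mono_left _ _ _)
        · exact absurd rfl hne'
      · rintro ⟨b, p, h⟩
        simp only [List.mem_append] at h
        rcases h with (h | h) | h
        · exact hSα (mem_txns_of_mem h)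
        · exact hβ.not_capacityAborts S ⟨b, p, h⟩
        · simp [hτ] at h
      · rw [Aborted, proj_append, proj_append, proj_eq_self hτT]
        simp [hτ]

/-- The solo run in the definition of liveness may contain earlier responses and further
t-operations, so it is cut at its first response. That this response matches the invocation is
recovered later from the step that produces it. -/
theorem ObstructionFreeLiveness.exists_response (hM : M.ObstructionFreeLiveness)
    {E : List (Event n X V B W R)} {T : Txn n} {op : TOp X V}
    (hE : M.IsExecution (E ++ [.inv T op])) :
    ∃ β r, (∀ e ∈ β, e.txn = T ∧ ∀ r', e ≠ .resp T r') ∧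
      M.IsExecution (E ++ [.inv T op] ++ β ++ [.resp T r]) := by
  obtain ⟨E', r, hE', -, hex⟩ := hM E T op hE
  obtain ⟨β, r', L', hL, hβ⟩ := exists_first_response (T := T) (L := E' ++ [.resp T r])
    (by
      intro e he
      rcases List.mem_append.1 he with h | h
      · exact hE' e h
      · rw [List.mem_singleton.1 h]; rfl)
    ⟨r, by simp⟩
  refine ⟨β, r', hβ, IsExecution.prefix (E' := L') ?_⟩
  have : E ++ [.inv T op] ++ β ++ [.resp T r'] ++ L' =
      E ++ [.inv T op] ++ (E' ++ [.resp T r]) := by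
    rw [hL]; simp
  rw [this, ← List.append_assoc]
  exact hex

variable (M) in
/-- No fast-path read-only transaction with a data set of size at most `m` incurs a capacity
abort. -/
def NoCapacityAborts (m : ℕ) : Prop :=
  ∀ E T, M.IsExecution E → T ∈ txns E → T.path = .fast → ReadOnly E T →
    (Dset E T).ncard ≤ m → ¬ CapacityAborts E T

theorem Rset_eq_empty_of_prim {β : List (Event n X V B W R)}
    (hβ : ∀ e ∈ β, ∃ T b p o, e = .prim T b p o) (T : Txn n) : Rset β T = ∅ := by
  ext x
  simp only [Rset, Set.mem_ofPred_eq, Set.mem_empty_iff_false, iff_false]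
  intro h
  obtain ⟨T', b, p, o, h⟩ := hβ _ h
  cases h

theorem FastReads.Dset_read {mem : B → W} {T : Txn n} {α β : List (Event n X V B W R)} {x : X}
    {t : ProcState n X V B W Q} (ht : M.FastReads mem T (α ++ [.inv T (.read x)] ++ β) t)
    (hβ : ∀ e ∈ β, ∃ b p o, e = .prim T b p o) :
    Dset (α ++ [.inv T (.read x)] ++ β) T = insert x (Dset α T) := by
  have hβR := Rset_eq_empty_of_prim (fun e he => ⟨T, hβ e he⟩) T
  have hβW : Wset β T = ∅ := by
    have := ht.Wset_eq T
    rw [Wset_append, Set.union_empty_iff] at this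
    exact this.2
  rw [Dset_append, Dset_append, Dset, Dset, Dset, hβR, hβW]
  ext y
  simp [Rset, Wset, or_comm]

/-- A fast-path transaction that runs solo and keeps within the capacity gets to the response of
its next t-read. -/
theorem FastReads.exists_read_pending {m : ℕ} (hM : M.ObstructionFreeLiveness)
    (hcap : M.NoCapacityAborts m) {E α : List (Event n X V B W R)} {C : Config n X V B W Q}
    {T : Txn n} {s : ProcState n X V B W Q} (hE : M.FreshFast E C T)
    (htrack : ∀ j ≠ T.proc, C.track j = fun _ => none)
    (hα : M.FastReads C.mem T α s) (hs : s.phase = .ready T ∨ α = []) {x : X}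
    (hx : x ∉ Dset α T) (hm : (insert x (Dset α T)).ncard ≤ m) :
    ∃ β r t, M.FastReads C.mem T (α ++ [.inv T (.read x)] ++ β) t ∧
      t.phase = .busy T (.read x) ∧ M.next T t.loc = .respond r ∧
      (TOp.read x : TOp X V).Matches r ∧ ∀ e ∈ β, ∃ b p o, e = .prim T b p o := by
  have hclash : ∀ (α' : List (Event n X V B W R)) b p o, .prim T b p o ∈ α' →
      ∀ j ≠ T.proc, ¬ Clashes (C.track j) b p := fun _ b p o _ j hj => by
    simp [Clashes, htrack j hj]
  have hinv : M.FastReads C.mem T (α ++ [.inv T (.read x)])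
      ⟨M.onInvoke T (.read x) s.loc, .busy T (.read x), s.track⟩ := by
    refine .snoc _ s _ _ hα (.invoke s x ?_ fun h => hx (.inl h))
    rcases hs with h | rfl
    · exact .inr h
    · left
      rw [hα.nil_inv]
      simp
  have hrun := FastReads.run hE hinv (hclash _)
  rw [← List.append_assoc] at hrun
  obtain ⟨β, r, hβ, D, hD⟩ := hM.exists_response ⟨_, hrun⟩
  obtain ⟨D₁, hD₁, hstep⟩ := hD.snoc_inv
  -- All events up to the response are successful cached accesses: the tracking set stays valid in a
  -- solo run, the other tracking sets are empty, and a capacity abort would occur with a data set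
  -- of at most `m` t-objects.
  have key : ∀ β : List (Event n X V B W R), (∀ e ∈ β, e.txn = T ∧ ∀ r', e ≠ .resp T r') →
      ∀ D₁, M.Run (E ++ α ++ [.inv T (.read x)] ++ β) D₁ →
      ∃ t, M.FastReads C.mem T (α ++ [.inv T (.read x)] ++ β) t ∧
      t.phase = .busy T (.read x) ∧ D₁ = C.put T.proc t ∧ ∀ e ∈ β, ∃ b p o, e = .prim T b p o := by
    intro β
    induction β using List.reverseRecOn with
    | nil =>
      intro _ D₁ hD₁
      refine ⟨_, by simpa using hinv, rfl, ?_, by simp⟩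
      exact Run.deterministic (by simpa using hD₁) hrun
    | append_singleton β e ih =>
      intro hβ D₁ hD₁
      rw [← List.append_assoc] at hD₁
      obtain ⟨D₂, hD₂, hstep⟩ := hD₁.snoc_inv
      obtain ⟨t, ht, hph, rfl, hβ'⟩ := ih (fun e he => hβ e (by simp [he])) D₂ hD₂
      obtain ⟨heT, her⟩ := hβ e (by simp)
      have hph' : (C.put T.proc t).phase T.proc = .busy T (.read x) := by simp [hph]
      cases hstep with
      | invoke T' op hphase =>
        obtain rfl : T' = T := heT
        rw [hph'] at hphase
        rcases hphase with h | h
        · cases h.1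
        · cases h
      | direct T' op b p hpath => obtain rfl : T' = T := heT; exact absurd (hpath.symm.trans hE.path) (by simp)
      | cachedCapacity T' op b p hpath hphase hop hnext hsize =>
        obtain rfl : T' = T := heT
        exfalso
        have hW : Wset (E ++ α ++ [Event.inv T' (TOp.read x)] ++ β ++
            [Event.prim T' b p Outcome.capacityAbort]) T' = ∅ := by
          have := ht.Wset_eq T'
          rw [Wset_append, List.append_assoc E, List.append_assoc E, Wset_append, this,
            Wset_eq_empty hE.notMem]
          ext; simp [Wset]
        refine hcap _ T' ⟨_, hD₁⟩ ⟨.inv T' (.read x), by simp, rfl⟩ hE.path ⟨⟨x, by simp [Rset]⟩, hW⟩ ?_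
          ⟨b, p, by simp⟩
        refine (congrArg Set.ncard ?_).trans_le hm
        have := ht.Dset_read hβ'
        rw [Dset_append, List.append_assoc E, List.append_assoc E, Dset_append, this,
            Dset_eq_empty hE.notMem]
        simp [Dset, Rset, Wset]
      | cachedInvalid T' op b p hpath hphase hop hnext hsize hvalid =>
        obtain rfl : T' = T := heT; exact absurd hE.valid hvalid
      | cachedClash T' op b p hpath hphase hop hnext hsize hvalid hcl =>
        obtain rfl : T' = T := heT
        obtain ⟨j, hj, hj'⟩ := hcl
        rw [Config.put_track_of_ne _ hj, htrack j hj] at hj'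
        exact absurd hj' (by simp [Clashes])
      | cached T' op b p hpath hphase hop hnext hsize hvalid hcl =>
        obtain rfl : T' = T := heT
        simp only [Config.put_loc_self, Config.put_track_self] at hnext hsize
        rw [Config.put_cachedValue, ← List.append_assoc, Config.put_trackAccess]
        refine ⟨_, .snoc _ _ _ _ ht (.access t x b p hph hnext hsize), hph,
          by simp [Implementation.access], ?_⟩
        intro e he
        rcases List.mem_append.1 he with h | h
        · exact hβ' e h
        · exact ⟨_, _, _, List.mem_singleton.1 h⟩
      | commitSuccess T' hpath hphase =>
        obtain rfl : T' = T := heT; rw [hph'] at hphase; cases hphase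
      | commitFailure T' hpath hphase =>
        obtain rfl : T' = T := heT; rw [hph'] at hphase; cases hphase
      | respond T' => obtain rfl : T' = T := heT; exact absurd rfl (her _)
      | respondFinal T' => obtain rfl : T' = T := heT; exact absurd rfl (her _)
      | abort T' => obtain rfl : T' = T := heT; exact absurd rfl (her _)
      | commit T' => obtain rfl : T' = T := heT; exact absurd rfl (her _)
  obtain ⟨t, ht, hph, rfl, hβ'⟩ := key β hβ D₁ hD₁
  have hph' : (C.put T.proc t).phase T.proc = .busy T (.read x) := by simp [hph]
  refine ⟨β, r, t, ht, hph, ?_, ?_, hβ'⟩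
  · cases hstep with
    | respond _ op _ hphase hop hnext => simpa using hnext
    | respondFinal _ op _ hphase hop hnext => simpa using hnext
    | abort _ hphase => rw [hph'] at hphase; cases hphase
    | commit _ hphase => rw [hph'] at hphase; cases hphase
  · cases hstep with
    | respond _ op _ hphase hop hnext hmatch =>
      rw [hph'] at hphase; cases hphase; exact hmatch
    | respondFinal _ op _ hphase hop hnext hmatch =>
      rw [hph'] at hphase; cases hphase; exact hmatch
    | abort _ hphase => rw [hph'] at hphase; cases hphase
    | commit _ hphase => rw [hph'] at hphase; cases hphase

end Implementation

end Progress

end HybridTM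

namespace HybridTM

/-! ### Solo runs that succeed: responses of t-reads, and slow-path writers that commit. -/

section Writers

open Classical

universe u₁ u₂ u₃ u₄ u₅ u₆

variable {n : ℕ} {X : Type u₁} {V : Type u₂} {B : Type u₃} {W : Type u₄} {R : Type u₅}
  {Q : Type u₆}

namespace Implementation

variable {M : Implementation n X V B W R Q}

/-- A t-read of a fast-path transaction that runs solo after a t-complete execution does not
abort. -/
theorem FastReads.response_eq_value (hM : M.Progressive) {E α : List (Event n X V B W R)}
    {C : Config n X V B W Q} {T : Txn n} {t : ProcState n X V B W Q} (hE : M.FreshFast E C T)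
    (hEc : AllTComplete E) (htrack : ∀ j ≠ T.proc, C.track j = fun _ => none)
    (ht : M.FastReads C.mem T α t) {x : X} {r : TResp V} (hph : t.phase = .busy T (.read x))
    (hnext : M.next T t.loc = .respond r) (hr : (TOp.read x : TOp X V).Matches r) :
    ∃ v, r = .value v := by
  have hrun := FastReads.run hE ht fun b p o _ j hj => by simp [Clashes, htrack j hj]
  cases r with
  | value v => exact ⟨v, rfl⟩
  | ok => exact hr.elim
  | commit => exact hr.elim
  | abort =>
    exfalso
    have h1 := Run.snoc _ _ _ _ hrun (.respondFinal _ T (.read x) .abort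
      (by simp [hph]) (.inr (by simp)) (by simpa using hnext) trivial (.inr rfl))
    have hT : ∀ e ∈ α ++ [Event.resp T .abort], e.txn = T := by
      intro e he
      rcases List.mem_append.1 he with h | h
      · exact ht.txn_eq _ h
      · rw [List.mem_singleton.1 h]; rfl
    refine hM.not_aborted (F := E) (G := α ++ [.resp T .abort]) (T := T)
      ⟨_, by simpa using h1⟩ hEc ⟨.resp T .abort, by simp, rfl⟩ ?_ ?_ ?_ ?_
    · intro T' hT'
      rw [txns_subset hT _ hT']
      exact hE.notMem
    · intro T' hT' hne
      exact absurd (txns_subset hT _ hT') hne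
    · rintro ⟨b, p, h⟩
      rw [List.mem_append] at h
      rcases h with h | h
      · exact ht.not_capacityAborts T ⟨b, p, h⟩
      · simp at h
    · rw [Aborted, proj_append, proj_eq_self hT]
      simp

/-- Direct primitives never return `⊥`, so this excuse for an abort is not available to the writers
below. -/
theorem Run.path_of_capacityAborts {E : List (Event n X V B W R)} {C : Config n X V B W Q}
    (h : M.Run E C) {T : Txn n} (hT : CapacityAborts E T) : T.path = .fast := by
  induction h with
  | nil => simp [CapacityAborts] at hT
  | snoc E C e C' hrun hstep ih =>
    obtain ⟨b, p, h⟩ := hT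
    rcases List.mem_append.1 h with h | h
    · exact ih ⟨b, p, h⟩
    · rw [List.mem_singleton] at h
      subst h
      cases hstep with
      | cachedCapacity _ _ _ _ hpath => exact hpath

/-- A t-write or `tryC` of a slow-path transaction that runs solo after a t-complete execution
gets a response, and does not abort. -/
theorem Progressive.exists_slow_response (hM : M.Progressive) (hL : M.ObstructionFreeLiveness)
    {F γ : List (Event n X V B W R)} {C : Config n X V B W Q} {T : Txn n} {op : TOp X V}
    (hF : AllTComplete F) (hTF : T ∉ txns F) (hrun : M.Run (F ++ γ) C)
    (hγ : ∀ e ∈ γ, e.txn = T) (hT : T.path = .slow) (hop : ∀ x, op ≠ .read x)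
    (hph : (C.phase T.proc = .idle ∧ γ = []) ∨ C.phase T.proc = .ready T) :
    ∃ β r C', M.Run (F ++ (γ ++ [.inv T op] ++ β ++ [.resp T r])) C' ∧
      (∀ e ∈ β, ∃ b p o, e = .prim T b p o) ∧ op.Matches r ∧ r ≠ .abort ∧
      (r ≠ .commit → C'.phase T.proc = .ready T) := by
  have h0 := Run.snoc _ _ _ _ hrun (.invoke C T op (hph.imp_left fun h => ⟨h.1, by
    rw [h.2, List.append_nil]; exact hTF⟩) fun x hx => absurd hx (hop x))
  obtain ⟨β, r, hβ, D, hD⟩ := hL.exists_response ⟨_, h0⟩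
  obtain ⟨D₁, hD₁, hstep⟩ := hD.snoc_inv
  have key : ∀ β : List (Event n X V B W R), (∀ e ∈ β, e.txn = T ∧ ∀ r', e ≠ .resp T r') →
      ∀ D₁, M.Run (F ++ γ ++ [.inv T op] ++ β) D₁ → D₁.phase T.proc = .busy T op ∧
        ∀ e ∈ β, ∃ b p o, e = .prim T b p o := by
    intro β
    induction β using List.reverseRecOn with
    | nil =>
      intro _ D₁ hD₁
      rw [List.append_nil] at hD₁
      rw [hD₁.deterministic h0]
      simp [Config.setPhase]
    | append_singleton β e ih =>
      intro hβ D₁ hD₁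
      rw [← List.append_assoc] at hD₁
      obtain ⟨D₂, hD₂, hstep⟩ := hD₁.snoc_inv
      obtain ⟨hph, hβ'⟩ := ih (fun e he => hβ e (by simp [he])) D₂ hD₂
      obtain ⟨heT, her⟩ := hβ e (by simp)
      cases hstep with
      | invoke T' op hphase =>
        obtain rfl : T' = T := heT
        rw [hph] at hphase
        rcases hphase with h | h
        · cases h.1
        · cases h
      | direct T' op' b p hpath hphase hnext =>
        obtain rfl : T' = T := heT
        refine ⟨by simpa [Config.setLoc, Config.invalidate] using hph, ?_⟩
        intro e he
        rcases List.mem_append.1 he with h | h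
        · exact hβ' e h
        · exact ⟨_, _, _, List.mem_singleton.1 h⟩
      | cachedCapacity T' op b p hpath => cases heT; exact absurd (hpath.symm.trans hT) (by simp)
      | cachedInvalid T' op b p hpath => cases heT; exact absurd (hpath.symm.trans hT) (by simp)
      | cachedClash T' op b p hpath => cases heT; exact absurd (hpath.symm.trans hT) (by simp)
      | cached T' op b p hpath => cases heT; exact absurd (hpath.symm.trans hT) (by simp)
      | commitSuccess T' hpath => cases heT; exact absurd (hpath.symm.trans hT) (by simp)
      | commitFailure T' hpath => cases heT; exact absurd (hpath.symm.trans hT) (by simp)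
      | respond T' => cases heT; exact absurd rfl (her _)
      | respondFinal T' => cases heT; exact absurd rfl (her _)
      | abort T' => cases heT; exact absurd rfl (her _)
      | commit T' => cases heT; exact absurd rfl (her _)
  obtain ⟨hph', hβ'⟩ := key β hβ D₁ hD₁
  have hTG : ∀ e ∈ γ ++ [.inv T op] ++ β ++ [.resp T r], e.txn = T := by
    intro e he
    simp only [List.mem_append, List.mem_singleton] at he
    rcases he with ((he | rfl) | he) | rfl
    · exact hγ e he
    · rfl
    · exact (hβ e he).1
    · rfl
  have hD' : M.Run (F ++ (γ ++ [.inv T op] ++ β ++ [.resp T r])) D := by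
    simpa using hD
  -- After the t-complete `F`, the transaction `T` meets no concurrent one, and being slow-path it
  -- has no capacity aborts.
  have hna : r ≠ .abort := by
    rintro rfl
    refine hM.not_aborted (T := T) ⟨_, hD'⟩ hF ⟨.inv T op, by simp, rfl⟩ ?_ ?_ ?_ ?_
    · intro T' hT'
      rw [txns_subset hTG _ hT']
      exact hTF
    · intro T' hT' hne
      exact absurd (txns_subset hTG _ hT') hne
    · rintro ⟨b, p, h⟩
      have := hD'.path_of_capacityAborts (T := T) ⟨b, p, List.mem_append_right _ h⟩
      rw [hT] at this
      cases this
    · rw [Aborted, proj_append, proj_eq_self hTG, ← List.append_assoc, List.getLast?_concat]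
  refine ⟨β, r, D, hD', hβ', ?_, hna, fun hr => ?_⟩
  · cases hstep with
    | respond _ _ _ hphase _ _ hm => rw [hph'] at hphase; cases hphase; exact hm
    | respondFinal _ _ _ hphase _ _ hm => rw [hph'] at hphase; cases hphase; exact hm
    | abort _ hphase => rw [hph'] at hphase; cases hphase
    | commit _ hphase => rw [hph'] at hphase; cases hphase
  · cases hstep with
    | respond _ _ _ hphase => simp [Config.setPhase]
    | respondFinal _ _ _ hphase _ _ _ hf => exact (hf.elim hr hna).elim
    | abort _ hphase => rw [hph'] at hphase; cases hphase
    | commit _ hphase => rw [hph'] at hphase; cases hphase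

/-- A slow-path transaction that runs solo after a t-complete execution and writes to two
t-objects commits. -/
theorem Progressive.exists_writer (hM : M.Progressive) (hL : M.ObstructionFreeLiveness)
    {F : List (Event n X V B W R)} {C : Config n X V B W Q} {T : Txn n}
    (hF : AllTComplete F) (hTF : T ∉ txns F) (hrun : M.Run F C) (hT : T.path = .slow)
    (hph : C.phase T.proc = .idle) (x y : X) (v w : V) :
    ∃ γ γ', M.IsExecution (F ++ (γ ++ γ')) ∧ (∀ e ∈ γ ++ γ', e.txn = T) ∧
      Committed (F ++ (γ ++ γ')) T ∧ .inv T (.write x v) ∈ γ ∧ .inv T (.write y w) ∈ γ ∧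
      .inv T .tryC ∉ γ ∧ .resp T .commit ∉ γ ∧
      ∀ op, .inv T op ∈ γ ++ γ' → op = .write x v ∨ op = .write y w ∨ op = .tryC := by
  obtain ⟨β₁, r₁, C₁, h₁, hβ₁, hm₁, ha₁, hp₁⟩ :=
    hM.exists_slow_response hL (γ := []) (op := .write x v) hF hTF (by simpa using hrun)
      (by simp) hT (by simp) (.inl ⟨hph, rfl⟩)
  have hp₁ := hp₁ (by rintro rfl; exact hm₁)
  obtain ⟨β₂, r₂, C₂, h₂, hβ₂, hm₂, ha₂, hp₂⟩ :=
    hM.exists_slow_response hL (op := .write y w) hF hTF h₁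
      (by
        intro e he
        simp only [List.mem_append, List.mem_singleton, List.not_mem_nil, false_or] at he
        rcases he with (rfl | he) | rfl
        · rfl
        · obtain ⟨_, _, _, rfl⟩ := hβ₁ e he; rfl
        · rfl) hT (by simp) (.inr hp₁)
  have hp₂ := hp₂ (by rintro rfl; exact hm₂)
  obtain ⟨β₃, r₃, C₃, h₃, hβ₃, hm₃, ha₃, -⟩ :=
    hM.exists_slow_response hL (op := .tryC) hF hTF h₂
      (by
        intro e he
        simp only [List.mem_append, List.mem_singleton, List.not_mem_nil, false_or] at he
        rcases he with (((((rfl | he) | rfl) | rfl) | he) | rfl)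
        · rfl
        · obtain ⟨_, _, _, rfl⟩ := hβ₁ e he; rfl
        · rfl
        · rfl
        · obtain ⟨_, _, _, rfl⟩ := hβ₂ e he; rfl
        · rfl) hT (by simp) (.inr hp₂)
  have hr₃ : r₃ = .commit := by
    cases r₃ with
    | value => exact hm₃.elim
    | ok => exact hm₃.elim
    | commit => rfl
    | abort => exact absurd rfl ha₃
  subst hr₃
  have hall : ∀ e ∈ ([] ++ [.inv T (.write x v)] ++ β₁ ++ [.resp T r₁] ++ [.inv T (.write y w)] ++
      β₂ ++ [.resp T r₂] ++ [.inv T .tryC] ++ β₃ ++ [.resp T .commit] :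
        List (Event n X V B W R)), e.txn = T ∧
      ∀ op, e = .inv T op → op = .write x v ∨ op = .write y w ∨ op = .tryC := by
    intro e he
    simp only [List.mem_append, List.mem_singleton, List.not_mem_nil, false_or] at he
    rcases he with ((((((((rfl | he) | rfl) | rfl) | he) | rfl) | rfl) | he) | rfl)
    · simp [Event.txn, eq_comm]
    · obtain ⟨_, _, _, rfl⟩ := hβ₁ e he; simp [Event.txn]
    · simp [Event.txn]
    · simp [Event.txn, eq_comm]
    · obtain ⟨_, _, _, rfl⟩ := hβ₂ e he; simp [Event.txn]
    · simp [Event.txn]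
    · simp [Event.txn, eq_comm]
    · obtain ⟨_, _, _, rfl⟩ := hβ₃ e he; simp [Event.txn]
    · simp [Event.txn]
  -- The run is cut just before the invocation of `tryC`: during `γ` the writer is still invisible
  -- to readers.
  have hγ' : ∀ γ γ' : List (Event n X V B W R), ∀ δ, γ ++ [.inv T .tryC] ++ γ' ++ δ =
    γ ++ ([.inv T .tryC] ++ γ' ++ δ) := by simp
  rw [hγ'] at hall h₃
  refine ⟨_, _, ⟨C₃, h₃⟩, fun e he => (hall e he).1, ?_, by simp, by simp, ?_, ?_,
    fun op hop => (hall _ hop).2 op rfl⟩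
  · rw [Committed, proj_append, proj_eq_self fun e he => (hall e he).1, ← List.append_assoc,
      ← List.append_assoc, List.getLast?_concat]
  · intro h
    simp only [List.mem_append, List.mem_singleton, List.not_mem_nil, false_or] at h
    rcases h with ((((h | h) | h) | h) | h) | h
    · simp at h
    · obtain ⟨_, _, _, h⟩ := hβ₁ _ h; cases h
    · cases h
    · simp at h
    · obtain ⟨_, _, _, h⟩ := hβ₂ _ h; cases h
    · cases h
  · intro h
    simp only [List.mem_append, List.mem_singleton, List.not_mem_nil, false_or] at h
    rcases h with ((((h | h) | h) | h) | h) | h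
    · cases h
    · obtain ⟨_, _, _, h⟩ := hβ₁ _ h; cases h
    · cases h; exact hm₁
    · cases h
    · obtain ⟨_, _, _, h⟩ := hβ₂ _ h; cases h
    · cases h; exact hm₂

end Implementation

end Writers

end HybridTM

namespace HybridTM

/-! ### What opacity says about the values of t-reads. -/

section Opacity

open Classical

universe u₁ u₂ u₃ u₄ u₅ u₆

variable {n : ℕ} {X : Type u₁} {V : Type u₂} {B : Type u₃} {W : Type u₄} {R : Type u₅}
  {Q : Type u₆}

/-- `S` is a legal t-complete t-sequential history that is equivalent to a completion of `H` and
respects its real-time order. -/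
structure IsSerialization (init : X → V) (H S : List (Event n X V B W R)) : Prop where
  sequential : TSequential S
  legal : Legal init S
  precedes : ∀ T T', Precedes H T T' → Precedes S T T'
  txns_eq : txns S = txns H
  proj_eq : ∀ T ∈ txns H, ∃ s, CompletionSuffix T (proj H T) s ∧ proj S T = proj H T ++ s

/-- The order of events in the intermediate completion is irrelevant; only its projections to single
transactions are kept. -/
theorem FinalStateOpaque.exists_serialization {init : X → V} {H : List (Event n X V B W R)}
    (h : FinalStateOpaque init H) : ∃ S, IsSerialization init H S := by
  obtain ⟨S, -, hs, hl, hp, H', ⟨-, h2, h3⟩, h4, h5⟩ := h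
  refine ⟨S, hs, hl, fun T T' hT => hp T hT.1 T' hT.2.1 hT, h4.trans h2, fun T hT => ?_⟩
  obtain ⟨s, hs, hs'⟩ := h3 T hT
  exact ⟨s, hs, by rw [h5 T (by rw [h4, h2]; exact hT), hs']⟩

/-- The position of an event of `T'` after one of `T` excludes that `T'` precedes `T`. -/
theorem not_precedes_of_mem {S S₁ S₂ : List (Event n X V B W R)} {T T' : Txn n}
    (hS : S = S₁ ++ S₂) (h₁ : T ∈ txns S₁) (h₂ : T' ∈ txns S₂) : ¬ Precedes S T' T := by
  rintro ⟨-, -, -, E₁, E₂, hE, hT, hT'⟩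
  rw [hS] at hE
  rcases List.append_eq_append_iff.1 hE with ⟨a, rfl, rfl⟩ | ⟨a, rfl, rfl⟩
  · rw [txns_append] at hT
    exact hT (.inl h₁)
  · rw [txns_append] at hT'
    exact hT' (.inr h₂)

/-- An event of `T` comes before any event of a transaction that `T` precedes. -/
theorem Precedes.mem_left {S S₁ S₂ : List (Event n X V B W R)} {T T' : Txn n}
    {e : Event n X V B W R} (h : Precedes S T T') (hS : S = S₁ ++ S₂) (he : e ∈ S)
    (heT : e.txn = T) (hT' : ∃ e' S₃, S₂ = e' :: S₃ ∧ e'.txn = T') : e ∈ S₁ := by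
  obtain ⟨-, -, -, E₁, E₂, hE, h1, h2⟩ := h
  obtain ⟨e', S₃, rfl, rfl⟩ := hT'
  have heE : e ∈ E₁ := by
    rw [hE] at he
    rcases List.mem_append.1 he with h | h
    · exact h
    · exact absurd ⟨e, h, heT⟩ h2
  rw [hS] at hE
  rcases List.append_eq_append_iff.1 hE with ⟨a, rfl, ha⟩ | ⟨a, rfl, rfl⟩
  · rcases List.mem_append.1 heE with h | h
    · exact h
    · cases a with
      | nil => simp at h
      | cons c a =>
        simp only [List.cons_append, List.cons.injEq] at ha
        refine absurd ⟨e', ?_, rfl⟩ h1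
        simp [ha.1]
  · exact List.mem_append_left _ heE

/-- Since `T₂` has an event, the cut that separates it from `T₁` cannot lie after the cut that
separates it from `T₃`. -/
theorem Precedes.trans {S : List (Event n X V B W R)} {T₁ T₂ T₃ : Txn n}
    (h : Precedes S T₁ T₂) (h' : Precedes S T₂ T₃) : Precedes S T₁ T₃ := by
  obtain ⟨h1, h2, h3, E₁, E₂, hE, h4, h5⟩ := h
  obtain ⟨h1', h2', h3', E₁', E₂', hE', h4', h5'⟩ := h'
  refine ⟨h1, h2', h3, E₁', E₂', hE', h4', ?_⟩
  rw [hE] at hE'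
  rcases List.append_eq_append_iff.1 hE' with ⟨a, rfl, rfl⟩ | ⟨a, rfl, rfl⟩
  · rw [txns_append] at h5
    exact fun h => h5 (.inr h)
  · exfalso
    rw [hE, txns_append, txns_append] at h2
    rw [txns_append] at h4 h5'
    simp only [Set.mem_union] at *
    tauto

/-- In a t-sequential history, consecutive events of a transaction are adjacent. -/
theorem TSequential.adjacent {S : List (Event n X V B W R)} (hS : TSequential S) {T : Txn n}
    {l₁ l₂ : List (Event n X V B W R)} {e e' : Event n X V B W R}
    (h : proj S T = l₁ ++ e :: e' :: l₂) : ∃ S₁ S₂, S = S₁ ++ e :: e' :: S₂ := by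
  have heT : e.txn = T := (mem_proj.1 (h ▸ by simp : e ∈ proj S T)).2
  have heT' : e'.txn = T := (mem_proj.1 (h ▸ by simp : e' ∈ proj S T)).2
  obtain ⟨A, A', rfl, hA, hA'⟩ := List.filter_eq_append_iff.1 h
  obtain ⟨Z, A'', rfl, hZ, heZ, hA''⟩ := List.filter_eq_cons_iff.1 hA'
  obtain ⟨Y, A₃, rfl, hY, heY, hA₃⟩ := List.filter_eq_cons_iff.1 hA''
  rcases Y with _ | ⟨c, Y⟩
  · exact ⟨A ++ Z, A₃, by simp⟩
  · exfalso
    -- A foreign event between two events of `T` would belong to a transaction concurrent with `T`.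
    -- Adjacency matters because `Legal` speaks only of responses that directly follow their
    -- invocations.
    have hc : c.txn ≠ T := by simpa using hY c (by simp)
    have hcS : c.txn ∈ txns (A ++ (Z ++ e :: (c :: Y ++ e' :: A₃))) := ⟨c, by simp, rfl⟩
    have hTS : T ∈ txns (A ++ (Z ++ e :: (c :: Y ++ e' :: A₃))) := ⟨e, by simp, heT⟩
    refine hS T c.txn ⟨hTS, hcS, hc.symm, ?_, ?_⟩
    · exact not_precedes_of_mem (S₁ := A ++ Z ++ [e, c]) (S₂ := Y ++ e' :: A₃) (by simp)
        ⟨c, by simp, rfl⟩ ⟨e', by simp, heT'⟩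
    · exact not_precedes_of_mem (S₁ := A ++ Z ++ [e]) (S₂ := c :: Y ++ e' :: A₃) (by simp)
        ⟨e, by simp, heT⟩ ⟨c, by simp, rfl⟩

theorem writtenValue_eq_some {P : Txn n → Prop} {x : X} {e : Event n X V B W R} {v : V} :
    writtenValue P x e = some v ↔ ∃ T, P T ∧ e = .inv T (.write x v) := by
  constructor
  · intro h
    rcases e with ⟨T, _ | ⟨y, w⟩ | _⟩ | _ | _ | _ <;> simp [writtenValue] at h
    obtain ⟨⟨h1, rfl⟩, rfl⟩ := h
    exact ⟨T, h1, rfl⟩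
  · rintro ⟨T, hT, rfl⟩
    simp [writtenValue, hT]

namespace IsSerialization

variable {init : X → V} {H S : List (Event n X V B W R)}

/-- Completions append only `tryC` and final responses, never writes. -/
theorem write_mem_iff (h : IsSerialization init H S) {T : Txn n} {x : X} {v : V} :
    .inv T (.write x v) ∈ S ↔ .inv T (.write x v) ∈ H := by
  have key : T ∈ txns H → (Event.inv T (.write x v) ∈ proj S T ↔
      Event.inv T (.write x v) ∈ proj H T) := fun hT => by
    obtain ⟨s, hs, hs'⟩ := h.proj_eq T hT
    rw [hs']
    cases hs <;> simp
  simp only [mem_proj, Event.txn, and_true] at key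
  constructor
  · intro h'
    exact (key (h.txns_eq ▸ ⟨_, h', rfl⟩)).1 h'
  · intro h'
    exact (key ⟨_, h', rfl⟩).2 h'

theorem committed (h : IsSerialization init H S) {T : Txn n} (hT : Committed H T) :
    Committed S T := by
  have hmem : T ∈ txns H := by
    have := List.mem_of_getLast? hT
    exact ⟨_, (mem_proj.1 this).1, rfl⟩
  obtain ⟨s, hs, hs'⟩ := h.proj_eq T hmem
  rw [Committed] at hT
  cases hs with
  | tComplete r hr hl => rw [Committed, hs', List.append_nil, hT]
  | pendingAbort op hl => rw [hT] at hl; cases hl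
  | pendingCommit hl => rw [hT] at hl; cases hl
  | complete r hr hl => rw [hT] at hl; cases hl; exact absurd (.inl rfl) hr

/-- A transaction that is committed in a serialization has invoked `tryC` or has committed. -/
theorem of_committed (h : IsSerialization init H S) {T : Txn n} (hT : Committed S T) :
    .inv T .tryC ∈ H ∨ .resp T .commit ∈ H := by
  have hmem : T ∈ txns S := ⟨_, (mem_proj.1 (List.mem_of_getLast? hT)).1, rfl⟩
  rw [h.txns_eq] at hmem
  obtain ⟨s, hs, hs'⟩ := h.proj_eq T hmem
  rw [Committed, hs'] at hT
  have key : ∀ {e}, (proj H T).getLast? = some e → e ∈ H := fun he =>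
    (mem_proj.1 (List.mem_of_getLast? he)).1
  cases hs with
  | tComplete r hr hl => rw [List.append_nil] at hT; exact .inr (key hT)
  | pendingAbort op hl => simp at hT
  | pendingCommit hl => exact .inl (key hl)
  | complete r hr hl => simp at hT

/-- The value returned by a t-read of a transaction that does not write. -/
theorem read_value (h : IsSerialization init H S) {T : Txn n} {x : X} {v : V}
    {l₁ l₂ : List (Event n X V B W R)}
    (hT : proj H T = l₁ ++ .inv T (.read x) :: .resp T (.value v) :: l₂)
    (hw : ∀ u, .inv T (.write x u) ∉ H) :
    ∃ S₁ S₂, S = S₁ ++ .inv T (.read x) :: S₂ ∧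
      v = ((S₁.filterMap (writtenValue (Committed S) x)).getLast?).getD (init x) := by
  have hmem : T ∈ txns H := by
    have : Event.inv T (.read x) ∈ proj H T := by simp [hT]
    exact ⟨_, (mem_proj.1 this).1, rfl⟩
  obtain ⟨s, -, hs⟩ := h.proj_eq T hmem
  rw [hT, List.append_assoc, List.cons_append, List.cons_append] at hs
  obtain ⟨S₁, S₂, hS⟩ := h.sequential.adjacent hs
  refine ⟨S₁, _, hS, ?_⟩
  have hl := h.legal S₁ S₂ T x v hS
  -- Without writes of its own, `T` falls through to the latest committed write in `latestValue`.
  have hnil : S₁.filterMap (writtenValue (fun T' => T' = T) x) = [] := by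
    rw [List.filterMap_eq_nil_iff]
    intro e he
    rw [Option.eq_none_iff_forall_ne_some]
    intro u hu
    obtain ⟨T', rfl, rfl⟩ := writtenValue_eq_some.1 hu
    refine hw u (h.write_mem_iff.1 ?_)
    rw [hS]
    exact List.mem_append_left _ he
  rwa [latestValue, hnil, List.getLast?_nil, Option.getD_none] at hl

/-- If a t-read does not return the initial value, the only writer of the t-object is committed
and precedes the reader. -/
theorem writer_of_ne_init (h : IsSerialization init H S) {T T₀ : Txn n} {x : X} {v : V}
    {l₁ l₂ : List (Event n X V B W R)}
    (hT : proj H T = l₁ ++ .inv T (.read x) :: .resp T (.value v) :: l₂)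
    (hw : ∀ T' u, .inv T' (.write x u) ∈ H → T' = T₀) (hne : T ≠ T₀) (hv : v ≠ init x) :
    Committed S T₀ ∧ Precedes S T₀ T := by
  obtain ⟨S₁, S₂, hS, hval⟩ := h.read_value hT fun u hu => hne (hw T u hu)
  rcases hl : (S₁.filterMap (writtenValue (Committed S) x)).getLast? with _ | u
  · rw [hl] at hval
    exact absurd hval hv
  · obtain ⟨e, he, hu⟩ := List.mem_filterMap.1 (List.mem_of_getLast? hl)
    obtain ⟨T', hT', rfl⟩ := writtenValue_eq_some.1 hu
    have heS : Event.inv T' (.write x u) ∈ S := by rw [hS]; exact List.mem_append_left _ he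
    obtain rfl := hw T' u (h.write_mem_iff.1 heS)
    refine ⟨hT', ?_⟩
    -- In `S` the write comes before the read, so `T` does not precede `T'`; as `S` is t-sequential,
    -- `T'` precedes `T`.
    by_contra hp
    refine h.sequential T' T ⟨⟨_, heS, rfl⟩, ⟨.inv T (.read x), by simp [hS], rfl⟩, hne.symm, hp,
      ?_⟩
    exact not_precedes_of_mem hS ⟨_, he, rfl⟩ ⟨.inv T (.read x), by simp, rfl⟩

/-- A t-read returns the value written by a committed transaction that precedes it if no other
transaction writes to the t-object. -/
theorem read_eq_written (h : IsSerialization init H S) {T T₀ : Txn n} {x : X} {v w : V}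
    {l₁ l₂ : List (Event n X V B W R)}
    (hT : proj H T = l₁ ++ .inv T (.read x) :: .resp T (.value v) :: l₂)
    (hw : ∀ T' u, .inv T' (.write x u) ∈ H → T' = T₀ ∧ u = w) (hne : T ≠ T₀)
    (hwrite : .inv T₀ (.write x w) ∈ H) (hc : Committed S T₀) (hp : Precedes S T₀ T) :
    v = w := by
  obtain ⟨S₁, S₂, hS, hval⟩ := h.read_value hT fun u hu => hne (hw T u hu).1
  have hmem : w ∈ S₁.filterMap (writtenValue (Committed S) x) :=
    List.mem_filterMap.2 ⟨_, hp.mem_left hS (h.write_mem_iff.2 hwrite) rfl ⟨_, _, rfl, rfl⟩,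
      writtenValue_eq_some.2 ⟨T₀, hc, rfl⟩⟩
  rcases hl : (S₁.filterMap (writtenValue (Committed S) x)).getLast? with _ | u
  · rw [List.getLast?_eq_none_iff] at hl
    rw [hl] at hmem
    simp at hmem
  · rw [hl, Option.getD_some] at hval
    obtain ⟨e, he, hu⟩ := List.mem_filterMap.1 (List.mem_of_getLast? hl)
    obtain ⟨T', hT', rfl⟩ := writtenValue_eq_some.1 hu
    rw [hval]
    exact (hw T' u (h.write_mem_iff.1 (by rw [hS]; exact List.mem_append_left _ he))).2

end IsSerialization

/-- A t-read of `x` by `T` returns `v` in `E`. -/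
def ReadsValue (E : List (Event n X V B W R)) (T : Txn n) (x : X) (v : V) : Prop :=
  ∃ E₁ β E₂, E = E₁ ++ [.inv T (.read x)] ++ β ++ [.resp T (.value v)] ++ E₂ ∧
    ∀ e ∈ β, ∃ b p o, e = .prim T b p o

theorem ReadsValue.append {E : List (Event n X V B W R)} {T : Txn n} {x : X} {v : V}
    (h : ReadsValue E T x v) (E' : List (Event n X V B W R)) : ReadsValue (E ++ E') T x v := by
  obtain ⟨E₁, β, E₂, rfl, hβ⟩ := h
  exact ⟨E₁, β, E₂ ++ E', by simp, hβ⟩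

theorem ReadsValue.append_left {E : List (Event n X V B W R)} {T : Txn n} {x : X} {v : V}
    (h : ReadsValue E T x v) (E' : List (Event n X V B W R)) : ReadsValue (E' ++ E) T x v := by
  obtain ⟨E₁, β, E₂, rfl, hβ⟩ := h
  exact ⟨E' ++ E₁, β, E₂, by simp, hβ⟩

theorem history_append (E E' : List (Event n X V B W R)) :
    history (E ++ E') = history E ++ history E' := List.filter_append ..

theorem ReadsValue.proj_history {E : List (Event n X V B W R)} {T : Txn n} {x : X} {v : V}
    (h : ReadsValue E T x v) : ∃ l₁ l₂, proj (history E) T =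
      l₁ ++ .inv T (.read x) :: .resp T (.value v) :: l₂ := by
  obtain ⟨E₁, β, E₂, rfl, hβ⟩ := h
  refine ⟨proj (history E₁) T, proj (history E₂) T, ?_⟩
  have h1 : history β = [] := by
    simp only [history, List.filter_eq_nil_iff, decide_eq_true_eq]
    intro e he
    obtain ⟨b, p, o, rfl⟩ := hβ e he
    exact id
  have h2 : history [(.inv T (.read x) : Event n X V B W R)] = [.inv T (.read x)] := by
    exact List.filter_cons_of_pos (decide_eq_true trivial)
  have h3 : history [(.resp T (.value v) : Event n X V B W R)] = [.resp T (.value v)] := by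
    exact List.filter_cons_of_pos (decide_eq_true trivial)
  simp only [history_append, proj_append, h1, h2, h3]
  simp [proj, Event.txn]

theorem write_mem_history {E : List (Event n X V B W R)} {T : Txn n} {op : TOp X V} :
    .inv T op ∈ history E ↔ .inv T op ∈ E := by
  simp only [history, List.mem_filter, decide_eq_true_eq, and_iff_left_iff_imp]
  exact fun _ => trivial

theorem Committed.history {E : List (Event n X V B W R)} {T : Txn n} (h : Committed E T) :
    Committed (history E) T := by
  rw [Committed, List.getLast?_eq_some_iff] at h
  obtain ⟨l, hl⟩ := h
  have : proj (HybridTM.history E) T = HybridTM.history (proj E T) := by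
    simp only [proj, HybridTM.history, List.filter_filter, Bool.and_comm]
  have h3 : HybridTM.history [(.resp T .commit : Event n X V B W R)] = [.resp T .commit] :=
    List.filter_cons_of_pos (decide_eq_true trivial)
  rw [Committed, this, hl, history_append, h3, List.getLast?_concat]

theorem Precedes.history_of_committed {E : List (Event n X V B W R)} {T T' : Txn n}
    (h : Precedes E T T') (hc : Committed E T) (hT' : T' ∈ txns (history E)) :
    Precedes (history E) T T' := by
  obtain ⟨-, -, -, E₁, E₂, rfl, h1, h2⟩ := h
  have hc' := hc.history
  refine ⟨⟨_, (mem_proj.1 (List.mem_of_getLast? hc')).1, rfl⟩, hT', .inl hc', history E₁,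
    history E₂, history_append .., ?_, ?_⟩
  · rintro ⟨e, he, rfl⟩
    exact h1 ⟨e, List.mem_of_mem_filter he, rfl⟩
  · rintro ⟨e, he, rfl⟩
    exact h2 ⟨e, List.mem_of_mem_filter he, rfl⟩

theorem ReadsValue.mem_txns_history {E : List (Event n X V B W R)} {T : Txn n} {x : X} {v : V}
    (h : ReadsValue E T x v) : T ∈ txns (history E) := by
  obtain ⟨l₁, l₂, h⟩ := h.proj_history
  have : Event.inv T (.read x) ∈ proj (history E) T := by simp [h]
  exact ⟨_, (mem_proj.1 this).1, rfl⟩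

namespace Implementation

variable {M : Implementation n X V B W R Q}

theorem SatisfiesOpacity.exists_serialization (hM : M.SatisfiesOpacity)
    {E : List (Event n X V B W R)} (hE : M.IsExecution E) :
    ∃ S, IsSerialization M.initVal (history E) S :=
  (hM E hE _ (List.prefix_refl _)).exists_serialization

/-- A transaction that has not invoked `tryC` is not visible to other transactions. -/
theorem SatisfiesOpacity.read_eq_init_of_live (hM : M.SatisfiesOpacity)
    {E : List (Event n X V B W R)} (hE : M.IsExecution E) {T T₀ : Txn n} {x : X} {v : V}
    (hr : ReadsValue E T x v) (hw : ∀ T' u, .inv T' (.write x u) ∈ E → T' = T₀)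
    (hne : T ≠ T₀) (hlive : .inv T₀ .tryC ∉ E) (hlive' : .resp T₀ .commit ∉ E) :
    v = M.initVal x := by
  obtain ⟨S, hS⟩ := hM.exists_serialization hE
  obtain ⟨l₁, l₂, hl⟩ := hr.proj_history
  by_contra hv
  obtain ⟨hc, -⟩ := hS.writer_of_ne_init hl
    (fun T' u hu => hw T' u (write_mem_history.1 hu)) hne hv
  rcases hS.of_committed hc with h | h
  · exact hlive (List.mem_of_mem_filter h)
  · exact hlive' (List.mem_of_mem_filter h)

/-- A committed writer is visible to the transactions that it precedes. -/
theorem SatisfiesOpacity.read_eq_of_precedes (hM : M.SatisfiesOpacity)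
    {E : List (Event n X V B W R)} (hE : M.IsExecution E) {T T₀ : Txn n} {x : X} {v w : V}
    (hr : ReadsValue E T x v) (hw : ∀ T' u, .inv T' (.write x u) ∈ E → T' = T₀ ∧ u = w)
    (hne : T ≠ T₀) (hwrite : .inv T₀ (.write x w) ∈ E) (hc : Committed E T₀)
    (hp : Precedes E T₀ T) : v = w := by
  obtain ⟨S, hS⟩ := hM.exists_serialization hE
  obtain ⟨l₁, l₂, hl⟩ := hr.proj_history
  exact hS.read_eq_written hl (fun T' u hu => hw T' u (write_mem_history.1 hu)) hne
    (write_mem_history.2 hwrite) (hS.committed hc.history)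
    (hS.precedes _ _ (hp.history_of_committed hc hr.mem_txns_history))

/-- If a committed transaction has seen a writer, so do the transactions that it precedes. -/
theorem SatisfiesOpacity.read_eq_of_seen (hM : M.SatisfiesOpacity)
    {E : List (Event n X V B W R)} (hE : M.IsExecution E) {T T' T₀ : Txn n} {x y : X}
    {v v' w : V} (hr : ReadsValue E T x v) (hr' : ReadsValue E T' y v')
    (hw : ∀ S u, .inv S (.write x u) ∈ E → S = T₀)
    (hw' : ∀ S u, .inv S (.write y u) ∈ E → S = T₀ ∧ u = w)
    (hne : T ≠ T₀) (hne' : T' ≠ T₀) (hwrite : .inv T₀ (.write y w) ∈ E)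
    (hv : v ≠ M.initVal x) (hc : Committed E T) (hp : Precedes E T T') : v' = w := by
  obtain ⟨S, hS⟩ := hM.exists_serialization hE
  obtain ⟨l₁, l₂, hl⟩ := hr.proj_history
  obtain ⟨l₁', l₂', hl'⟩ := hr'.proj_history
  -- The writer may still be pending in `E`; having been seen by `T`, it is committed in the
  -- serialization and placed before `T`, hence before `T'`.
  obtain ⟨hc₀, hp₀⟩ := hS.writer_of_ne_init hl
    (fun T' u hu => hw T' u (write_mem_history.1 hu)) hne hv
  exact hS.read_eq_written hl' (fun T' u hu => hw' T' u (write_mem_history.1 hu)) hne'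
    (write_mem_history.2 hwrite) hc₀
    (hp₀.trans (hS.precedes _ _ (hp.history_of_committed hc hr'.mem_txns_history)))

end Implementation

end Opacity

end HybridTM

namespace HybridTM

/-! ### Lists sorted by a numerical key. -/

section Sorted

variable {A : Type*}

theorem sorted_eq_filter_append {f : A → ℕ} {l : List A}
    (h : l.Pairwise fun a b => f a ≤ f b) (K : ℕ) :
    l = l.filter (fun a => f a < K) ++ l.filter (fun a => K ≤ f a) := by
  induction l with
  | nil => rfl
  | cons a l ih =>
    rw [List.pairwise_cons] at h
    by_cases ha : f a < K
    · rw [List.filter_cons_of_pos (by simpa using ha), List.filter_cons_of_neg (by simpa using ha),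
        List.cons_append, ← ih h.2]
    · have h1 : l.filter (fun a => f a < K) = [] := by
        rw [List.filter_eq_nil_iff]
        intro b hb
        have := h.1 b hb
        simp only [decide_eq_true_eq]
        omega
      have h2 := ih h.2
      rw [h1, List.nil_append] at h2
      rw [List.filter_cons_of_neg (by simpa using ha), List.filter_cons_of_pos (by simpa using ha),
        h1, List.nil_append, ← h2]

/-- A sorted list is the concatenation of its level lists. Applied with transaction indices as keys,
this reconstructs an execution from its projections. -/
theorem filter_lt_eq_of_sorted {f : A → ℕ} {l l' : List A}
    (h : l.Pairwise fun a b => f a ≤ f b) (h' : l'.Pairwise fun a b => f a ≤ f b) {N : ℕ}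
    (heq : ∀ k < N, l.filter (fun a => f a = k) = l'.filter (fun a => f a = k)) :
    l.filter (fun a => f a < N) = l'.filter (fun a => f a < N) := by
  have key : ∀ (l : List A), l.Pairwise (fun a b => f a ≤ f b) → ∀ K,
      l.filter (fun a => f a < K + 1) =
        l.filter (fun a => f a < K) ++ l.filter (fun a => f a = K) := by
    intro l h K
    conv_lhs => rw [sorted_eq_filter_append (h.filter (fun a => f a < K + 1)) K]
    simp only [List.filter_filter]
    congr 2 <;> funext a <;> simp only [← Bool.decide_and, decide_eq_decide] <;> omega
  induction N with
  | zero => simp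
  | succ K ih =>
    rw [key l h, key l' h', ih fun k hk => heq k (by omega), heq K (by omega)]

end Sorted

/-! ### Executions that witness the appearance of t-sequentiality, and slow-path prefixes. -/

section Witness

open Classical

universe u₁ u₂ u₃ u₄ u₅ u₆

variable {n : ℕ} {X : Type u₁} {V : Type u₂} {B : Type u₃} {W : Type u₄} {R : Type u₅}
  {Q : Type u₆}

theorem not_precedes_self (E : List (Event n X V B W R)) (T : Txn n) : ¬ Precedes E T T := by
  rintro ⟨h, -, -, E₁, E₂, rfl, h1, h2⟩
  rw [txns_append] at h
  exact h.elim h1 h2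

theorem tComplete_append_iff {E E' : List (Event n X V B W R)} {T : Txn n} (h : T ∉ txns E') :
    TComplete (E ++ E') T ↔ TComplete E T := by
  rw [TComplete, TComplete, Committed, Committed, Aborted, Aborted, proj_append, proj_eq_nil h,
    List.append_nil]

/-- The later transaction already has an event in `E`, so the separating cut falls inside `E`. -/
theorem Precedes.of_append {E E' : List (Event n X V B W R)} {T T' : Txn n}
    (h : Precedes (E ++ E') T T') (hT : T ∉ txns E') (hT' : T' ∈ txns E) : Precedes E T T' := by
  obtain ⟨h1, -, h3, E₁, E₂, hE, h4, h5⟩ := h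
  rw [txns_append] at h1
  refine ⟨h1.resolve_right hT, hT', (tComplete_append_iff hT).1 h3, ?_⟩
  rcases List.append_eq_append_iff.1 hE with ⟨a, rfl, rfl⟩ | ⟨a, rfl, rfl⟩
  · rw [txns_append] at h4
    exact absurd (.inl hT') h4
  · rw [txns_append] at h5
    exact ⟨E₁, a, rfl, h4, fun h => h5 (.inl h)⟩

namespace Implementation

variable (M : Implementation n X V B W R Q)

/-- `E'` is a t-complete execution as in the definition of `AppearsTSequential`, which does not
refer to the events of `T` yet. -/
structure IsWitness (E : List (Event n X V B W R)) (T : Txn n)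
    (E' : List (Event n X V B W R)) : Prop where
  exec : M.IsExecution E'
  subset : txns E' ⊆ txns E \ {T}
  complete : AllTComplete E'
  proj_eq : ∀ T' ∈ txns E, Precedes E T' T → T' ∈ txns E' ∧ proj E T' = proj E' T'
  precedes : ∀ T₁ ∈ txns E', ∀ T₂ ∈ txns E', Precedes E T₁ T₂ → Precedes E' T₁ T₂
  sets : ∀ T' ∈ txns E', Rset E' T' ⊆ Rset E T' ∧ Wset E' T' ⊆ Wset E T'

/-- Executions of slow-path transactions of process `p`, ordered by their indices, which are
smaller than `N`. -/
structure SlowPrefix (p : Fin n) (N : ℕ) (F : List (Event n X V B W R)) : Prop where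
  exec : M.IsExecution F
  complete : AllTComplete F
  slow : ∀ e ∈ F, e.txn.proc = p ∧ e.txn.path = .slow
  lt : ∀ e ∈ F, e.txn.idx < N
  sorted : F.Pairwise fun e e' => e.txn.idx ≤ e'.txn.idx

variable {M}

theorem appearsTSequential_iff {E : List (Event n X V B W R)} {T : Txn n} :
    M.AppearsTSequential E T ↔
      T ∈ txns E ∧ ∃ E', M.IsWitness E T E' ∧ M.IsExecution (E' ++ proj E T) := by
  constructor
  · rintro ⟨h, E', h1, h2, h3, h4, h5, h6, h7⟩
    exact ⟨h, E', ⟨h1, h2, h3, h4, h5, h6⟩, h7⟩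
  · rintro ⟨h, E', ⟨h1, h2, h3, h4, h5, h6⟩, h7⟩
    exact ⟨h, E', h1, h2, h3, h4, h5, h6, h7⟩

/-- A further event of `T`, which has already started, adds no transactions before `T` and no order
among the others. So a witness stays one as long as `T` can perform its events after it. -/
theorem IsWitness.snoc {E E' : List (Event n X V B W R)} {T : Txn n} {e : Event n X V B W R}
    (h : M.IsWitness E T E') (hT : T ∈ txns E) (he : e.txn = T) :
    M.IsWitness (E ++ [e]) T E' := by
  have hn : ∀ T', T' ≠ T → T' ∉ txns [e] := by
    rintro T' hT' ⟨e', he', rfl⟩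
    rw [List.mem_singleton.1 he'] at hT'
    exact hT' he
  have hne : ∀ T' ∈ txns E', T' ≠ T := fun T' hT' => (h.subset hT').2
  refine ⟨h.exec, fun T' hT' => ⟨?_, hne T' hT'⟩, h.complete, fun T' hT' hp => ?_,
    fun T₁ h₁ T₂ h₂ hp => ?_, fun T' hT' => ?_⟩
  · rw [txns_append]
    exact .inl (h.subset hT').1
  · have hT'T : T' ≠ T := by
      rintro rfl
      exact not_precedes_self _ _ hp
    have hp' := hp.of_append (hn T' hT'T) hT
    rw [proj_append, proj_eq_nil (hn T' hT'T), List.append_nil]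
    exact h.proj_eq T' hp'.1 hp'
  · exact h.precedes T₁ h₁ T₂ h₂ (hp.of_append (hn T₁ (hne T₁ h₁)) (h.subset h₂).1)
  · rw [Rset_append, Wset_append]
    exact ⟨(h.sets T' hT').1.trans Set.subset_union_left,
      (h.sets T' hT').2.trans Set.subset_union_left⟩

theorem IsWitness.of_prefix {E ρ : List (Event n X V B W R)} {T : Txn n}
    (hE : M.IsExecution E) (hc : AllTComplete E) (hT : T ∉ txns E)
    (hd : ∀ T' ∈ txns E, T' ∉ txns ρ)
    (hp : ∀ T', Precedes (E ++ ρ) T' T → T' ∈ txns E) : M.IsWitness (E ++ ρ) T E := by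
  refine ⟨hE, fun T' hT' => ⟨?_, ?_⟩, hc, fun T' _ h => ⟨hp T' h, ?_⟩,
    fun T₁ h₁ T₂ h₂ h => h.of_append (hd T₁ h₁) h₂, fun T' hT' => ?_⟩
  · rw [txns_append]
    exact .inl hT'
  · rintro rfl
    exact hT hT'
  · rw [proj_append, proj_eq_nil (hd T' (hp T' h)), List.append_nil]
  · rw [Rset_append, Wset_append]
    exact ⟨Set.subset_union_left, Set.subset_union_left⟩

namespace SlowPrefix

variable {p : Fin n} {N : ℕ} {F : List (Event n X V B W R)}

theorem notMem (hF : M.SlowPrefix p N F) : (⟨p, .slow, N⟩ : Txn n) ∉ txns F := by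
  rintro ⟨e, he, h⟩
  have := hF.lt e he
  rw [h] at this
  exact lt_irrefl _ this

theorem notMem_of_proc_ne (hF : M.SlowPrefix p N F) {T : Txn n} (hT : T.proc ≠ p) :
    T ∉ txns F := by
  rintro ⟨e, he, rfl⟩
  exact hT (hF.slow e he).1

/-- The index `N` is larger than all indices in `F`, so the order by indices persists. -/
theorem append (hF : M.SlowPrefix p N F) {δ : List (Event n X V B W R)}
    (hex : M.IsExecution (F ++ δ)) (hc : AllTComplete (F ++ δ))
    (hδ : ∀ e ∈ δ, e.txn = ⟨p, .slow, N⟩) : M.SlowPrefix p (N + 1) (F ++ δ) := by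
  refine ⟨hex, hc, ?_, ?_, ?_⟩
  · intro e he
    rcases List.mem_append.1 he with h | h
    · exact hF.slow e h
    · simp [hδ e h]
  · intro e he
    rcases List.mem_append.1 he with h | h
    · exact (hF.lt e h).trans (Nat.lt_succ_self N)
    · simp [hδ e h]
  · rw [List.pairwise_append]
    refine ⟨hF.sorted, ?_, ?_⟩
    · rw [List.pairwise_iff_forall_sublist]
      intro a b hab
      have ha := hδ a (hab.subset (by simp))
      have hb := hδ b (hab.subset (by simp))
      rw [ha, hb]
    · intro a ha b hb
      rw [hδ b hb]
      exact (hF.lt a ha).le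

/-- A witness for an execution that consists of a slow prefix, events of a single slow-path
transaction, and events of a fast-path transaction extends the slow prefix. -/
theorem exists_eq_append (hF : M.SlowPrefix p N F) {δ ρ E' : List (Event n X V B W R)}
    {T : Txn n} (hδ : ∀ e ∈ δ, e.txn = ⟨p, .slow, N⟩) (hρ : ∀ e ∈ ρ, e.txn = T)
    (hT : T.proc ≠ p) (hTρ : T ∈ txns ρ) (h : M.IsWitness (F ++ δ ++ ρ) T E') :
    ∃ δ', E' = F ++ δ' ∧ (∀ e ∈ δ', e.txn = ⟨p, .slow, N⟩) ∧
      Dset δ' ⟨p, .slow, N⟩ ⊆ Dset δ ⟨p, .slow, N⟩ := by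
  have hTF : T ∉ txns F := hF.notMem_of_proc_ne hT
  have hTδ : T ∉ txns δ := fun h => hT (by rw [txns_subset hδ _ h])
  have hTE : T ∈ txns (F ++ δ ++ ρ) := by rw [txns_append]; exact .inr hTρ
  have hρ' : ∀ T' ∈ txns ρ, T' = T := txns_subset hρ
  have hδ' : ∀ T' ∈ txns δ, T' = ⟨p, .slow, N⟩ := txns_subset hδ
  have hFsub : ∀ T' ∈ txns F, T'.proc = p ∧ T'.path = .slow ∧ T'.idx < N := by
    rintro _ ⟨e, he, rfl⟩
    exact ⟨(hF.slow e he).1, (hF.slow e he).2, hF.lt e he⟩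
  have hE'sub : ∀ T' ∈ txns E', T' ∈ txns F ∨ T' = ⟨p, .slow, N⟩ := by
    intro T' hT'
    obtain ⟨h1, h2⟩ := h.subset hT'
    rw [txns_append, txns_append] at h1
    rcases h1 with (h1 | h1) | h1
    · exact .inl h1
    · exact .inr (hδ' T' h1)
    · exact absurd (hρ' T' h1) h2
  have hE'p : ∀ e ∈ E', e.txn.proc = p ∧ e.txn.path = .slow ∧ e.txn.idx ≤ N := by
    intro e he
    rcases hE'sub _ (mem_txns_of_mem he) with h | h
    · exact ⟨(hFsub _ h).1, (hFsub _ h).2.1, (hFsub _ h).2.2.le⟩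
    · rw [h]; exact ⟨rfl, rfl, le_refl _⟩
  have hnot : ∀ T' ∈ txns F, T' ∉ txns (δ ++ ρ) := by
    intro T' hT' h'
    rw [txns_append] at h'
    rcases h' with h' | h'
    · rw [hδ' T' h'] at hT'
      exact hF.notMem hT'
    · rw [hρ' T' h'] at hT'
      exact hTF hT'
  have hcompl : ∀ T' ∈ txns F, TComplete (F ++ δ ++ ρ) T' := fun T' hT' => by
    rw [List.append_assoc]
    exact (tComplete_append_iff (hnot T' hT')).2 (hF.complete T' hT')
  have hFE : ∀ T' ∈ txns F, T' ∈ txns (F ++ δ ++ ρ) := fun T' hT' => by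
    rw [txns_append, txns_append]; exact .inl (.inl hT')
  -- All transactions of `F` are complete before `T` starts, so the witness must reproduce them
  -- event by event.
  have hproj : ∀ T' ∈ txns F, T' ∈ txns E' ∧ proj F T' = proj E' T' := by
    intro T' hT'
    have hp : Precedes (F ++ δ ++ ρ) T' T :=
      ⟨hFE T' hT', hTE, hcompl T' hT', F, δ ++ ρ, by simp, hTF, hnot T' hT'⟩
    have := h.proj_eq T' (hFE T' hT') hp
    rw [List.append_assoc, proj_append, proj_eq_nil (hnot T' hT'), List.append_nil] at this
    exact this
  -- Real-time order on `F ++ δ` is order by index, and the witness respects it. This is what the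
  -- sortedness in `SlowPrefix` is for: together with the projections it pins down the part of `E'`
  -- with indices below `N`.
  have hsorted : E'.Pairwise fun e e' => e.txn.idx ≤ e'.txn.idx := by
    rw [List.pairwise_iff_forall_sublist]
    intro a b hab
    by_contra hlt
    rw [not_le] at hlt
    have ha : a ∈ E' := hab.subset (by simp)
    have hb : b ∈ E' := hab.subset (by simp)
    have hbF : b.txn ∈ txns F := by
      rcases hE'sub _ (mem_txns_of_mem hb) with h | h
      · exact h
      · have := (hE'p a ha).2.2
        rw [h] at hlt
        exact absurd hlt (by simpa using this)
    have hp : Precedes (F ++ δ ++ ρ) b.txn a.txn := by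
      refine ⟨hFE _ hbF, (h.subset (mem_txns_of_mem ha)).1, hcompl _ hbF,
        F.filter (fun e => e.txn.idx < a.txn.idx),
        F.filter (fun e => a.txn.idx ≤ e.txn.idx) ++ (δ ++ ρ), ?_, ?_, ?_⟩
      · rw [← List.append_assoc, ← sorted_eq_filter_append hF.sorted, List.append_assoc]
      · rintro ⟨e, he, hea⟩
        rw [List.mem_filter, hea] at he
        simp at he
      · rw [txns_append]
        rintro (⟨e, he, hea⟩ | h')
        · rw [List.mem_filter, hea] at he
          simp only [decide_eq_true_eq] at he
          omega
        · exact hnot _ hbF h'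
    obtain ⟨-, -, -, E₁, E₂, rfl, h1, h2⟩ :=
      h.precedes _ (mem_txns_of_mem hb) _ (mem_txns_of_mem ha) hp
    obtain ⟨l₁, l₂, hl, hl₁, hl₂⟩ := List.sublist_append_iff.1 hab
    rcases l₁ with _ | ⟨c, l₁⟩
    · rw [List.nil_append] at hl
      subst hl
      exact h2 ⟨b, hl₂.subset (by simp), rfl⟩
    · simp only [List.cons_append, List.cons.injEq] at hl
      exact h1 ⟨a, hl₁.subset (by simp [hl.1]), rfl⟩
  -- With process and path fixed, a transaction is determined by its index, so level lists are
  -- projections.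
  have hfilter : ∀ (L : List (Event n X V B W R)),
      (∀ e ∈ L, e.txn.proc = p ∧ e.txn.path = .slow) → ∀ k,
      L.filter (fun e => e.txn.idx = k) = proj L ⟨p, .slow, k⟩ := by
    intro L hL k
    refine List.filter_congr fun e he => ?_
    rw [decide_eq_decide]
    obtain ⟨h1, h2⟩ := hL e he
    have h3 : e.txn = ⟨e.txn.proc, e.txn.path, e.txn.idx⟩ := rfl
    rw [h1, h2] at h3
    rw [h3]
    simp
  have heq : E'.filter (fun e => e.txn.idx < N) = F := by
    have h1 : F.filter (fun e => e.txn.idx < N) = F := by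
      rw [List.filter_eq_self]
      intro e he
      simpa using hF.lt e he
    conv_rhs => rw [← h1]
    refine filter_lt_eq_of_sorted hsorted hF.sorted fun k hk => ?_
    rw [hfilter E' (fun e he => ⟨(hE'p e he).1, (hE'p e he).2.1⟩) k, hfilter F hF.slow k]
    by_cases hk' : (⟨p, .slow, k⟩ : Txn n) ∈ txns F
    · exact (hproj _ hk').2.symm
    · rw [proj_eq_nil hk', proj_eq_nil]
      intro h'
      rcases hE'sub _ h' with h' | h'
      · exact hk' h'
      · simp only [Txn.mk.injEq, true_and] at h'
        omega
  have hE' := sorted_eq_filter_append hsorted N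
  rw [heq] at hE'
  have hS : ∀ e ∈ E'.filter (fun e => N ≤ e.txn.idx), e.txn = ⟨p, .slow, N⟩ := by
    intro e he
    rw [List.mem_filter] at he
    obtain ⟨h1, h2⟩ := he
    rcases hE'sub _ (mem_txns_of_mem h1) with h | h
    · have := (hFsub _ h).2.2
      simp only [decide_eq_true_eq] at h2
      omega
    · exact h
  refine ⟨_, hE', hS, ?_⟩
  have hSρ : (⟨p, .slow, N⟩ : Txn n) ∉ txns ρ := fun h => hT (by rw [← hρ' _ h])
  by_cases hSE : (⟨p, .slow, N⟩ : Txn n) ∈ txns E'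
  · have hsub : Dset E' ⟨p, .slow, N⟩ ⊆ Dset (F ++ δ ++ ρ) ⟨p, .slow, N⟩ :=
      Set.union_subset_union (h.sets _ hSE).1 (h.sets _ hSE).2
    rw [Dset_append, Dset_append, Dset_eq_empty hSρ, Dset_eq_empty hF.notMem] at hsub
    rw [hE', Dset_append, Dset_eq_empty hF.notMem] at hsub
    simpa using hsub
  · rw [hE', txns_append] at hSE
    rw [Dset_eq_empty fun h => hSE (.inr h)]
    exact Set.empty_subset _

end SlowPrefix

end Implementation

end Witness

end HybridTM

namespace HybridTM

/-! ### A t-read next to a possibly unfinished writer appears t-sequential to the reader. -/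

section Reads

open Classical

universe u₁ u₂ u₃ u₄ u₅ u₆

variable {n : ℕ} {X : Type u₁} {V : Type u₂} {B : Type u₃} {W : Type u₄} {R : Type u₅}
  {Q : Type u₆}

theorem Accesses.append_inv {E E' : List (Event n X V B W R)} {T : Txn n} {b : B}
    (h : Accesses (E ++ E') T b) : Accesses E T b ∨ Accesses E' T b := by
  obtain ⟨p, o, h⟩ := h
  exact (List.mem_append.1 h).imp (fun h => ⟨p, o, h⟩) fun h => ⟨p, o, h⟩

namespace Implementation

variable {M : Implementation n X V B W R Q}

/-- The tracked objects are the accessed ones, whatever their values, so the capacity check has the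
same outcome for both memories. -/
theorem FastReads.size_eq {mem mem' : B → W} {T : Txn n} {α : List (Event n X V B W R)}
    {s s' : ProcState n X V B W Q} (h : M.FastReads mem T α s) (h' : M.FastReads mem' T α s') :
    s.track.size = s'.track.size := by
  have : {b | s.track b ≠ none} = {b | s'.track b ≠ none} := by
    ext b
    exact (h.track_ne_none_iff b).trans (h'.track_ne_none_iff b).symm
  simp only [TrackingSet.size, this]

/-- A run of primitives is a prefix of the run that continues to the response. -/
theorem FastReads.prefix_of_respond {mem : B → W} {T : Txn n} {σ β β' : List (Event n X V B W R)}
    {t t' : ProcState n X V B W Q} {r : TResp V} (h : M.FastReads mem T (σ ++ β) t)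
    (hr : M.next T t.loc = .respond r) (hβ : ∀ e ∈ β, ∃ b p o, e = .prim T b p o)
    (h' : M.FastReads mem T (σ ++ β') t') (hβ' : ∀ e ∈ β', ∃ b p o, e = .prim T b p o) :
    β' <+: β := by
  induction β' using List.reverseRecOn generalizing t' with
  | nil => exact List.nil_prefix
  | append_singleton β' e ih =>
    rw [← List.append_assoc] at h'
    obtain ⟨t₁, ht₁, hstep⟩ := h'.snoc_inv
    obtain ⟨β₂, rfl⟩ := ih ht₁ fun e he => hβ' e (by simp [he])
    obtain ⟨b, p, o, rfl⟩ := hβ' e (by simp)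
    cases hstep with
    | access x _ _ hphase hnext hsize =>
      -- The process is deterministic: at the end of `β` it responds and cannot access memory, and
      -- before that its next access is forced.
      rcases β₂ with _ | ⟨e', β₃⟩
      · rw [List.append_nil] at h
        obtain rfl := h.unique ht₁
        rw [hr] at hnext
        cases hnext
      · have h₂ : M.FastReads mem T (σ ++ β' ++ [e'] ++ β₃) t := by simpa using h
        obtain ⟨t₂, ht₂⟩ := h₂.prefix
        obtain ⟨t₃, ht₃, hstep'⟩ := ht₂.snoc_inv
        obtain rfl := ht₃.unique ht₁
        obtain ⟨b', p', o', rfl⟩ := hβ e' (by simp)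
        cases hstep' with
        | access x' _ _ hphase' hnext' hsize' =>
          rw [hnext] at hnext'
          cases hnext'
          exact ⟨β₃, by simp⟩

namespace SlowPrefix

variable {p : Fin n} {N : ℕ} {F : List (Event n X V B W R)}

theorem freshFast (hF : M.SlowPrefix p N F) {δ : List (Event n X V B W R)}
    {D : Config n X V B W Q} (hδ : ∀ e ∈ δ, e.txn = ⟨p, .slow, N⟩) (hD : M.Run (F ++ δ) D)
    {T : Txn n} (hT : T.path = .fast) (hTp : T.proc ≠ p) : M.FreshFast (F ++ δ) D T := by
  refine hD.freshFast hT fun e he => ?_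
  rcases List.mem_append.1 he with h | h
  · rw [(hF.slow e h).1]; exact hTp.symm
  · rw [hδ e h]; exact hTp.symm

theorem track_eq (hF : M.SlowPrefix p N F) {δ : List (Event n X V B W R)}
    {D : Config n X V B W Q} (hδ : ∀ e ∈ δ, e.txn = ⟨p, .slow, N⟩) (hD : M.Run (F ++ δ) D)
    (j : Fin n) : D.track j = fun _ => none := by
  refine hD.track_of_slow fun e he _ => ?_
  rcases List.mem_append.1 he with h | h
  · exact (hF.slow e h).2
  · rw [hδ e h]

end SlowPrefix

variable (M) in
/-- `F ++ δ` is a t-complete execution that leads to the configuration `D`, where `δ` consists of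
events of the slow-path transaction `⟨p, slow, N⟩` with data set contained in `Y`. -/
structure Extends (p : Fin n) (N : ℕ) (F : List (Event n X V B W R)) (Y : Set X)
    (δ : List (Event n X V B W R)) (D : Config n X V B W Q) : Prop where
  run : M.Run (F ++ δ) D
  txn : ∀ e ∈ δ, e.txn = ⟨p, .slow, N⟩
  complete : AllTComplete (F ++ δ)
  dset : Dset δ ⟨p, .slow, N⟩ ⊆ Y

variable (M) in
/-- Some t-complete extension of `F` by a slow-path transaction with data set `Y` allows `T` to
continue its run `α` with a t-read of `x` in which it accesses a further metadata object. -/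
def AccessesNewMetadata (P : B → Option X) (p : Fin n) (N : ℕ) (F : List (Event n X V B W R))
    (Y : Set X) (T : Txn n) (α : List (Event n X V B W R)) (x : X) : Prop :=
  ∃ δ D, M.Extends p N F Y δ D ∧ ∃ ρ t, M.FastReads D.mem T ρ t ∧ t.phase = .ready T ∧
    Dset ρ T = insert x (Dset α T) ∧ (∀ b, Accesses α T b → Accesses ρ T b) ∧
    ∃ b, P b = none ∧ ¬ Accesses α T b ∧ Accesses ρ T b

/-- A solo t-read after a t-complete execution returns a value. -/
theorem FastReads.exists_read {m : ℕ} (hP : M.Progressive) (hL : M.ObstructionFreeLiveness)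
    (hcap : M.NoCapacityAborts m) {E α : List (Event n X V B W R)} {C : Config n X V B W Q}
    {T : Txn n} {s : ProcState n X V B W Q} (hE : M.FreshFast E C T) (hEc : AllTComplete E)
    (htrack : ∀ j ≠ T.proc, C.track j = fun _ => none)
    (hα : M.FastReads C.mem T α s) (hs : s.phase = .ready T ∨ α = []) {x : X}
    (hx : x ∉ Dset α T) (hm : (insert x (Dset α T)).ncard ≤ m) :
    ∃ β r v t, M.FastReads C.mem T (α ++ [.inv T (.read x)] ++ β) r ∧
      M.next T r.loc = .respond (.value v) ∧
      M.FastReads C.mem T (α ++ [.inv T (.read x)] ++ β ++ [.resp T (.value v)]) t ∧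
      t.phase = .ready T ∧ (∀ e ∈ β, ∃ b p o, e = .prim T b p o) ∧
      Dset (α ++ [.inv T (.read x)] ++ β ++ [.resp T (.value v)]) T = insert x (Dset α T) := by
  obtain ⟨β, r, t, ht, hph, hnext, hmatch, hβ⟩ :=
    FastReads.exists_read_pending hL hcap hE htrack hα hs hx hm
  obtain ⟨v, rfl⟩ := FastReads.response_eq_value hP hE hEc htrack ht hph hnext hmatch
  refine ⟨β, t, v, _, ht, hnext, .snoc _ _ _ _ ht (.respond t x v hph hnext), rfl, hβ, ?_⟩
  rw [Dset_append, ht.Dset_read hβ]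
  simp [Dset, Rset, Wset]

/-- The conditions under which a fast-path transaction `T` that has run `α` after `F` goes on to
read `x` while the slow-path transaction `⟨p, slow, N⟩` has performed the events `δ`. -/
structure ReadContext (M : Implementation n X V B W R Q) (P : B → Option X) (m : ℕ) (p : Fin n)
    (N : ℕ) (F : List (Event n X V B W R)) (C : Config n X V B W Q) (Y : Set X) (T : Txn n)
    (α : List (Event n X V B W R)) (s : ProcState n X V B W Q) (x : X) : Prop where
  partition : M.IsDataPartition P
  progressive : M.Progressive
  live : M.ObstructionFreeLiveness
  capacity : M.NoCapacityAborts m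
  slow : M.SlowPrefix p N F
  run : M.Run F C
  path : T.path = .fast
  proc : T.proc ≠ p
  reads : M.FastReads C.mem T α s
  phase : s.phase = .ready T ∨ α = []
  fresh : x ∉ Dset α T
  card : (insert x (Dset α T)).ncard ≤ m
  disjoint : Disjoint Y (Dset α T)

namespace ReadContext

variable {P : B → Option X} {m : ℕ} {p : Fin n} {N : ℕ} {F : List (Event n X V B W R)}
  {C : Config n X V B W Q} {Y : Set X} {T : Txn n} {α : List (Event n X V B W R)}
  {s : ProcState n X V B W Q} {x : X}

/-- The writer need not be complete after `δ`, so this covers every prefix of its run. -/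
theorem mem_eq (h : M.ReadContext P m p N F C Y T α s x) {δ : List (Event n X V B W R)}
    {D : Config n X V B W Q} (hδ : ∀ e ∈ δ, e.txn = ⟨p, .slow, N⟩) (hD : M.Run (F ++ δ) D)
    (hY : Dset δ ⟨p, .slow, N⟩ ⊆ Y) : ∀ b, Accesses α T b → D.mem b = C.mem b := by
  have hF : M.Run (F ++ []) C := by simpa using h.run
  have hfresh := h.slow.freshFast (δ := []) (by simp) hF h.path h.proc
  rw [List.append_nil] at hfresh
  exact h.progressive.mem_eq hfresh h.slow.complete (h.slow.track_eq (δ := []) (by simp) hF)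
    h.reads h.phase hD hδ rfl h.proc.symm h.slow.notMem (h.disjoint.mono_left hY)

theorem reads_after (h : M.ReadContext P m p N F C Y T α s x) {δ : List (Event n X V B W R)}
    {D : Config n X V B W Q} (hδ : ∀ e ∈ δ, e.txn = ⟨p, .slow, N⟩) (hD : M.Run (F ++ δ) D)
    (hY : Dset δ ⟨p, .slow, N⟩ ⊆ Y) : M.FastReads D.mem T α s :=
  h.reads.congr_mem (h.mem_eq hδ hD hY)

theorem invoke_after (h : M.ReadContext P m p N F C Y T α s x) {δ : List (Event n X V B W R)}
    {D : Config n X V B W Q} (hδ : ∀ e ∈ δ, e.txn = ⟨p, .slow, N⟩) (hD : M.Run (F ++ δ) D)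
    (hY : Dset δ ⟨p, .slow, N⟩ ⊆ Y) : ∃ t, M.FastReads D.mem T (α ++ [.inv T (.read x)]) t := by
  have hα := h.reads_after hδ hD hY
  refine ⟨_, .snoc _ s _ _ hα (.invoke s x ?_ fun h' => h.fresh (.inl h'))⟩
  rcases h.phase with h' | rfl
  · exact .inr h'
  · left
    rw [hα.nil_inv]
    simp

theorem run_after (h : M.ReadContext P m p N F C Y T α s x) {δ ρ : List (Event n X V B W R)}
    {D : Config n X V B W Q} {t : ProcState n X V B W Q}
    (hδ : ∀ e ∈ δ, e.txn = ⟨p, .slow, N⟩) (hD : M.Run (F ++ δ) D)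
    (hρ : M.FastReads D.mem T ρ t) : M.Run (F ++ δ ++ ρ) (D.put T.proc t) :=
  FastReads.run (h.slow.freshFast hδ hD h.path h.proc) hρ fun b p o _ j _ => by
    simp [Clashes, h.slow.track_eq hδ hD]

/-- If `T` gets to a new metadata object when it runs solo after a t-complete extension, it can
complete its t-read. -/
theorem accessesNewMetadata (h : M.ReadContext P m p N F C Y T α s x)
    {δ β : List (Event n X V B W R)} {D : Config n X V B W Q} (hD : M.Extends p N F Y δ D)
    {t : ProcState n X V B W Q} (ht : M.FastReads D.mem T (α ++ [.inv T (.read x)] ++ β) t)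
    (hβ : ∀ e ∈ β, ∃ b p o, e = .prim T b p o) {b : B} (hb : P b = none)
    (hbα : ¬ Accesses α T b) (hbβ : Accesses β T b) :
    M.AccessesNewMetadata P p N F Y T α x := by
  obtain ⟨β', r, v, t', hr, hnext, ht', hph, hβ', hDs⟩ := FastReads.exists_read h.progressive
    h.live h.capacity (h.slow.freshFast hD.txn hD.run h.path h.proc) hD.complete
    (fun j _ => h.slow.track_eq hD.txn hD.run j) (h.reads_after hD.txn hD.run hD.dset) h.phase
    h.fresh h.card
  -- By determinism the complete t-read continues the partial one and keeps its new access.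
  obtain ⟨β₂, rfl⟩ := hr.prefix_of_respond hnext hβ' ht hβ
  exact ⟨δ, D, hD, _, t', ht', hph, hDs,
    fun b hb => hb.append_left.append_left.append_left, b, hb, hbα,
    (hbβ.append_left.append_right).append_left⟩

/-- Base case of the induction in `appearsTSequential`. The run `α` accesses nothing that the writer
has changed, so the writer can be kept if it is complete and dropped if it is not. -/
theorem appearsTSequential_invoke (h : M.ReadContext P m p N F C Y T α s x)
    {δ : List (Event n X V B W R)} {D : Config n X V B W Q}
    (hδ : ∀ e ∈ δ, e.txn = ⟨p, .slow, N⟩) (hD : M.Run (F ++ δ) D)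
    (hY : Dset δ ⟨p, .slow, N⟩ ⊆ Y) :
    M.AppearsTSequential (F ++ δ ++ (α ++ [.inv T (.read x)])) T := by
  set ρ : List (Event n X V B W R) := α ++ [.inv T (.read x)] with hρdef
  have hρ : ∀ e ∈ ρ, e.txn = T := by
    obtain ⟨t, ht⟩ := h.invoke_after hδ hD hY
    exact ht.txn_eq
  have hTρ : T ∈ txns ρ := ⟨.inv T (.read x), by simp [hρdef], rfl⟩
  have hTF := h.slow.notMem_of_proc_ne h.proc
  have hTS : T ≠ ⟨p, .slow, N⟩ := fun h' => h.proc (by rw [h'])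
  have hTδ : T ∉ txns δ := fun h' => hTS (txns_subset hδ _ h')
  have hproj : proj (F ++ δ ++ ρ) T = ρ := by
    rw [proj_append, proj_append, proj_eq_nil hTF, proj_eq_nil hTδ, proj_eq_self hρ]
    rfl
  rw [appearsTSequential_iff, hproj]
  refine ⟨by rw [txns_append]; exact .inr hTρ, ?_⟩
  by_cases hc : AllTComplete (F ++ δ)
  · obtain ⟨t, ht⟩ := h.invoke_after hδ hD hY
    refine ⟨F ++ δ, .of_prefix ⟨_, hD⟩ hc ?_ ?_ ?_, ⟨_, h.run_after hδ hD ht⟩⟩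
    · rw [txns_append]
      exact fun h' => h'.elim hTF hTδ
    · intro T' hT' h'
      rw [txns_subset hρ _ h', txns_append] at hT'
      exact hT'.elim hTF hTδ
    · intro T' hp
      have hT' := hp.1
      rw [txns_append] at hT'
      refine hT'.resolve_right fun h' => ?_
      rw [txns_subset hρ _ h'] at hp
      exact not_precedes_self _ _ hp
  · have hF : M.Run (F ++ []) C := by simpa using h.run
    obtain ⟨t, ht⟩ := h.invoke_after (δ := []) (by simp) hF (by simp [Dset, Rset, Wset])
    have := h.run_after (δ := []) (by simp) hF ht
    rw [List.append_nil] at this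
    -- The witness leaves out the writer. This is allowed because the incomplete writer does not
    -- precede `T`.
    refine ⟨F, ?_, ⟨_, this⟩⟩
    rw [List.append_assoc]
    refine .of_prefix h.slow.exec h.slow.complete hTF ?_ ?_
    · intro T' hT' h'
      rw [txns_append] at h'
      rcases h' with h' | h'
      · rw [txns_subset hδ _ h'] at hT'
        exact h.slow.notMem hT'
      · rw [txns_subset hρ _ h'] at hT'
        exact hTF hT'
    · intro T' hp
      have hT' := hp.1
      rw [← List.append_assoc, txns_append, txns_append] at hT'
      rcases hT' with (hT' | hT') | hT'
      · exact hT'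
      · exfalso
        rw [txns_subset hδ _ hT', ← List.append_assoc] at hp
        have hS : TComplete (F ++ δ) ⟨p, .slow, N⟩ :=
          (tComplete_append_iff fun h' => hTS (txns_subset hρ _ h').symm).1 hp.2.2.1
        refine hc fun T₁ hT₁ => ?_
        rw [txns_append] at hT₁
        by_cases h₁ : T₁ ∈ txns δ
        · rw [txns_subset hδ _ h₁]
          exact hS
        · exact (tComplete_append_iff h₁).2 (h.slow.complete T₁ (hT₁.resolve_right h₁))
      · rw [txns_subset hρ _ hT'] at hp
        exact absurd hp (not_precedes_self _ _)

/-- As long as `T` accesses no new metadata objects, the execution appears t-sequential to it. -/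
theorem appearsTSequential (h : M.ReadContext P m p N F C Y T α s x)
    {δ : List (Event n X V B W R)} {D : Config n X V B W Q}
    (hδ : ∀ e ∈ δ, e.txn = ⟨p, .slow, N⟩) (hD : M.Run (F ++ δ) D)
    (hY : Dset δ ⟨p, .slow, N⟩ ⊆ Y) (hnew : ¬ M.AccessesNewMetadata P p N F Y T α x)
    {β : List (Event n X V B W R)} {t : ProcState n X V B W Q}
    (ht : M.FastReads D.mem T (α ++ [.inv T (.read x)] ++ β) t)
    (hβ : ∀ e ∈ β, ∃ b p o, e = .prim T b p o) :
    M.AppearsTSequential (F ++ δ ++ (α ++ [.inv T (.read x)] ++ β)) T ∧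
      (∀ b, P b = none → Accesses β T b → Accesses α T b) ∧
      ∃ δ' D', M.Extends p N F Y δ' D' ∧
        ∃ t', M.FastReads D'.mem T (α ++ [.inv T (.read x)] ++ β) t' := by
  -- Any witness is a t-complete extension of `F` by the writer, after which `T` performs the very
  -- same events.
  have hwit : ∀ {β : List (Event n X V B W R)} {t : ProcState n X V B W Q},
      M.FastReads D.mem T (α ++ [.inv T (.read x)] ++ β) t →
      M.AppearsTSequential (F ++ δ ++ (α ++ [.inv T (.read x)] ++ β)) T →
      ∃ δ' D', M.Extends p N F Y δ' D' ∧
        M.IsWitness (F ++ δ ++ (α ++ [.inv T (.read x)] ++ β)) T (F ++ δ') ∧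
        ∃ t', M.FastReads D'.mem T (α ++ [.inv T (.read x)] ++ β) t' := by
    intro β t ht happ
    obtain ⟨hT, E', hE', hex⟩ := appearsTSequential_iff.1 happ
    have hρ := ht.txn_eq
    have hTF := h.slow.notMem_of_proc_ne h.proc
    have hTS : T ≠ ⟨p, .slow, N⟩ := fun h' => h.proc (by rw [h'])
    have hTδ : T ∉ txns δ := fun h' => hTS (txns_subset hδ _ h')
    rw [proj_append, proj_append, proj_eq_nil hTF, proj_eq_nil hTδ, proj_eq_self hρ] at hex
    obtain ⟨δ', rfl, hδ', hDs⟩ := h.slow.exists_eq_append hδ hρ h.proc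
      ⟨.inv T (.read x), by simp, rfl⟩ hE'
    obtain ⟨D', hD'⟩ := hE'.exec
    obtain ⟨D₂, hD₂⟩ := hex
    obtain ⟨t', ht', -⟩ := hD₂.fastReads (h.slow.freshFast hδ' hD' h.path h.proc) ht.shape
    exact ⟨δ', D', ⟨hD', hδ', hE'.complete, hDs.trans hY⟩, hE', t', ht'⟩
  suffices hmain : M.AppearsTSequential (F ++ δ ++ (α ++ [.inv T (.read x)] ++ β)) T ∧
      (∀ b, P b = none → Accesses β T b → Accesses α T b) by
    obtain ⟨δ', D', h1, -, h2⟩ := hwit ht hmain.1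
    exact ⟨hmain.1, hmain.2, δ', D', h1, h2⟩
  induction β using List.reverseRecOn generalizing t with
  | nil =>
    refine ⟨?_, fun b _ hb => ?_⟩
    · rw [List.append_nil]
      exact h.appearsTSequential_invoke hδ hD hY
    · simp [Accesses] at hb
  | append_singleton β e ih =>
    rw [show F ++ δ ++ (α ++ [.inv T (.read x)] ++ (β ++ [e])) =
      F ++ δ ++ (α ++ [.inv T (.read x)] ++ β) ++ [e] by simp]
    rw [← List.append_assoc] at ht
    obtain ⟨t₁, ht₁, hstep⟩ := ht.snoc_inv
    have hβ₁ : ∀ e ∈ β, ∃ b p o, e = .prim T b p o := fun e he => hβ e (by simp [he])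
    obtain ⟨happ, hmeta⟩ := ih ht₁ hβ₁
    obtain ⟨δ', D', hext, hw, t', ht'⟩ := hwit ht₁ happ
    obtain ⟨b, q, o, rfl⟩ := hβ e (by simp)
    obtain ⟨hv1, hv2, hv3⟩ := ht₁.view ht'
    have hrun := h.run_after hδ hD ht
    rw [← List.append_assoc] at hrun
    have hTE : T ∈ txns (F ++ δ ++ (α ++ [.inv T (.read x)] ++ β)) :=
      ⟨.inv T (.read x), by simp, rfl⟩
    cases hstep with
    | access x' _ _ hphase hnext hsize =>
      -- In the witness `T` is in the same local state, so it makes the same access, possibly with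
      -- another response.
      have hstep' : M.ReadStep D'.mem T (α ++ [.inv T (.read x)] ++ β) t' _ _ :=
        .access t' x' b q (hv2 ▸ hphase) (hv1 ▸ hnext) (ht₁.size_eq ht' ▸ hsize)
      have ht'' := FastReads.snoc _ _ _ _ ht' hstep'
      by_cases hPb : P b = none
      · by_cases hbα : Accesses α T b
        -- An old metadata object has its value from `F` in both executions; the response is the
        -- same and the witness can be kept.
        · have hmem : D.mem b = D'.mem b := by
            rw [h.mem_eq hδ hD hY b hbα, h.mem_eq hext.txn hext.run hext.dset b hbα]
          have hval : t'.value D'.mem b = t₁.value D.mem b := by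
            simp only [ProcState.value, hv3 b hmem, hmem]
          rw [hval] at ht''
          refine ⟨appearsTSequential_iff.2 ⟨?_, _, hw.snoc hTE rfl, ?_⟩, ?_⟩
          · rw [txns_append]
            exact .inl hTE
          · have hTF := h.slow.notMem_of_proc_ne h.proc
            have hTS : T ≠ ⟨p, .slow, N⟩ := fun h' => h.proc (by rw [h'])
            have hTδ : T ∉ txns δ := fun h' => hTS (txns_subset hδ _ h')
            rw [List.append_assoc (F ++ δ), proj_append, proj_append, proj_eq_nil hTF,
              proj_eq_nil hTδ, proj_eq_self ht.txn_eq]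
            exact ⟨_, h.run_after hext.txn hext.run ht''⟩
          · intro b' hb' hacc
            rcases hacc.append_inv with hacc | ⟨_, _, hacc⟩
            · exact hmeta b' hb' hacc
            · simp only [List.mem_singleton, Event.prim.injEq] at hacc
              rw [hacc.2.1]
              exact hbα
        -- A new metadata object would be accessed after a t-complete extension as well, which
        -- `hnew` excludes.
        · rw [List.append_assoc] at ht''
          refine absurd (h.accessesNewMetadata hext ht'' ?_ hPb hbα
            ⟨q, _, List.mem_append_right _ (List.mem_singleton.2 rfl)⟩) hnew
          intro e he
          rcases List.mem_append.1 he with he | he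
          · exact hβ₁ e he
          · exact ⟨_, _, _, List.mem_singleton.1 he⟩
      -- For data objects the step is the assumption on the partition; it may call for a different
      -- witness.
      · refine ⟨h.partition.data_access _ T b q _ h.path happ hPb ⟨_, hrun⟩, ?_⟩
        intro b' hb' hacc
        rcases hacc.append_inv with hacc | ⟨_, _, hacc⟩
        · exact hmeta b' hb' hacc
        · simp only [List.mem_singleton, Event.prim.injEq] at hacc
          rw [hacc.2.1] at hb'
          exact absurd hb' hPb

/-- Either `T` accesses a new metadata object in a t-read of `x` after some t-complete
extension, or its t-read after `F ++ δ` returns a value without accesses to new metadata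
objects. -/
theorem exists_read (h : M.ReadContext P m p N F C Y T α s x)
    (hnew : ¬ M.AccessesNewMetadata P p N F Y T α x)
    {δ : List (Event n X V B W R)} {D : Config n X V B W Q}
    (hδ : ∀ e ∈ δ, e.txn = ⟨p, .slow, N⟩) (hD : M.Run (F ++ δ) D)
    (hY : Dset δ ⟨p, .slow, N⟩ ⊆ Y) :
    ∃ β v t, M.FastReads D.mem T (α ++ [.inv T (.read x)] ++ β ++ [.resp T (.value v)]) t ∧
      t.phase = .ready T ∧ (∀ e ∈ β, ∃ b p o, e = .prim T b p o) ∧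
      Dset (α ++ [.inv T (.read x)] ++ β ++ [.resp T (.value v)]) T = insert x (Dset α T) ∧
      (∀ b, P b = none → Accesses (α ++ [.inv T (.read x)] ++ β ++ [.resp T (.value v)]) T b →
        Accesses α T b) ∧
      ∃ δ' D', M.Extends p N F Y δ' D' ∧ ∃ t',
        M.FastReads D'.mem T (α ++ [.inv T (.read x)] ++ β ++ [.resp T (.value v)]) t' := by
  obtain ⟨β, r, t, ht, hph, hnext, hmatch, hβ⟩ := FastReads.exists_read_pending h.live h.capacity
    (h.slow.freshFast hδ hD h.path h.proc) (fun j _ => h.slow.track_eq hδ hD j)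
    (h.reads_after hδ hD hY) h.phase h.fresh h.card
  obtain ⟨-, hmeta, δ', D', hext, t', ht'⟩ := h.appearsTSequential hδ hD hY hnew ht hβ
  obtain ⟨hv1, hv2, -⟩ := ht.view ht'
  -- The pending writer might excuse an abort of `T` after `F ++ δ`. In the t-complete witness `T`
  -- has the same view and no excuse, so the response is a value.
  obtain ⟨v, rfl⟩ := FastReads.response_eq_value h.progressive
    (h.slow.freshFast hext.txn hext.run h.path h.proc) hext.complete
    (fun j _ => h.slow.track_eq hext.txn hext.run j) ht' (hv2 ▸ hph) (hv1 ▸ hnext) hmatch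
  refine ⟨β, v, _, .snoc _ _ _ _ ht (.respond t x v hph hnext), rfl, hβ, ?_, ?_, δ', D', hext, _,
    .snoc _ _ _ _ ht' (.respond t' x v (hv2 ▸ hph) (hv1 ▸ hnext))⟩
  · rw [Dset_append, ht.Dset_read hβ]
    simp [Dset, Rset, Wset]
  · intro b hb hacc
    rcases hacc.append_inv with hacc | ⟨_, _, hacc⟩
    · rcases hacc.append_inv with hacc | hacc
      · rcases hacc.append_inv with hacc | ⟨_, _, hacc⟩
        · exact hacc
        · simp at hacc
      · exact hmeta b hb hacc
    · simp at hacc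

end ReadContext

end Implementation

end Reads

end HybridTM

namespace HybridTM

/-! ### Quiet reads: what changes their values, and why two readers agree on having seen the writer.
-/

section Flip

open Classical

universe u₁ u₂ u₃ u₄ u₅ u₆

variable {n : ℕ} {X : Type u₁} {V : Type u₂} {B : Type u₃} {W : Type u₄} {R : Type u₅}
  {Q : Type u₆}

/-- The transaction that a process is running. -/
def Phase.txn : Phase n X V → Option (Txn n)
  | .idle => none
  | .ready T => some T
  | .busy T _ => some T
  | .doomed T => some T
  | .flushed T => some T

namespace Implementation

variable {M : Implementation n X V B W R Q}

theorem Step.phase_of_ne {E : List (Event n X V B W R)} {C C' : Config n X V B W Q}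
    {e : Event n X V B W R} (h : M.Step E C e C') {i : Fin n} (hi : i ≠ e.txn.proc) :
    C'.phase i = C.phase i := by
  cases h <;> simp_all [Event.txn, Config.setLoc, Config.setPhase, Config.clear, Config.flush,
    bottom, Config.invalidate, Config.trackAccess]

theorem Step.phase_txn {E : List (Event n X V B W R)} {C C' : Config n X V B W Q}
    {e : Event n X V B W R} (h : M.Step E C e C') {T : Txn n}
    (hT : (C'.phase e.txn.proc).txn = some T) :
    T = e.txn ∧ ∀ r : TResp V, r.Final → e ≠ .resp T r := by
  cases h <;> simp_all [Event.txn, Config.setLoc, Config.setPhase, Config.clear, Config.flush,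
    bottom, Config.invalidate, Config.trackAccess, Phase.txn]
  grind

theorem Run.phase_txn {E : List (Event n X V B W R)} {C : Config n X V B W Q} (h : M.Run E C)
    {i : Fin n} {T : Txn n} (hT : (C.phase i).txn = some T) :
    T.proc = i ∧ ∃ e, (proj E T).getLast? = some e ∧ ∀ r : TResp V, r.Final → e ≠ .resp T r := by
  induction h generalizing i T with
  | nil => simp [initConfig, Phase.txn] at hT
  | snoc E C e C' hrun hstep ih =>
    by_cases hi : i = e.txn.proc
    · subst hi
      obtain ⟨rfl, h⟩ := hstep.phase_txn hT
      refine ⟨rfl, e, ?_, h⟩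
      simp [proj]
    · rw [hstep.phase_of_ne hi] at hT
      obtain ⟨rfl, h⟩ := ih hT
      refine ⟨rfl, ?_⟩
      rw [proj_append, proj_eq_nil (E := [e]), List.append_nil]
      · exact h
      · rintro ⟨e', he', h'⟩
        rw [List.mem_singleton.1 he'] at h'
        exact hi (by rw [h'])

/-- After a t-complete execution, no transaction is running. -/
theorem Run.phase_idle {E : List (Event n X V B W R)} {C : Config n X V B W Q} (h : M.Run E C)
    (hE : AllTComplete E) (i : Fin n) : C.phase i = .idle := by
  suffices hT : (C.phase i).txn = none by
    generalize C.phase i = φ at hT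
    cases φ <;> simp_all [Phase.txn]
  by_contra hne
  obtain ⟨T, hT⟩ := Option.ne_none_iff_exists'.1 hne
  obtain ⟨-, e, he, hr⟩ := h.phase_txn hT
  have hmem := mem_proj.1 (List.mem_of_getLast? he)
  rcases hE T ⟨e, hmem⟩ with hc | hc
  · rw [Committed, he, Option.some.injEq] at hc
    exact hr .commit (.inl rfl) hc
  · rw [Aborted, he, Option.some.injEq] at hc
    exact hr .abort (.inr rfl) hc

/-- A slow-path transaction changes at most one base object in a step. -/
theorem Step.mem_change_unique {E : List (Event n X V B W R)} {C C' : Config n X V B W Q}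
    {e : Event n X V B W R} (h : M.Step E C e C') (he : e.txn.path = .slow) {b b' : B}
    (hb : C'.mem b ≠ C.mem b) (hb' : C'.mem b' ≠ C.mem b') : b = b' := by
  cases h <;> simp_all [Event.txn, Config.setLoc, Config.setPhase, Config.clear,
    Function.update_apply]

theorem FastReads.read_unique {mem : B → W} {T : Txn n} {σ β β' : List (Event n X V B W R)}
    {t t' : ProcState n X V B W Q} {v v' : V}
    (h : M.FastReads mem T (σ ++ β ++ [.resp T (.value v)]) t)
    (hβ : ∀ e ∈ β, ∃ b p o, e = .prim T b p o)
    (h' : M.FastReads mem T (σ ++ β' ++ [.resp T (.value v')]) t')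
    (hβ' : ∀ e ∈ β', ∃ b p o, e = .prim T b p o) : v = v' := by
  obtain ⟨s, hs, hstep⟩ := h.snoc_inv
  obtain ⟨s', hs', hstep'⟩ := h'.snoc_inv
  cases hstep with
  | respond x _ hphase hnext =>
    cases hstep' with
    | respond x' _ hphase' hnext' =>
      have h1 := hs.prefix_of_respond hnext hβ hs' hβ'
      have h2 := hs'.prefix_of_respond hnext' hβ' hs hβ
      obtain rfl := h1.eq_of_length_le h2.length_le
      obtain rfl := hs.unique hs'
      rw [hnext] at hnext'
      cases hnext'
      rfl

/-- After a run of t-reads, a transaction that runs alone can commit. -/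
theorem FastReads.run_commit {E : List (Event n X V B W R)} {C : Config n X V B W Q} {T : Txn n}
    (hE : M.FreshFast E C T) {ρ : List (Event n X V B W R)} {t : ProcState n X V B W Q}
    (hρ : M.FastReads C.mem T ρ t) (ht : t.phase = .ready T)
    (htrack : ∀ j, C.track j = fun _ => none) :
    ∃ C', M.Run (E ++ ρ ++ [.inv T .tryC, .cacheCommit T true, .resp T .commit]) C' ∧
      (∀ j, C'.track j = fun _ => none) ∧
      ∀ b, (∀ w, t.track b ≠ some (w, .exclusive)) → C'.mem b = C.mem b := by
  have hrun := FastReads.run hE hρ fun b p o _ j _ => by simp [Clashes, htrack]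
  have h1 := Run.snoc _ _ _ _ hrun (.invoke _ T .tryC (.inr (by simpa using ht)) (by simp))
  have h2 := Run.snoc _ _ _ _ h1 (.commitSuccess _ T hE.path
    (by simp [Config.setPhase]) (by simpa [Config.setPhase, Config.setLoc] using hE.valid))
  have h3 := Run.snoc _ _ _ _ h2 (.commit _ T (by simp [Config.setPhase]))
  refine ⟨_, by simpa using h3, fun j => ?_, fun b hb => ?_⟩
  · by_cases hj : j = T.proc
    · subst hj
      simp [Config.setPhase, Config.setLoc, Config.clear]
    · simp [Config.setPhase, Config.setLoc, Config.clear, Config.flush, Config.put, hj, htrack]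
  · simp only [Config.setPhase, Config.setLoc, Config.clear, Config.flush, Config.put_track_self,
      Config.put_mem]

/-- A t-read of `x` by `T` that returns `v`, with the run `ρ` of `T` up to its response and
without accesses to new metadata objects. -/
structure QuietRead (M : Implementation n X V B W R Q) (P : B → Option X) (p : Fin n) (N : ℕ)
    (F : List (Event n X V B W R)) (Y : Set X) (T : Txn n) (α : List (Event n X V B W R)) (x : X)
    (mem : B → W) (ρ : List (Event n X V B W R)) (v : V) (t : ProcState n X V B W Q) :
    Prop where
  reads : M.FastReads mem T ρ t
  phase : t.phase = .ready T
  shape : ∃ β, ρ = α ++ [.inv T (.read x)] ++ β ++ [.resp T (.value v)] ∧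
    ∀ e ∈ β, ∃ b p o, e = .prim T b p o
  dset : Dset ρ T = insert x (Dset α T)
  metadata : ∀ b, P b = none → Accesses ρ T b → Accesses α T b
  data : ∀ b z, P b = some z → Accesses ρ T b → z ∈ insert x (Dset α T)
  witness : ∃ δ D, M.Extends p N F Y δ D ∧ ∃ t', M.FastReads D.mem T ρ t'

variable {P : B → Option X} {m : ℕ} {p : Fin n} {N : ℕ} {F : List (Event n X V B W R)}
  {C : Config n X V B W Q} {Y : Set X} {T T' : Txn n} {α α' : List (Event n X V B W R)}
  {s s' : ProcState n X V B W Q} {x y : X}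

theorem QuietRead.readsValue {mem : B → W} {ρ : List (Event n X V B W R)} {v : V}
    {t : ProcState n X V B W Q} (h : M.QuietRead P p N F Y T α x mem ρ v t) :
    ReadsValue ρ T x v := by
  obtain ⟨β, rfl, hβ⟩ := h.shape
  exact ⟨α, β, [], by simp, hβ⟩

/-- Adds to `exists_read` that the data objects accessed belong to the data set, which is the first
condition on the partition. -/
theorem ReadContext.exists_quietRead (h : M.ReadContext P m p N F C Y T α s x)
    (hnew : ¬ M.AccessesNewMetadata P p N F Y T α x)
    {δ : List (Event n X V B W R)} {D : Config n X V B W Q}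
    (hδ : ∀ e ∈ δ, e.txn = ⟨p, .slow, N⟩) (hD : M.Run (F ++ δ) D)
    (hY : Dset δ ⟨p, .slow, N⟩ ⊆ Y) :
    ∃ ρ v t, M.QuietRead P p N F Y T α x D.mem ρ v t := by
  obtain ⟨β, v, t, ht, hph, hβ, hDs, hmeta, hw⟩ := h.exists_read hnew hδ hD hY
  refine ⟨_, v, t, ht, hph, ⟨β, rfl, hβ⟩, hDs, hmeta, fun b z hb hacc => ?_, hw⟩
  have hT : T ∉ txns (F ++ δ) := (h.slow.freshFast hδ hD h.path h.proc).notMem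
  have := h.partition.fast_access _ ⟨_, h.run_after hδ hD ht⟩ T ?_ h.path b hacc.append_right z hb
  · rwa [Dset_append, Dset_eq_empty hT, Set.empty_union, hDs] at this
  · rw [txns_append]
    exact .inr ⟨.inv T (.read x), by simp, rfl⟩

/-- A quiet t-read that returns different values when the memory changes has accessed a base
object that has changed. -/
theorem QuietRead.exists_change {mem mem' : B → W} {ρ ρ' : List (Event n X V B W R)} {v v' : V}
    {t t' : ProcState n X V B W Q} (h : M.QuietRead P p N F Y T α x mem ρ v t)
    (h' : M.QuietRead P p N F Y T α x mem' ρ' v' t') (hv : v ≠ v') :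
    ∃ b, Accesses ρ T b ∧ mem' b ≠ mem b := by
  by_contra! hmem
  obtain ⟨β, hρ, hβ⟩ := h.shape
  obtain ⟨β', hρ', hβ'⟩ := h'.shape
  exact hv ((hρ ▸ h.reads.congr_mem hmem).read_unique hβ (hρ' ▸ h'.reads) hβ')

/-- If `T` sees the writer, so does `T'`. -/
theorem QuietRead.eq_of_seen (hO : M.SatisfiesOpacity)
    (h : M.ReadContext P m p N F C Y T α s x) (h' : M.ReadContext P m p N F C Y T' α' s' y)
    (hTT' : T.proc ≠ T'.proc)
    (hdisj : Disjoint (insert x (Dset α T)) (insert y (Dset α' T')))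
    {δ : List (Event n X V B W R)} {D : Config n X V B W Q}
    (hδ : ∀ e ∈ δ, e.txn = ⟨p, .slow, N⟩) (hD : M.Run (F ++ δ) D)
    {ρ ρ' : List (Event n X V B W R)} {v v' w : V} {t t' : ProcState n X V B W Q}
    (hρ : M.QuietRead P p N F Y T α x D.mem ρ v t)
    (hρ' : M.QuietRead P p N F Y T' α' y D.mem ρ' v' t')
    (hwx : ∀ T₁ u, .inv T₁ (.write x u) ∈ F ++ δ → T₁ = ⟨p, .slow, N⟩)
    (hwy : ∀ T₁ u, .inv T₁ (.write y u) ∈ F ++ δ → T₁ = ⟨p, .slow, N⟩ ∧ u = w)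
    (hwrite : .inv ⟨p, .slow, N⟩ (.write y w) ∈ δ) (hv : v ≠ M.initVal x) : v' = w := by
  have hfresh := h.slow.freshFast hδ hD h.path h.proc
  obtain ⟨C', hC', htrack', hmem'⟩ :=
    hρ.reads.run_commit hfresh hρ.phase (h.slow.track_eq hδ hD)
  have hT'T : T' ≠ T := fun h => hTT' (by rw [h])
  -- Although `T` only reads t-objects, its cache-commit may write to memory. It must not disturb
  -- the run `ρ'`, which is then replayed after the commit of `T`.
  have hmem : ∀ b, Accesses ρ' T' b → C'.mem b = D.mem b := by
    intro b hb
    refine hmem' b fun u hu => ?_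
    have hbρ : Accesses ρ T b := (hρ.reads.track_ne_none_iff b).1 (by simp [hu])
    rcases hPb : P b with _ | z
    -- A metadata object accessed in `ρ'` was accessed in `α'` already. If `T` applied a nontrivial
    -- primitive to it, `T` would clash with `T'` pending after `α'`. The argument takes place after
    -- the witness for `ρ` because `not_clashes` needs a t-complete start.
    · obtain ⟨δ₁, D₁, hext, t₁, ht₁⟩ := hρ.witness
      obtain ⟨q, o, hq, hqt⟩ := hρ.reads.exclusive hu
      have hα' := h'.reads_after hext.txn hext.run hext.dset
      refine h.progressive.not_clashes (h'.slow.freshFast hext.txn hext.run h'.path h'.proc)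
        (h.slow.freshFast hext.txn hext.run h.path h.proc) hext.complete
        (h.slow.track_eq hext.txn hext.run) hTT'.symm hα' ht₁ ?_ b q o hq ?_
      · rw [hρ.dset]
        exact (hdisj.mono_right (Set.subset_insert _ _)).symm
      · have := (hα'.track_ne_none_iff b).2 (hρ'.metadata b hPb hb)
        rcases hs : s'.track b with _ | ⟨_, _ | _⟩
        · exact absurd hs this
        · simpa [Clashes, hs] using hqt
        · simp [Clashes, hs]
    · exact Set.disjoint_left.1 hdisj (hρ.data b z hPb hbρ) (hρ'.data b z hPb hb)
  have hproc : ∀ e ∈ F ++ δ ++ ρ ++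
      [.inv T .tryC, .cacheCommit T true, .resp T .commit], e.txn.proc ≠ T'.proc := by
    intro e he
    simp only [List.mem_append, List.mem_cons, List.not_mem_nil, or_false] at he
    rcases he with ((he | he) | he) | rfl | rfl | rfl
    · rw [(h.slow.slow e he).1]; exact h'.proc.symm
    · rw [hδ e he]; exact h'.proc.symm
    · rw [hρ.reads.txn_eq e he]; exact hTT'
    all_goals exact hTT'
  have hrun := FastReads.run (hC'.freshFast h'.path hproc) (hρ'.reads.congr_mem hmem)
    fun b q o _ j _ => by simp [Clashes, htrack']
  have hwrites : ∀ T₁ z u, .inv T₁ (.write z u) ∈ F ++ δ ++ ρ ++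
      [.inv T .tryC, .cacheCommit T true, .resp T .commit] ++ ρ' →
      .inv T₁ (.write z u) ∈ F ++ δ := by
    intro T₁ z u he
    have h1 : Event.inv T₁ (.write z u) ∉ ρ := fun h' => by
      have : z ∈ Wset ρ T₁ := ⟨u, h'⟩
      simp [hρ.reads.Wset_eq] at this
    have h2 : Event.inv T₁ (.write z u) ∉ ρ' := fun h' => by
      have : z ∈ Wset ρ' T₁ := ⟨u, h'⟩
      simp [hρ'.reads.Wset_eq] at this
    rw [List.mem_append, List.mem_append, List.mem_append] at he
    rcases he with ((he | he) | he) | he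
    · exact he
    · exact absurd he h1
    · simp at he
    · exact absurd he h2
  have hTρ' : T ∉ txns ρ' := fun h' => hT'T (txns_subset hρ'.reads.txn_eq _ h').symm
  have hT'mem : T' ∈ txns ρ' := by
    obtain ⟨β, rfl, -⟩ := hρ'.shape
    exact ⟨.inv T' (.read y), by simp, rfl⟩
  have hcommit : Committed (F ++ δ ++ ρ ++
      [.inv T .tryC, .cacheCommit T true, .resp T .commit] ++ ρ') T := by
    rw [Committed, proj_append, proj_append, proj_eq_nil hTρ', List.append_nil,
      proj_eq_self (E := [.inv T .tryC, .cacheCommit T true, .resp T .commit])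
        (by simp [Event.txn])]
    simp
  -- In this execution `T` commits before `T'` starts, so a serialization with the writer before `T`
  -- has it before `T'` too.
  refine hO.read_eq_of_seen (T := T) (T' := T') (x := x) (y := y) ⟨_, hrun⟩
    ((hρ.readsValue.append_left _).append _ |>.append _) (hρ'.readsValue.append_left _)
    (fun T₁ u he => hwx T₁ u (hwrites _ _ _ he)) (fun T₁ u he => hwy T₁ u (hwrites _ _ _ he))
    (fun h₁ => h.proc (by rw [h₁])) (fun h₁ => h'.proc (by rw [h₁])) ?_ hv hcommit
    ⟨?_, ?_, .inl hcommit, _, ρ', rfl, ?_, hTρ'⟩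
  · exact List.mem_append_left _ (List.mem_append_left _ (List.mem_append_left _
      (List.mem_append_right _ hwrite)))
  · exact ⟨.inv T .tryC, by simp, rfl⟩
  · rw [txns_append]
    exact .inr hT'mem
  · rintro ⟨e, he, h₁⟩
    exact hproc e he (by rw [h₁])

end Implementation

end Flip

end HybridTM

namespace HybridTM

/-! ### The induction: one more t-object for each reader, one more metadata access in total. -/

section Growth

open Classical

universe u₁ u₂ u₃ u₄ u₅ u₆

variable {n : ℕ} {X : Type u₁} {V : Type u₂} {B : Type u₃} {W : Type u₄} {R : Type u₅}
  {Q : Type u₆}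

namespace Implementation

variable {M : Implementation n X V B W R Q} {P : B → Option X} {m : ℕ} {p : Fin n} {N : ℕ}
  {F : List (Event n X V B W R)} {C : Config n X V B W Q} {T T' : Txn n}
  {α α' : List (Event n X V B W R)} {s s' : ProcState n X V B W Q} {x y : X}

/-- A quiet t-read that precedes `tryC` of the only writer returns the initial value. -/
theorem QuietRead.eq_init (hO : M.SatisfiesOpacity) {Y : Set X}
    (h : M.ReadContext P m p N F C Y T α s x) (hwF : ∀ T₁ u, .inv T₁ (.write x u) ∉ F)
    {δ : List (Event n X V B W R)} {D : Config n X V B W Q}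
    (hδ : ∀ e ∈ δ, e.txn = ⟨p, .slow, N⟩) (hD : M.Run (F ++ δ) D)
    (htry : .inv ⟨p, .slow, N⟩ .tryC ∉ δ) (hcom : .resp ⟨p, .slow, N⟩ .commit ∉ δ)
    {ρ : List (Event n X V B W R)} {v : V} {t : ProcState n X V B W Q}
    (hρ : M.QuietRead P p N F Y T α x D.mem ρ v t) : v = M.initVal x := by
  have hTS : T ≠ ⟨p, .slow, N⟩ := fun h' => h.proc (by rw [h'])
  have hS : ∀ e ∈ F ++ δ ++ ρ, e.txn = ⟨p, .slow, N⟩ → e ∈ δ := by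
    intro e he heS
    rw [List.mem_append, List.mem_append] at he
    rcases he with (he | he) | he
    · exact absurd ⟨e, he, heS⟩ h.slow.notMem
    · exact he
    · exact absurd ((hρ.reads.txn_eq e he).symm.trans heS) hTS
  refine hO.read_eq_init_of_live ⟨_, h.run_after hδ hD hρ.reads⟩ (hρ.readsValue.append_left _)
    (fun T₁ u he => ?_) hTS (fun he => htry (hS _ he rfl)) fun he => hcom (hS _ he rfl)
  rw [List.mem_append, List.mem_append] at he
  rcases he with (he | he) | he
  · exact absurd he (hwF T₁ u)
  · exact hδ _ he
  · have : x ∈ Wset ρ T₁ := ⟨u, he⟩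
    simp [hρ.reads.Wset_eq] at this

/-- A quiet t-read that follows the only writer returns the written value. -/
theorem QuietRead.eq_written (hO : M.SatisfiesOpacity) {Y : Set X}
    (h : M.ReadContext P m p N F C Y T α s x)
    {δ : List (Event n X V B W R)} {D : Config n X V B W Q}
    (hδ : ∀ e ∈ δ, e.txn = ⟨p, .slow, N⟩) (hD : M.Run (F ++ δ) D)
    (hcom : Committed (F ++ δ) ⟨p, .slow, N⟩) {w : V}
    (hw : ∀ T₁ u, .inv T₁ (.write x u) ∈ F ++ δ → T₁ = ⟨p, .slow, N⟩ ∧ u = w)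
    (hwrite : .inv ⟨p, .slow, N⟩ (.write x w) ∈ δ)
    {ρ : List (Event n X V B W R)} {v : V} {t : ProcState n X V B W Q}
    (hρ : M.QuietRead P p N F Y T α x D.mem ρ v t) : v = w := by
  have hTS : T ≠ ⟨p, .slow, N⟩ := fun h' => h.proc (by rw [h'])
  have hSρ : (⟨p, .slow, N⟩ : Txn n) ∉ txns ρ := fun h' =>
    hTS (txns_subset hρ.reads.txn_eq _ h').symm
  have hcom' : Committed (F ++ δ ++ ρ) ⟨p, .slow, N⟩ := by
    rw [Committed, proj_append, proj_eq_nil hSρ, List.append_nil]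
    exact hcom
  refine hO.read_eq_of_precedes ⟨_, h.run_after hδ hD hρ.reads⟩ (hρ.readsValue.append_left _)
    (fun T₁ u he => ?_) hTS (by simp [hwrite]) hcom'
    ⟨⟨.inv ⟨p, .slow, N⟩ (.write x w), by simp [hwrite], rfl⟩, ?_, .inl hcom', _, _, rfl,
      (h.slow.freshFast hδ hD h.path h.proc).notMem, hSρ⟩
  · rcases List.mem_append.1 he with he | he
    · exact hw T₁ u he
    · have : x ∈ Wset ρ T₁ := ⟨u, he⟩
      simp [hρ.reads.Wset_eq] at this
  · obtain ⟨β, rfl, -⟩ := hρ.shape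
    exact ⟨.inv T (.read x), by simp, rfl⟩

/-- Of two fast-path transactions whose next t-reads are on t-objects that a slow-path
transaction writes, one has to access a new metadata object. -/
theorem ReadContext.accessesNewMetadata_or [Nontrivial V] (hO : M.SatisfiesOpacity)
    (h : M.ReadContext P m p N F C {x, y} T α s x)
    (h' : M.ReadContext P m p N F C {x, y} T' α' s' y) (hTT' : T.proc ≠ T'.proc)
    (hdisj : Disjoint (insert x (Dset α T)) (insert y (Dset α' T')))
    (hwx : ∀ T₁ u, .inv T₁ (.write x u) ∉ F) (hwy : ∀ T₁ u, .inv T₁ (.write y u) ∉ F) :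
    M.AccessesNewMetadata P p N F {x, y} T α x ∨
      M.AccessesNewMetadata P p N F {x, y} T' α' y := by
  by_contra! hcon
  obtain ⟨hnew, hnew'⟩ := hcon
  have hxy : x ≠ y := by
    rintro rfl
    exact Set.disjoint_left.1 hdisj (Set.mem_insert _ _) (Set.mem_insert _ _)
  obtain ⟨v₀, hv₀⟩ := exists_ne (M.initVal x)
  obtain ⟨w₀, hw₀⟩ := exists_ne (M.initVal y)
  obtain ⟨γ, γ', hex, hγ, hcom, hγx, hγy, hγt, hγc, hops⟩ := h.progressive.exists_writer h.live
    h.slow.complete h.slow.notMem h.run rfl (h.run.phase_idle h.slow.complete _) x y v₀ w₀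
  set S : Txn n := ⟨p, .slow, N⟩ with hS
  -- The prefixes considered are `γ ++ γ'.take i`: for `i = 0` both writes are done and `tryC` has
  -- not been invoked, for `i = γ'.length` the writer has committed.
  have hsub : ∀ i, ∀ e ∈ γ ++ γ'.take i, e ∈ γ ++ γ' := fun i e he => by
    rcases List.mem_append.1 he with he | he
    · exact List.mem_append_left _ he
    · exact List.mem_append_right _ (List.mem_of_mem_take he)
  have hδ : ∀ i, ∀ e ∈ γ ++ γ'.take i, e.txn = S := fun i e he => hγ e (hsub i e he)
  have hY : ∀ i, Dset (γ ++ γ'.take i) S ⊆ {x, y} := by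
    rintro i z (hz | ⟨u, hz⟩)
    · rcases hops _ (hsub i _ hz) with hz | hz | hz <;> cases hz
    · rcases hops _ (hsub i _ hz) with hz | hz | hz <;> cases hz
      · exact .inl rfl
      · exact .inr rfl
  have hwx' : ∀ i T₁ u, .inv T₁ (.write x u) ∈ F ++ (γ ++ γ'.take i) → T₁ = S ∧ u = v₀ := by
    intro i T₁ u he
    rcases List.mem_append.1 he with he | he
    · exact absurd he (hwx T₁ u)
    · obtain rfl : T₁ = S := hδ i _ he
      rcases hops _ (hsub i _ he) with he | he | he <;> cases he
      · exact ⟨rfl, rfl⟩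
      · exact absurd rfl hxy
  have hwy' : ∀ i T₁ u, .inv T₁ (.write y u) ∈ F ++ (γ ++ γ'.take i) → T₁ = S ∧ u = w₀ := by
    intro i T₁ u he
    rcases List.mem_append.1 he with he | he
    · exact absurd he (hwy T₁ u)
    · obtain rfl : T₁ = S := hδ i _ he
      rcases hops _ (hsub i _ he) with he | he | he <;> cases he
      · exact absurd rfl hxy
      · exact ⟨rfl, rfl⟩
  have hrun : ∀ i, ∃ D, M.Run (F ++ (γ ++ γ'.take i)) D := by
    intro i
    refine IsExecution.prefix (E' := γ'.drop i) ?_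
    rwa [List.append_assoc, List.append_assoc, List.take_append_drop]
  choose D hD using hrun
  have hq := fun i => h.exists_quietRead hnew (hδ i) (hD i) (hY i)
  have hq' := fun i => h'.exists_quietRead hnew' (hδ i) (hD i) (hY i)
  choose ρ v t hρ using hq
  choose ρ' v' t' hρ' using hq'
  have hseen : ∀ i, v i ≠ M.initVal x → v' i ≠ M.initVal y := fun i hi => by
    rw [(hρ i).eq_of_seen hO h h' hTT' hdisj (hδ i) (hD i) (hρ' i)
      (fun T₁ u he => (hwx' i T₁ u he).1) (hwy' i) (List.mem_append_left _ hγy) hi]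
    exact hw₀
  have hseen' : ∀ i, v' i ≠ M.initVal y → v i ≠ M.initVal x := fun i hi => by
    rw [(hρ' i).eq_of_seen hO h' h hTT'.symm hdisj.symm (hδ i) (hD i) (hρ i)
      (fun T₁ u he => (hwy' i T₁ u he).1) (hwx' i) (List.mem_append_left _ hγx) hi]
    exact hv₀
  have hzero : v 0 = M.initVal x := by
    refine (hρ 0).eq_init hO h hwx (hδ 0) (hD 0) ?_ ?_ <;> simpa
  have hlast : v γ'.length ≠ M.initVal x := by
    rw [(hρ γ'.length).eq_written hO h (hδ _) (hD _) (by rwa [List.take_length]) (hwx' _)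
      (List.mem_append_left _ hγx)]
    exact hv₀
  have hflip : ∃ i, v i ≠ M.initVal x := ⟨_, hlast⟩
  -- The first index at which `T` sees the writer is positive. By `hseen` and `hseen'` it is also a
  -- switch for `T'`, so event `j` of `γ'` changes both answers.
  obtain ⟨j, hj⟩ : ∃ j, Nat.find hflip = j + 1 := by
    refine Nat.exists_eq_succ_of_ne_zero fun h0 => ?_
    have := Nat.find_spec hflip
    rw [h0] at this
    exact this hzero
  have hjx : v j = M.initVal x := not_not.1 (Nat.find_min hflip (m := j) (by omega))
  have hjx' : v (j + 1) ≠ M.initVal x := by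
    rw [← hj]
    exact Nat.find_spec hflip
  have hjy : v' j = M.initVal y := not_not.1 fun h₁ => hseen' j h₁ hjx
  have hjy' := hseen _ hjx'
  have hjlt : j < γ'.length := by
    have := Nat.find_min' hflip hlast
    omega
  obtain ⟨b, hb, hbmem⟩ := (hρ j).exists_change (hρ (j + 1)) (hjx ▸ hjx'.symm)
  obtain ⟨b', hb', hbmem'⟩ := (hρ' j).exists_change (hρ' (j + 1)) (hjy ▸ hjy'.symm)
  have hstep : M.Step (F ++ (γ ++ γ'.take j)) (D j) γ'[j] (D (j + 1)) := by
    have h1 := hD (j + 1)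
    rw [← List.take_append_getElem hjlt, ← List.append_assoc, ← List.append_assoc] at h1
    obtain ⟨C₁, h2, h3⟩ := h1.snoc_inv
    rw [List.append_assoc] at h2 h3
    rwa [h2.deterministic (hD j)] at h3
  -- One event of a slow-path transaction changes one base object, so both reads depend on the same
  -- one.
  obtain rfl := hstep.mem_change_unique
    (by rw [hγ _ (List.mem_append_right _ (List.getElem_mem hjlt))]) hbmem hbmem'
  -- A metadata object would lie in the old run `α`, which the writer does not affect; a data object
  -- would belong to both data sets.
  rcases hPb : P b with _ | z
  · have := (hρ j).metadata b hPb hb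
    exact hbmem (by rw [h.mem_eq (hδ _) (hD _) (hY _) b this, h.mem_eq (hδ _) (hD _) (hY _) b this])
  · exact Set.disjoint_left.1 hdisj ((hρ j).data b z hPb hb) ((hρ' j).data b z hPb hb')

end Implementation

/-- The t-objects on which t-reads or t-writes are invoked. -/
def mentioned (E : List (Event n X V B W R)) : Set X :=
  {x | ∃ T, .inv T (.read x) ∈ E ∨ ∃ v, .inv T (.write x v) ∈ E}

theorem finite_mentioned (E : List (Event n X V B W R)) : (mentioned E).Finite := by
  induction E with
  | nil => simp [mentioned]
  | cons e E ih =>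
    have : ∃ A : Set X, A.Finite ∧ mentioned (e :: E) ⊆ A ∪ mentioned E := by
      rcases e with ⟨T, x | ⟨x, v⟩ | _⟩ | _ | _ | _
      · refine ⟨{x}, Set.finite_singleton x, ?_⟩
        rintro y ⟨T', hy⟩
        simp only [List.mem_cons, Event.inv.injEq, TOp.read.injEq] at hy
        simp only [Set.mem_union, Set.mem_singleton_iff, mentioned, Set.mem_ofPred_eq]
        grind
      · refine ⟨{x}, Set.finite_singleton x, ?_⟩
        rintro y ⟨T', hy⟩
        simp only [List.mem_cons, Event.inv.injEq, TOp.write.injEq] at hy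
        simp only [Set.mem_union, Set.mem_singleton_iff, mentioned, Set.mem_ofPred_eq]
        grind
      all_goals
        refine ⟨∅, Set.finite_empty, ?_⟩
        rintro y ⟨T', hy⟩
        simp only [List.mem_cons] at hy
        simp only [Set.empty_union, mentioned, Set.mem_ofPred_eq]
        grind
    obtain ⟨A, hA, hsub⟩ := this
    exact (hA.union ih).subset hsub

theorem Dset_subset_mentioned (E : List (Event n X V B W R)) (T : Txn n) :
    Dset E T ⊆ mentioned E := by
  rintro x (hx | hx)
  · exact ⟨T, .inl hx⟩
  · exact ⟨T, .inr hx⟩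

theorem finite_Dset (E : List (Event n X V B W R)) (T : Txn n) : (Dset E T).Finite :=
  (finite_mentioned E).subset (Dset_subset_mentioned E T)

/-- The metadata objects that a transaction accesses. -/
def metadataAccesses (P : B → Option X) (E : List (Event n X V B W R)) (T : Txn n) : Set B :=
  {b | P b = none ∧ Accesses E T b}

theorem finite_metadataAccesses (P : B → Option X) (E : List (Event n X V B W R)) (T : Txn n) :
    (metadataAccesses P E T).Finite := by
  suffices h : {b | Accesses E T b}.Finite from h.subset fun b hb => hb.2
  induction E with
  | nil => simp [Accesses]
  | cons e E ih =>
    have : ∃ A : Set B, A.Finite ∧ {b | Accesses [e] T b} ⊆ A := by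
      rcases e with _ | _ | ⟨T', b, q, o⟩ | _
      case prim =>
        refine ⟨{b}, Set.finite_singleton b, ?_⟩
        rintro b' ⟨q', o', hb⟩
        simp only [List.mem_singleton, Event.prim.injEq] at hb
        exact hb.2.1
      all_goals
        refine ⟨∅, Set.finite_empty, ?_⟩
        rintro b' ⟨q', o', hb⟩
        simp at hb
    obtain ⟨A, hA, hsub⟩ := this
    refine (hA.union ih).subset fun b hb => ?_
    exact (Accesses.append_inv (E := [e]) hb).imp (fun h => hsub h) id

namespace Implementation

/-- After a t-complete execution `F` by slow-path transactions of process `p`, the fast-path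
transactions `T` and `T'` can perform t-reads on `k` t-objects each, where their numbers of
accesses to metadata objects add up to at least `k`. -/
structure ReadPair (M : Implementation n X V B W R Q) (P : B → Option X) (p : Fin n)
    (T T' : Txn n) (k N : ℕ) (F : List (Event n X V B W R)) (C : Config n X V B W Q)
    (α α' : List (Event n X V B W R)) (s s' : ProcState n X V B W Q) : Prop where
  slow : M.SlowPrefix p N F
  run : M.Run F C
  reads : M.FastReads C.mem T α s
  reads' : M.FastReads C.mem T' α' s'
  phase : s.phase = .ready T ∨ α = []
  phase' : s'.phase = .ready T' ∨ α' = []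
  disjoint : Disjoint (Dset α T) (Dset α' T')
  card : (Dset α T).ncard = k
  card' : (Dset α' T').ncard = k
  metadata : k ≤ (metadataAccesses P α T).ncard + (metadataAccesses P α' T').ncard

variable {M : Implementation n X V B W R Q} {P : B → Option X} {m : ℕ} {p : Fin n} {k N : ℕ}
  {F : List (Event n X V B W R)} {C : Config n X V B W Q} {T T' : Txn n}
  {α α' : List (Event n X V B W R)} {s s' : ProcState n X V B W Q} {x y : X}

theorem ReadPair.swap (h : M.ReadPair P p T T' k N F C α α' s s') :
    M.ReadPair P p T' T k N F C α' α s' s :=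
  ⟨h.slow, h.run, h.reads', h.reads, h.phase', h.phase, h.disjoint.symm, h.card', h.card,
    (Nat.add_comm _ _).le.trans' h.metadata⟩

theorem ReadPair.exists_succ_of_accessesNewMetadata {Y : Set X}
    (h : M.ReadPair P p T T' k N F C α α' s s') (hx : M.ReadContext P m p N F C Y T α s x)
    (hy : M.ReadContext P m p N F C Y T' α' s' y)
    (hdisj : Disjoint (insert x (Dset α T)) (insert y (Dset α' T')))
    (hnew : M.AccessesNewMetadata P p N F Y T α x) :
    ∃ N F C α α' s s', M.ReadPair P p T T' (k + 1) N F C α α' s s' := by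
  obtain ⟨δ, D, hD, ρ, t, hρ, ht, hDs, hacc, b, hb, hbα, hbρ⟩ := hnew
  -- The other reader replays its run after the same extension and reads its t-object there. It may
  -- gain nothing, but it keeps its earlier metadata accesses.
  obtain ⟨β, r, v, t', -, -, hρ', ht', -, hDs'⟩ := FastReads.exists_read hy.progressive hy.live
    hy.capacity (hy.slow.freshFast hD.txn hD.run hy.path hy.proc) hD.complete
    (fun j _ => hy.slow.track_eq hD.txn hD.run j) (hy.reads_after hD.txn hD.run hD.dset) hy.phase
    hy.fresh hy.card
  refine ⟨N + 1, F ++ δ, D, ρ, _, t, t', h.slow.append ⟨_, hD.run⟩ hD.complete hD.txn, hD.run, hρ,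
    hρ', .inl ht, .inl ht', ?_, ?_, ?_, ?_⟩
  · rwa [hDs, hDs']
  · rw [hDs, Set.ncard_insert_of_notMem hx.fresh (finite_Dset _ _), h.card]
  · rw [hDs', Set.ncard_insert_of_notMem hy.fresh (finite_Dset _ _), h.card']
  · have h1 : (metadataAccesses P α T).ncard < (metadataAccesses P ρ T).ncard := by
      refine Set.ncard_lt_ncard ⟨fun b' hb' => ⟨hb'.1, hacc b' hb'.2⟩, fun hsub => ?_⟩
        (finite_metadataAccesses _ _ _)
      exact hbα (hsub ⟨hb, hbρ⟩).2
    have h2 := Set.ncard_le_ncard (s := metadataAccesses P α' T')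
      (t := metadataAccesses P (α' ++ [.inv T' (.read y)] ++ β ++ [.resp T' (.value v)]) T')
      (fun b' hb' => ⟨hb'.1, hb'.2.append_left.append_left.append_left⟩)
      (finite_metadataAccesses _ _ _)
    have := h.metadata
    omega

theorem ReadPair.exists_succ [Infinite X] [Nontrivial V] (hP : M.IsDataPartition P)
    (hM : M.Progressive) (hO : M.SatisfiesOpacity) (hL : M.ObstructionFreeLiveness)
    (hcap : M.NoCapacityAborts m) (hT : T.path = .fast) (hT' : T'.path = .fast)
    (hTp : T.proc ≠ p) (hTp' : T'.proc ≠ p) (hTT' : T.proc ≠ T'.proc) (hk : k + 1 ≤ m)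
    (h : M.ReadPair P p T T' k N F C α α' s s') :
    ∃ N F C α α' s s', M.ReadPair P p T T' (k + 1) N F C α α' s s' := by
  -- Only finitely many t-objects occur so far. Unused `x` and `y` still have their initial values,
  -- so a different value written to them can be recognized.
  have hfin := finite_mentioned (F ++ α ++ α')
  obtain ⟨x, hx⟩ := hfin.exists_notMem
  obtain ⟨y, hy⟩ := (hfin.insert x).exists_notMem
  simp only [Set.mem_insert_iff, not_or] at hy
  have hF : ∀ z, z ∉ mentioned (F ++ α ++ α') → ∀ T₁ u, .inv T₁ (.write z u) ∉ F :=
    fun z hz T₁ u hu => hz ⟨T₁, .inr ⟨u, by simp [hu]⟩⟩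
  have hα : ∀ z, z ∉ mentioned (F ++ α ++ α') → z ∉ Dset α T := fun z hz h' => by
    refine hz (Dset_subset_mentioned _ T ?_)
    rw [Dset_append, Dset_append]
    exact .inl (.inr h')
  have hα' : ∀ z, z ∉ mentioned (F ++ α ++ α') → z ∉ Dset α' T' := fun z hz h' => by
    refine hz (Dset_subset_mentioned _ T' ?_)
    rw [Dset_append]
    exact .inr h'
  have hdisj : Disjoint (insert x (Dset α T)) (insert y (Dset α' T')) := by
    rw [Set.disjoint_insert_left, Set.disjoint_insert_right, Set.mem_insert_iff, not_or]
    exact ⟨⟨Ne.symm hy.1, hα' x hx⟩, hα y hy.2, h.disjoint⟩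
  have hcx : M.ReadContext P m p N F C {x, y} T α s x :=
    ⟨hP, hM, hL, hcap, h.slow, h.run, hT, hTp, h.reads, h.phase, hα x hx,
      by rwa [Set.ncard_insert_of_notMem (hα x hx) (finite_Dset _ _), h.card],
      by simp [hα x hx, hα y hy.2]⟩
  have hcy : M.ReadContext P m p N F C {x, y} T' α' s' y :=
    ⟨hP, hM, hL, hcap, h.slow, h.run, hT', hTp', h.reads', h.phase', hα' y hy.2,
      by rwa [Set.ncard_insert_of_notMem (hα' y hy.2) (finite_Dset _ _), h.card'],
      by simp [hα' x hx, hα' y hy.2]⟩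
  rcases hcx.accessesNewMetadata_or hO hcy hTT' hdisj (hF x hx) (hF y hy.2) with hnew | hnew
  · exact h.exists_succ_of_accessesNewMetadata hcx hcy hdisj hnew
  · obtain ⟨N, F, C, α, α', s, s', h⟩ :=
      h.swap.exists_succ_of_accessesNewMetadata hcy hcx hdisj.symm hnew
    exact ⟨N, F, C, α', α, s', s, h.swap⟩

theorem exists_readPair [Infinite X] [Nontrivial V] (hP : M.IsDataPartition P)
    (hM : M.Progressive) (hO : M.SatisfiesOpacity) (hL : M.ObstructionFreeLiveness)
    (hcap : M.NoCapacityAborts m) (hT : T.path = .fast) (hT' : T'.path = .fast)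
    (hTp : T.proc ≠ p) (hTp' : T'.proc ≠ p) (hTT' : T.proc ≠ T'.proc) (hk : k ≤ m) :
    ∃ N F C α α' s s', M.ReadPair P p T T' k N F C α α' s s' := by
  induction k with
  | zero =>
    refine ⟨0, [], _, [], [], _, _, ⟨⟨_, .nil⟩, ?_, by simp, by simp, by simp⟩, .nil, .nil, .nil,
      .inr rfl, .inr rfl, ?_, ?_, ?_, Nat.zero_le _⟩
    · simp [AllTComplete, txns]
    all_goals simp [Dset, Rset, Wset]
  | succ k ih =>
    obtain ⟨N, F, C, α, α', s, s', h⟩ := ih (by omega)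
    exact h.exists_succ hP hM hO hL hcap hT hT' hTp hTp' hTT' hk

/-- The two runs in a `ReadPair` are alternatives after `F`; here one of them is turned into an
execution. As `m` is positive, the read set is nonempty. -/
theorem ReadPair.exists_execution (hm : 1 ≤ m) (hT : T.path = .fast) (hTp : T.proc ≠ p)
    (h : M.ReadPair P p T T' m N F C α α' s s') : ∃ E, M.IsExecution E ∧ T ∈ txns E ∧
      ReadOnly E T ∧ (Dset E T).ncard = m ∧ metadataAccesses P α T ⊆ metadataAccesses P E T := by
  have hrun : M.Run (F ++ []) C := by simpa using h.run
  have hfresh := h.slow.freshFast (by simp) hrun hT hTp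
  rw [List.append_nil] at hfresh
  have hα := h.reads.run hfresh fun b q o _ j _ => by
    simp [Clashes, h.slow.track_eq (by simp) hrun]
  have hD : Dset (F ++ α) T = Dset α T := by
    rw [Dset_append, Dset_eq_empty hfresh.notMem, Set.empty_union]
  have hW : Wset (F ++ α) T = ∅ := by
    rw [Wset_append, Wset_eq_empty hfresh.notMem, h.reads.Wset_eq, Set.empty_union]
  have hR : (Rset (F ++ α) T).Nonempty := by
    rw [← Set.union_empty (Rset (F ++ α) T), ← hW]
    change (Dset (F ++ α) T).Nonempty
    rw [hD]
    exact Set.nonempty_of_ncard_ne_zero (by rw [h.card]; omega)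
  refine ⟨F ++ α, ⟨_, hα⟩, ?_, ⟨hR, hW⟩, by rw [hD, h.card], fun b hb => ⟨hb.1, hb.2.append_right⟩⟩
  obtain ⟨x, hx⟩ := hR
  exact ⟨.inv T (.read x), hx, rfl⟩

/-- If there are no capacity aborts, some fast-path read-only transaction with `m` t-objects in
its data set accesses at least `m / 2` metadata objects. -/
theorem NoCapacityAborts.exists_execution [Infinite X] [Nontrivial V]
    (hcap : M.NoCapacityAborts m) (hP : M.IsDataPartition P) (hM : M.Progressive)
    (hO : M.SatisfiesOpacity) (hL : M.ObstructionFreeLiveness) (hn : 3 ≤ n) (hm : 1 ≤ m) :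
    ∃ E T, M.IsExecution E ∧ T ∈ txns E ∧ T.path = .fast ∧ ReadOnly E T ∧
      (Dset E T).ncard = m ∧ m ≤ 2 * (metadataAccesses P E T).ncard := by
  obtain ⟨N, F, C, α, α', s, s', h⟩ := exists_readPair (k := m)
    (p := (⟨1, by omega⟩ : Fin n)) (T := ⟨⟨0, by omega⟩, .fast, 0⟩)
    (T' := ⟨⟨2, by omega⟩, .fast, 0⟩) hP hM hO hL hcap rfl rfl (by simp) (by simp) (by simp) le_rfl
  have hmeta := h.metadata
  -- The reader with more metadata accesses has at least half of the total `m`.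
  rcases le_total (metadataAccesses P α' ⟨⟨2, by omega⟩, .fast, 0⟩).ncard
    (metadataAccesses P α ⟨⟨0, by omega⟩, .fast, 0⟩).ncard with hle | hle
  · obtain ⟨E, h1, h2, h3, h4, h5⟩ := h.exists_execution hm rfl (by simp)
    have := Set.ncard_le_ncard h5 (finite_metadataAccesses _ _ _)
    exact ⟨E, _, h1, h2, rfl, h3, h4, by omega⟩
  · obtain ⟨E, h1, h2, h3, h4, h5⟩ := h.swap.exists_execution hm rfl (by simp)
    have := Set.ncard_le_ncard h5 (finite_metadataAccesses _ _ _)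
    exact ⟨E, _, h1, h2, rfl, h3, h4, by omega⟩

end Implementation

end Growth

end HybridTM

theorem mainTheorem10 :
    ∃ c : ℝ, 0 < c ∧
      ∀ (n : ℕ) (X V B W R Q : Type*), 3 ≤ n → Infinite X → Nontrivial V →
      ∀ (M : HybridTM.Implementation n X V B W R Q) (D : B → Option X),
        M.IsDataPartition D → M.Progressive → M.SatisfiesOpacity → M.ObstructionFreeLiveness →
        ∀ m : ℕ, 1 ≤ m →
          ∃ (E : List (HybridTM.Event n X V B W R)) (T : HybridTM.Txn n),
            M.IsExecution E ∧ T ∈ HybridTM.txns E ∧ T.path = .fast ∧ HybridTM.ReadOnly E T ∧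
            (((HybridTM.Dset E T).ncard ≤ m ∧ HybridTM.CapacityAborts E T) ∨
              ((HybridTM.Dset E T).ncard = m ∧
                c * (m : ℝ) ≤ ({b | D b = none ∧ HybridTM.Accesses E T b}.ncard : ℝ))) := by
  -- The factor `1 / 2` comes from sharing `m` metadata accesses between two readers. If
  -- `NoCapacityAborts` fails, its negation is the first alternative.
  refine ⟨1 / 2, by norm_num, fun n X V B W R Q hn _ _ M D hP hM hO hL m hm => ?_⟩
  by_cases hcap : M.NoCapacityAborts m
  · obtain ⟨E, T, h1, h2, h3, h4, h5, h6⟩ := hcap.exists_execution hP hM hO hL hn hm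
    refine ⟨E, T, h1, h2, h3, h4, .inr ⟨h5, ?_⟩⟩
    have h7 : (m : ℝ) ≤ 2 * ((HybridTM.metadataAccesses D E T).ncard : ℝ) := by exact_mod_cast h6
    rw [HybridTM.metadataAccesses] at h7
    linarith
  · simp only [HybridTM.Implementation.NoCapacityAborts, not_forall, not_not] at hcap
    obtain ⟨E, T, h1, h2, h3, h4, h5, h6⟩ := hcap
    exact ⟨E, T, h1, h2, h3, h4, .inl ⟨h5, h6⟩⟩
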